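/- Let $(\mathcal X,\nu)$ be a probability space, let $X_1,X_2,\dots$ be i.i.d. random variables with values in $\mathcal X$ and common distribution $\nu$, and let $f:\mathcal X^2\to\mathbb R$ be measurable with $\mathbb E\,f(X_1,X_2)^2<\infty$. Let $$f_\emptyset:=\mathbb E f(X_1,X_2),\quad f_1(x):=\int f(x,y)\,d\nu(y)-f_\emptyset,\quad f_2(y):=\int f(x,y)\,d\nu(x)-f_\emptyset,$$ $$f_{12}(x,y):=f(x,y)-f_1(x)-f_2(y)-f_\emptyset ,$$ and let $T_f$ be the integral operator $T_f\varphi(x)=\int f(x,y)\varphi(y)\,d\nu(y)$ on $L^2(\mathcal X,\nu)$. Define $$U_n:=\sum_{1\le i<j\le n}f(X_i,X_j),\qquad U^{c}_n:=\sum_{i\in\mathbb Z/n\mathbb Z}\ \sum_{1\le j<n/2}f(X_i,X_{i+j})\quad(\text{indices modulo } n),$$ $$U^{--}_n:=\sum_{1\le i<j\le n}(-1)^{i+j}f(X_i,X_j),\quad U^{+-}_n:=\sum_{1\le i<j\le n}(-1)^{j}f(X_i,X_j),\quad U^{-+}_n:=\sum_{1\le i<j\le n}(-1)^{i+1}f(X_i,X_j).$$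 Suppose that $f$ is symmetric and that $f=f_{12}$ (both almost everywhere with respect to $\nu\times\nu$). Then the nonzero eigenvalues of $T_f$, counted with multiplicities, form a finite or infinite sequence $(\lambda_r)_{r=1}^R$ of real numbers, and for every such enumeration the following holds. (i) As $n\to\infty$, each of $n^{-1}U_n$, $n^{-1}U^{c}_n$ and $n^{-1}U^{--}_n$ converges in distribution to $$\sum_{r=1}^R\tfrac12\lambda_r(\zeta_r^2-1),$$ where $\zeta_r$ are independent standard normal random variables. (ii) As $n\to\infty$, both $n^{-1}U^{+-}_n$ and $n^{-1}U^{-+}_n$ converge in distribution to $$\sum_{r=1}^R\lambda_r\xi_r,$$ where $\xi_r$ are i.i.d. random variables with characteristic function $\mathbb E e^{\mathrm i t\xi_r}=1/\sqrt{\cosh t}$, $t\in\mathbb R$ (a distribution with this characteristic function exists). The sums in (i) and (ii), which are infinite if $R=\infty$, converge unconditionally in $L^2$. -/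

import Mathlib

open MeasureTheory ProbabilityTheory Filter Topology
open scoped ENNReal

namespace UStat

section Statistics

variable {S : Type*}

/-! ### The five statistics of order two

A sample point is a sequence `x : ℕ → S`, where `x k` is the observation with number `k + 1`;
thus `x 0, …, x (n - 1)` are the observations with the numbers `1, …, n`. -/

/-- The ordinary `U`-statistic `∑_{1 ≤ i < j ≤ n} f(x_i, x_j)`. -/
def U (f : S → S → ℝ) (n : ℕ) (x : ℕ → S) : ℝ :=
  ∑ l ∈ Finset.range n, ∑ k ∈ Finset.range l, f (x k) (x l)

/-- The cyclic `U`-statistic `∑_{i ∈ ℤ/n} ∑_{1 ≤ j < n/2} f(x_i, x_{i+j})`, where the indices are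
read modulo `n`. -/
def Uc (f : S → S → ℝ) (n : ℕ) (x : ℕ → S) : ℝ :=
  ∑ k ∈ Finset.range n, ∑ j ∈ (Finset.range n).filter (fun j => 1 ≤ j ∧ 2 * j < n),
    f (x k) (x ((k + j) % n))

/-- The alternating statistic `∑_{1 ≤ i < j ≤ n} (-1)^(i+1) f(x_i, x_j)`. -/
def Ump (f : S → S → ℝ) (n : ℕ) (x : ℕ → S) : ℝ :=
  ∑ l ∈ Finset.range n, ∑ k ∈ Finset.range l, (-1) ^ ((k + 1) + 1) * f (x k) (x l)

/-- The alternating statistic `∑_{1 ≤ i < j ≤ n} (-1)^j f(x_i, x_j)`. -/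
def Upm (f : S → S → ℝ) (n : ℕ) (x : ℕ → S) : ℝ :=
  ∑ l ∈ Finset.range n, ∑ k ∈ Finset.range l, (-1) ^ (l + 1) * f (x k) (x l)

/-- The bi-alternating statistic `∑_{1 ≤ i < j ≤ n} (-1)^(i+j) f(x_i, x_j)`. -/
def Umm (f : S → S → ℝ) (n : ℕ) (x : ℕ → S) : ℝ :=
  ∑ l ∈ Finset.range n, ∑ k ∈ Finset.range l, (-1) ^ ((k + 1) + (l + 1)) * f (x k) (x l)

end Statistics

section Hoeffding

/-! ### The Hoeffding decomposition -/

variable {S : Type*} [MeasurableSpace S]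

/-- `f_∅ = E f(X₁, X₂)`. -/
noncomputable def hoeffding0 (ν : Measure S) (f : S → S → ℝ) : ℝ :=
  ∫ p, f p.1 p.2 ∂(ν.prod ν)

/-- `f₁(x) = E f(x, X) - f_∅`. -/
noncomputable def hoeffding1 (ν : Measure S) (f : S → S → ℝ) (x : S) : ℝ :=
  ∫ y, f x y ∂ν - hoeffding0 ν f

/-- `f₂(y) = E f(X, y) - f_∅`. -/
noncomputable def hoeffding2 (ν : Measure S) (f : S → S → ℝ) (y : S) : ℝ :=
  ∫ x, f x y ∂ν - hoeffding0 ν f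

/-- `f₁₂(x, y) = f(x, y) - f₁(x) - f₂(y) - f_∅`. -/
noncomputable def hoeffding12 (ν : Measure S) (f : S → S → ℝ) (x y : S) : ℝ :=
  f x y - hoeffding1 ν f x - hoeffding2 ν f y - hoeffding0 ν f

end Hoeffding

section Operator

/-! ### The integral operator with a square integrable kernel -/

variable {S : Type*} [MeasurableSpace S] {ν : Measure S} [IsProbabilityMeasure ν]

theorem memLp_section {g : S → S → ℝ} (hg : MemLp (Function.uncurry g) 2 (ν.prod ν)) :
    ∀ᵐ x ∂ν, MemLp (g x) 2 ν := by
  have h1 : Integrable (fun p : S × S => Function.uncurry g p ^ 2) (ν.prod ν) :=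
    (memLp_two_iff_integrable_sq hg.1).1 hg
  filter_upwards [h1.prod_right_ae, hg.1.prodMk_left] with x hx hx'
  exact (memLp_two_iff_integrable_sq hx').2 hx

theorem integrable_section_mul {g : S → S → ℝ}
    (hg : MemLp (Function.uncurry g) 2 (ν.prod ν)) {φ : S → ℝ} (hφ : MemLp φ 2 ν) :
    ∀ᵐ x ∂ν, Integrable (fun y => g x y * φ y) ν := by
  filter_upwards [memLp_section hg] with x hx
  exact hx.integrable_mul hφ

theorem memLp_integral_kernel {g : S → S → ℝ}
    (hg : MemLp (Function.uncurry g) 2 (ν.prod ν)) {φ : S → ℝ} (hφ : MemLp φ 2 ν) :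
    MemLp (fun x => ∫ y, g x y * φ y ∂ν) 2 ν := by
  have hm : AEStronglyMeasurable (fun p : S × S => g p.1 p.2 * φ p.2) (ν.prod ν) :=
    hg.1.mul hφ.1.comp_snd
  have hm' : AEStronglyMeasurable (fun x => ∫ y, g x y * φ y ∂ν) ν := hm.integral_prod_right'
  refine (memLp_two_iff_integrable_sq hm').2 ?_
  have h1 : Integrable (fun p : S × S => Function.uncurry g p ^ 2) (ν.prod ν) :=
    (memLp_two_iff_integrable_sq hg.1).1 hg
  have h2 : Integrable (fun x => (∫ y, g x y ^ 2 ∂ν) * ∫ y, φ y ^ 2 ∂ν) ν :=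
    h1.integral_prod_left.mul_const _
  refine h2.mono' (hm'.pow 2) ?_
  filter_upwards [memLp_section hg] with x hx
  have hip : inner ℝ (hx.toLp (g x)) (hφ.toLp φ) = ∫ y, g x y * φ y ∂ν := by
    rw [L2.inner_def]
    refine integral_congr_ae ?_
    filter_upwards [hx.coeFn_toLp, hφ.coeFn_toLp] with y h1 h2
    rw [h1, h2]
    simp [mul_comm]
  have hn : ∀ {ψ : S → ℝ} (hψ : MemLp ψ 2 ν),
      inner ℝ (hψ.toLp ψ) (hψ.toLp ψ) = ∫ y, ψ y ^ 2 ∂ν := by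
    intro ψ hψ
    rw [L2.inner_def]
    refine integral_congr_ae ?_
    filter_upwards [hψ.coeFn_toLp] with y h1
    rw [h1]
    simp [sq]
  have := real_inner_mul_inner_self_le (hx.toLp (g x)) (hφ.toLp φ)
  rw [hip, hn hx, hn hφ] at this
  rw [Real.norm_of_nonneg (by positivity), sq]
  exact this

/-- The integral operator `T_g φ(x) = ∫ g(x, y) φ(y) dν(y)` on `L²(S, ν)`. -/
noncomputable def integralOperator (g : S → S → ℝ)
    (hg : MemLp (Function.uncurry g) 2 (ν.prod ν)) : Module.End ℝ (Lp ℝ 2 ν) where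
  toFun φ := (memLp_integral_kernel hg (Lp.memLp φ)).toLp (fun x => ∫ y, g x y * φ y ∂ν)
  map_add' φ ψ := by
    rw [← MemLp.toLp_add, MemLp.toLp_eq_toLp_iff]
    filter_upwards [integrable_section_mul hg (Lp.memLp φ),
      integrable_section_mul hg (Lp.memLp ψ)] with x h1 h2
    rw [Pi.add_apply, ← integral_add h1 h2]
    refine integral_congr_ae ?_
    filter_upwards [Lp.coeFn_add φ ψ] with y hy
    rw [hy, Pi.add_apply, mul_add]
  map_smul' c φ := by
    rw [RingHom.id_apply, ← MemLp.toLp_const_smul, MemLp.toLp_eq_toLp_iff]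
    refine Eventually.of_forall fun x => ?_
    simp only [Pi.smul_apply, smul_eq_mul]
    rw [← integral_const_mul]
    refine integral_congr_ae ?_
    filter_upwards [Lp.coeFn_smul c φ] with y hy
    rw [hy, Pi.smul_apply, smul_eq_mul]
    ring

end Operator

/-- The family `lam` lists the nonzero eigenvalues of `T`, each of them as many times as its
multiplicity (the dimension of the eigenspace) says, and nothing else. -/
def IsNonzeroEigenvalues {E : Type*} [AddCommGroup E] [Module ℝ E] (T : Module.End ℝ E)
    {ι : Type*} (lam : ι → ℝ) : Prop :=
  (∀ r, lam r ≠ 0) ∧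
    ∀ c : ℝ, c ≠ 0 →
      {r | lam r = c}.encard = Cardinal.toENat (Module.rank ℝ (T.eigenspace c))

/-- The indices of a finite or infinite sequence of length `R`. -/
abbrev Idx (R : ℕ∞) : Type := {r : ℕ // (r : ℕ∞) < R}

/-- `W` is the sum `∑_r Y_r` of random variables, the series converging unconditionally in `L²`. -/
def IsL2Sum {Ω : Type*} [MeasurableSpace Ω] (P : Measure Ω) {ι : Type*} (Y : ι → Ω → ℝ)
    (W : Ω → ℝ) : Prop :=
  MemLp W 2 P ∧
    Tendsto (fun s : Finset ι => eLpNorm (fun ω => W ω - ∑ r ∈ s, Y r ω) 2 P) atTop (𝓝 0)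

/-- The real random variable `ξ` has the characteristic function `t ↦ 1 / √(cosh t)`. -/
def HasInvSqrtCoshCharFun {Ω : Type*} [MeasurableSpace Ω] (P : Measure Ω) (ξ : Ω → ℝ) : Prop :=
  AEMeasurable ξ P ∧
    ∀ t : ℝ, charFun (P.map ξ) t = ((1 / Real.sqrt (Real.cosh t) : ℝ) : ℂ)

end UStat

/-! The condition `f = f₁₂` makes both marginal means of `f` vanish
(`isDegenerate_of_ae_eq_hoeffding12`). Then the variables f(X_k, X_l), k < l, are orthogonal in L²,
so a weighted sum over pairs, divided by n, has second moment n⁻² · ∑ c² · ‖f‖²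
(`IsDegenerate.integral_weightedU_sq`). With bounded weights this is bounded uniformly in n, and two
errors become harmless: replacing `f` by a kernel close to it in L², and altering the weights on few
pairs.

The operator `T_f` is compact and self-adjoint, with square summable eigenvalues, and f = ∑ λ_r φ_r
⊗ φ_r in L² (`hasSum_eigenfunctions`). Degeneracy makes the φ_r centred. By the uniform bound it
suffices to treat finite partial sums of this expansion.

For weights w_k w_l with signs w, 2 ∑_{k<l} a_k a_l = (∑ a_k)² − ∑ a_k² with a_k = w_k φ_r(X_k). The
central limit theorem handles the square and the law of large numbers the diagonal, which gives ½
λ_r (ζ_r² − 1). This covers U and U⁻⁻. The cyclic statistic omits only the antipodal pairs, at most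
n of them, with an error of second moment O(1/n).

For U⁺⁻ and U⁻⁺ the weights are u_k v_l with orthogonal sign sequences u and v. The partial sums
weighted by u and by v then behave like independent Brownian motions, and the limit is the
stochastic integral of one against the other. To avoid continuous time, the indices are cut into M
blocks. Dropping the pairs inside a block costs O(1/M) in second moment, and the block sums converge
to independent normal variables, so that the limit for fixed M is a discrete stochastic integral
(`tendstoInDistribution_weightedU_block`). Its characteristic function is computed exactly:
integrating out the last pair of normals gives a Riccati recursion which hyperbolic cosines
linearise (`integral_exp_area`). As M → ∞ it tends to 1/√(cosh t) (`tendsto_charFun_area`), which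
also proves that this law exists.

All approximations are made on characteristic functions, which are Lipschitz in the L² distance of
the variables (`norm_charFun_sub_le`). -/

namespace UStat

/-! ### Characteristic function estimates and Lindeberg's theorem -/

section CharFun

open Complex

/-- A second order Taylor estimate for `exp (i x)`, with a remainder of Lindeberg type. -/
theorem norm_exp_mul_I_sub_taylor_le (x : ℝ) :
    ‖cexp (x * I) - (1 + x * I - x ^ 2 / 2)‖ ≤ 4 * (x ^ 2 * min 1 |x|) := by
  rcases le_total |x| 1 with hx | hx
  · have h := Complex.exp_bound (x := x * I) (by simpa using hx) (n := 3) (by norm_num)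
    have h2 : ∑ m ∈ Finset.range 3, ((x : ℂ) * I) ^ m / (m.factorial : ℂ)
        = 1 + x * I - x ^ 2 / 2 := by
      simp [Finset.sum_range_succ, mul_pow, Nat.factorial]
      ring
    rw [h2] at h
    refine h.trans ?_
    have h4 : x ^ 2 * |x| = |x| ^ 3 := by rw [← sq_abs]; ring
    rw [min_eq_right hx, h4]
    have h3 : 0 ≤ |x| ^ 3 := by positivity
    simp [Nat.factorial]
    nlinarith
  · rw [min_eq_left hx]
    have h1 : ‖cexp (x * I)‖ = 1 := Complex.norm_exp_ofReal_mul_I x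
    have h2 : ‖(1 + x * I - x ^ 2 / 2 : ℂ)‖ ≤ 1 + |x| + x ^ 2 / 2 := by
      refine (norm_sub_le _ _).trans (add_le_add ((norm_add_le _ _).trans ?_) ?_)
      · simp
      · simp
    refine (norm_sub_le _ _).trans ?_
    rw [h1]
    have : |x| ≤ x ^ 2 := by rw [← sq_abs]; nlinarith
    nlinarith

/-- Telescoping: one factor is exchanged at a time, and the remaining factors have norm at most 1.
-/
theorem norm_prod_sub_prod_le_sum {ι : Type*} (s : Finset ι) (a b : ι → ℂ)
    (ha : ∀ i ∈ s, ‖a i‖ ≤ 1) (hb : ∀ i ∈ s, ‖b i‖ ≤ 1) :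
    ‖∏ i ∈ s, a i - ∏ i ∈ s, b i‖ ≤ ∑ i ∈ s, ‖a i - b i‖ := by
  classical
  induction s using Finset.induction_on with
  | empty => simp
  | insert i s hi ih =>
    rw [Finset.prod_insert hi, Finset.prod_insert hi, Finset.sum_insert hi]
    have h1 : ‖∏ j ∈ s, b j‖ ≤ 1 := by
      rw [norm_prod]
      exact Finset.prod_le_one (fun _ _ => norm_nonneg _)
        fun j hj => hb j (Finset.mem_insert_of_mem hj)
    have h2 := ih (fun j hj => ha j (Finset.mem_insert_of_mem hj))
      (fun j hj => hb j (Finset.mem_insert_of_mem hj))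
    have h3 : a i * ∏ j ∈ s, a j - b i * ∏ j ∈ s, b j
        = (a i - b i) * ∏ j ∈ s, b j + a i * (∏ j ∈ s, a j - ∏ j ∈ s, b j) := by ring
    rw [h3]
    refine (norm_add_le _ _).trans (add_le_add ?_ ?_)
    · rw [norm_mul]
      exact mul_le_of_le_one_right (norm_nonneg _) h1
    · rw [norm_mul]
      exact (mul_le_of_le_one_left (norm_nonneg _) (ha i (Finset.mem_insert_self _ _))).trans h2

/-- The map s ↦ exp(is) is 1-Lipschitz, which bounds the difference by |t| E|A − B|. Nonnegativity
of the variance of |A − B| then passes from the first to the second moment. -/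
theorem norm_charFun_sub_le {Ω : Type*} [MeasurableSpace Ω] {P : Measure Ω}
    [IsProbabilityMeasure P] {A B : Ω → ℝ} (hA : AEMeasurable A P) (hB : AEMeasurable B P)
    (hAB : MemLp (fun ω => A ω - B ω) 2 P) (t : ℝ) :
    ‖charFun (P.map A) t - charFun (P.map B) t‖
      ≤ |t| * √(∫ ω, (A ω - B ω) ^ 2 ∂P) := by
  have hi : ∀ {C : Ω → ℝ}, AEMeasurable C P → Integrable (fun ω => cexp (t * C ω * I)) P := by
    intro C hC
    refine Integrable.of_bound (C := 1) (by fun_prop) (Eventually.of_forall fun ω => ?_)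
    rw [← ofReal_mul, Complex.norm_exp_ofReal_mul_I]
  have hmap : ∀ {C : Ω → ℝ}, AEMeasurable C P →
      charFun (P.map C) t = ∫ ω, cexp (t * C ω * I) ∂P := by
    intro C hC
    rw [charFun_apply_real, integral_map hC (by fun_prop)]
  rw [hmap hA, hmap hB, ← integral_sub (hi hA) (hi hB)]
  have h1 : ‖∫ ω, (cexp (t * A ω * I) - cexp (t * B ω * I)) ∂P‖
      ≤ ∫ ω, |t| * |A ω - B ω| ∂P := by
    refine norm_integral_le_of_norm_le ?_ (Eventually.of_forall fun ω => ?_)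
    · exact ((hAB.integrable (by norm_num)).abs).const_mul _
    · have h2 : cexp (t * A ω * I) - cexp (t * B ω * I)
          = cexp (((t * B ω : ℝ) : ℂ) * I) * (cexp (I * ((t * (A ω - B ω) : ℝ) : ℂ)) - 1) := by
        rw [mul_sub, ← Complex.exp_add, mul_one]
        push_cast
        ring_nf
      rw [h2, norm_mul, Complex.norm_exp_ofReal_mul_I, one_mul]
      refine Real.norm_exp_I_mul_ofReal_sub_one_le.trans ?_
      rw [Real.norm_eq_abs, abs_mul]
  refine h1.trans ?_
  rw [integral_const_mul]
  refine mul_le_mul_of_nonneg_left ?_ (abs_nonneg _)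
  refine Real.le_sqrt_of_sq_le ?_
  have h3 := variance_nonneg (fun ω => |A ω - B ω|) P
  have h4 : MemLp (fun ω => |A ω - B ω|) 2 P := hAB.abs
  rw [variance_eq_sub h4] at h3
  have h5 : ∫ ω, (A ω - B ω) ^ 2 ∂P = P[(fun ω => |A ω - B ω|) ^ 2] := by
    refine integral_congr_ae (Eventually.of_forall fun ω => ?_)
    simp
  rw [h5]
  linarith

/-- The truncated second moment which controls the Taylor remainder of a characteristic
function. -/
noncomputable def truncMoment {E : Type*} [NormedAddCommGroup E] [MeasurableSpace E]
    (μ : Measure E) (δ : ℝ) : ℝ := ∫ y, ‖y‖ ^ 2 * min 1 (δ * ‖y‖) ∂μ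

/-- Dominated convergence with majorant ‖y‖². The truncation by 1 is what makes a finite second
moment enough, without third moments. -/
theorem tendsto_truncMoment {E : Type*} [NormedAddCommGroup E] [MeasurableSpace E]
    [BorelSpace E] {μ : Measure E} (hμ : Integrable (fun y => ‖y‖ ^ 2) μ)
    {δ : ℕ → ℝ} (hδ0 : ∀ n, 0 ≤ δ n) (hδ : Tendsto δ atTop (𝓝 0)) :
    Tendsto (fun n => truncMoment μ (δ n)) atTop (𝓝 0) := by
  have h0 : (0 : ℝ) = ∫ y : E, (0 : ℝ) ∂μ := by simp
  rw [h0]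
  refine tendsto_integral_of_dominated_convergence (fun y => ‖y‖ ^ 2)
    (fun n => ?_) hμ (fun n => Eventually.of_forall fun y => ?_) (Eventually.of_forall fun y => ?_)
  · exact Measurable.aestronglyMeasurable (by fun_prop)
  · have h1 : 0 ≤ min 1 (δ n * ‖y‖) := le_min zero_le_one (mul_nonneg (hδ0 n) (norm_nonneg _))
    rw [Real.norm_of_nonneg (by positivity)]
    exact mul_le_of_le_one_right (by positivity) (min_le_left _ _)
  · have h1 : Tendsto (fun n => ‖y‖ ^ 2 * min 1 (δ n * ‖y‖)) atTop
        (𝓝 (‖y‖ ^ 2 * min 1 (0 * ‖y‖))) :=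
      tendsto_const_nhds.mul (tendsto_const_nhds.min (hδ.mul_const _))
    simpa using h1

variable {E : Type*} [NormedAddCommGroup E] [InnerProductSpace ℝ E] [FiniteDimensional ℝ E]
  [MeasurableSpace E] [BorelSpace E]

local notation "⟪" x ", " y "⟫" => inner ℝ x y

theorem norm_charFun_sub_taylor_le {μ : Measure E} [IsProbabilityMeasure μ]
    (hμ : Integrable (fun y => ‖y‖ ^ 2) μ) (h1 : ∀ θ : E, ∫ y, ⟪y, θ⟫ ∂μ = 0)
    (h2 : ∀ θ : E, ∫ y, ⟪y, θ⟫ ^ 2 ∂μ = ‖θ‖ ^ 2) {θ : E} {δ : ℝ} (hθ : ‖θ‖ ≤ δ) :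
    ‖charFun μ θ - (1 - ‖θ‖ ^ 2 / 2 : ℝ)‖ ≤ 4 * ‖θ‖ ^ 2 * truncMoment μ δ := by
  have hδ : 0 ≤ δ := (norm_nonneg _).trans hθ
  have hn : Integrable (fun y : E => ‖y‖) μ := by
    have : MemLp (fun y : E => ‖y‖) 2 μ :=
      (memLp_two_iff_integrable_sq (by fun_prop)).2 hμ
    exact this.integrable (by norm_num)
  have hin : Integrable (fun y : E => ⟪y, θ⟫) μ := by
    refine (hn.mul_const ‖θ‖).mono' (by fun_prop) (Eventually.of_forall fun y => ?_)
    exact norm_inner_le_norm _ _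
  have hsq : ∀ y : E, ⟪y, θ⟫ ^ 2 ≤ ‖θ‖ ^ 2 * ‖y‖ ^ 2 := by
    intro y
    rw [← mul_pow, mul_comm, ← sq_abs]
    gcongr
    exact abs_real_inner_le_norm _ _
  have hisq : Integrable (fun y : E => ⟪y, θ⟫ ^ 2) μ := by
    refine (hμ.const_mul (‖θ‖ ^ 2)).mono' (by fun_prop) (Eventually.of_forall fun y => ?_)
    rw [Real.norm_of_nonneg (sq_nonneg _)]
    exact hsq y
  have hexp : Integrable (fun y : E => cexp (⟪y, θ⟫ * I)) μ := by
    refine Integrable.of_bound (C := 1) (by fun_prop) (Eventually.of_forall fun ω => ?_)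
    rw [Complex.norm_exp_ofReal_mul_I]
  have hlin : Integrable (fun y : E => (1 + ⟪y, θ⟫ * I - ⟪y, θ⟫ ^ 2 / 2 : ℂ)) μ := by
    have h3 : Integrable (fun y : E => ((⟪y, θ⟫ ^ 2 : ℝ) : ℂ)) μ := hisq.ofReal
    have h4 : Integrable (fun y : E => ((⟪y, θ⟫ : ℝ) : ℂ)) μ := hin.ofReal
    push_cast at h3
    exact ((integrable_const _).add (h4.mul_const I)).sub (h3.div_const 2)
  have heq : ((1 - ‖θ‖ ^ 2 / 2 : ℝ) : ℂ)
      = ∫ y, (1 + ⟪y, θ⟫ * I - ⟪y, θ⟫ ^ 2 / 2 : ℂ) ∂μ := by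
    have h3 : Integrable (fun y : E => ((⟪y, θ⟫ ^ 2 : ℝ) : ℂ)) μ := hisq.ofReal
    have h4 : Integrable (fun y : E => ((⟪y, θ⟫ : ℝ) : ℂ)) μ := hin.ofReal
    have h5 : ∫ y, ((⟪y, θ⟫ ^ 2 : ℝ) : ℂ) ∂μ = ((‖θ‖ ^ 2 : ℝ) : ℂ) := by
      rw [integral_complex_ofReal, h2]
    have h6 : ∫ y, ((⟪y, θ⟫ : ℝ) : ℂ) ∂μ = 0 := by
      rw [integral_complex_ofReal, h1]; simp
    push_cast at h3 h5
    have h7 := integral_sub ((integrable_const (1 : ℂ)).add (h4.mul_const I)) (h3.div_const 2)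
    have h8 := integral_add (integrable_const (1 : ℂ)) (h4.mul_const I)
    simp only [Pi.add_apply] at h7
    rw [h7, h8, integral_mul_const, integral_div, h5, h6]
    simp
  rw [charFun_apply, heq, ← integral_sub hexp hlin]
  have hb : Integrable (fun y : E => 4 * ‖θ‖ ^ 2 * (‖y‖ ^ 2 * min 1 (δ * ‖y‖))) μ := by
    refine Integrable.const_mul ?_ _
    refine hμ.mono' (Measurable.aestronglyMeasurable (by fun_prop))
      (Eventually.of_forall fun y => ?_)
    have h1 : 0 ≤ min 1 (δ * ‖y‖) := le_min zero_le_one (mul_nonneg hδ (norm_nonneg _))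
    rw [Real.norm_of_nonneg (by positivity)]
    exact mul_le_of_le_one_right (by positivity) (min_le_left _ _)
  refine (norm_integral_le_of_norm_le hb (Eventually.of_forall fun y => ?_)).trans ?_
  · refine (norm_exp_mul_I_sub_taylor_le _).trans ?_
    rw [mul_assoc]
    refine mul_le_mul_of_nonneg_left ?_ (by norm_num)
    rw [← mul_assoc]
    have h7 : |⟪y, θ⟫| ≤ δ * ‖y‖ := by
      refine (abs_real_inner_le_norm _ _).trans ?_
      rw [mul_comm]
      gcongr
    refine mul_le_mul (hsq y) (min_le_min le_rfl h7) (le_min zero_le_one (abs_nonneg _))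
      (by positivity)
  · rw [integral_const_mul]
    rfl

/-- Lindeberg's limit theorem for weighted sums of i.i.d. vectors, in terms of characteristic
functions. -/
theorem tendsto_prod_charFun {μ : Measure E} [IsProbabilityMeasure μ]
    (hμ : Integrable (fun y => ‖y‖ ^ 2) μ) (h1 : ∀ θ : E, ∫ y, ⟪y, θ⟫ ∂μ = 0)
    (h2 : ∀ θ : E, ∫ y, ⟪y, θ⟫ ^ 2 ∂μ = ‖θ‖ ^ 2) (θ : ℕ → ℕ → E) {B τ : ℝ}
    (hB : ∀ n k, ‖θ n k‖ ≤ B)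
    (hτ : Tendsto (fun n : ℕ => (n : ℝ)⁻¹ * ∑ k ∈ Finset.range n, ‖θ n k‖ ^ 2) atTop (𝓝 τ)) :
    Tendsto (fun n : ℕ => ∏ k ∈ Finset.range n, charFun μ ((√n)⁻¹ • θ n k)) atTop
      (𝓝 (cexp (-τ / 2))) := by
  have hB0 : 0 ≤ B := (norm_nonneg _).trans (hB 0 0)
  have hgauss : ∀ n : ℕ, ∏ k ∈ Finset.range n,
      cexp (((-(‖(√n)⁻¹ • θ n k‖ ^ 2 / 2) : ℝ) : ℂ))
      = ((Real.exp (-((n : ℝ)⁻¹ * ∑ k ∈ Finset.range n, ‖θ n k‖ ^ 2) / 2) : ℝ) : ℂ) := by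
    intro n
    rw [← Complex.exp_sum, ofReal_exp, ← ofReal_sum]
    congr 2
    rw [Finset.mul_sum, ← Finset.sum_neg_distrib, Finset.sum_div]
    refine Finset.sum_congr rfl fun k _ => ?_
    rw [norm_smul, mul_pow, norm_inv, Real.norm_of_nonneg (Real.sqrt_nonneg _), inv_pow,
      Real.sq_sqrt (Nat.cast_nonneg _)]
    ring
  have hlim : Tendsto (fun n : ℕ => ∏ k ∈ Finset.range n,
      cexp (((-(‖(√n)⁻¹ • θ n k‖ ^ 2 / 2) : ℝ) : ℂ))) atTop (𝓝 (cexp (-τ / 2))) := by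
    simp_rw [hgauss]
    have h3 : cexp (-τ / 2) = ((Real.exp (-τ / 2) : ℝ) : ℂ) := by push_cast; rfl
    rw [h3]
    exact (continuous_ofReal.tendsto _).comp
      ((Real.continuous_exp.tendsto _).comp ((hτ.neg).div_const 2))
  have hδ : Tendsto (fun n : ℕ => B * (√n)⁻¹) atTop (𝓝 0) := by
    have : Tendsto (fun n : ℕ => (√n)⁻¹) atTop (𝓝 0) :=
      tendsto_inv_atTop_zero.comp (Real.tendsto_sqrt_atTop.comp tendsto_natCast_atTop_atTop)
    simpa using this.const_mul B
  have hnorm : ∀ (n k : ℕ), ‖(√(n : ℝ))⁻¹ • θ n k‖ ≤ B * (√n)⁻¹ := by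
    intro n k
    rw [norm_smul, norm_inv, Real.norm_of_nonneg (Real.sqrt_nonneg _), mul_comm]
    exact mul_le_mul_of_nonneg_right (hB n k) (by positivity)
  have hdiff : Tendsto (fun n : ℕ => ∏ k ∈ Finset.range n, charFun μ ((√n)⁻¹ • θ n k) -
      ∏ k ∈ Finset.range n, cexp (((-(‖(√n)⁻¹ • θ n k‖ ^ 2 / 2) : ℝ) : ℂ))) atTop (𝓝 0) := by
    -- Both kinds of factor are compared with 1 − ‖x‖²/2. Each of the n factors has an error of at
    -- most B²/n times a quantity that tends to zero, so the sum of the errors vanishes.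
    refine squeeze_zero_norm' (a := fun n : ℕ => 4 * B ^ 2 * truncMoment μ (B * (√n)⁻¹)
      + B ^ 2 * (B * (√n)⁻¹) ^ 2) ?_ ?_
    · have hev : ∀ᶠ n : ℕ in atTop, B * (√n)⁻¹ < 1 := hδ.eventually_lt_const one_pos
      filter_upwards [hev, eventually_gt_atTop 0] with n hn hn0
      have hn0' : (0 : ℝ) < n := by exact_mod_cast hn0
      refine (norm_prod_sub_prod_le_sum _ _ _ (fun _ _ => norm_charFun_le_one _) ?_).trans ?_
      · intro k _
        rw [← ofReal_exp, norm_real, Real.norm_of_nonneg (Real.exp_pos _).le, Real.exp_le_one_iff]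
        have : 0 ≤ ‖(√(n : ℝ))⁻¹ • θ n k‖ ^ 2 := by positivity
        linarith
      · have hterm : ∀ k ∈ Finset.range n, ‖charFun μ ((√n)⁻¹ • θ n k) -
            cexp (((-(‖(√n)⁻¹ • θ n k‖ ^ 2 / 2) : ℝ) : ℂ))‖
            ≤ (B * (√n)⁻¹) ^ 2 * (4 * truncMoment μ (B * (√n)⁻¹) + (B * (√n)⁻¹) ^ 2) := by
          intro k _
          have ha := norm_charFun_sub_taylor_le hμ h1 h2 (hnorm n k)
          set x := (√(n : ℝ))⁻¹ • θ n k with hx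
          set δ := B * (√(n : ℝ))⁻¹
          have hxδ : ‖x‖ ≤ δ := hnorm n k
          have hδ0 : 0 ≤ δ := (norm_nonneg _).trans hxδ
          have hT : 0 ≤ truncMoment μ δ := integral_nonneg fun y =>
            mul_nonneg (by positivity) (le_min zero_le_one (mul_nonneg hδ0 (norm_nonneg _)))
          have hx2 : ‖x‖ ^ 2 ≤ δ ^ 2 := by gcongr
          have hδ1 : δ ^ 2 ≤ 1 := by nlinarith
          have hx0 : 0 ≤ ‖x‖ ^ 2 := by positivity
          have hb : ‖((1 - ‖x‖ ^ 2 / 2 : ℝ) : ℂ) - cexp (((-(‖x‖ ^ 2 / 2) : ℝ) : ℂ))‖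
              ≤ (‖x‖ ^ 2) ^ 2 := by
            rw [← ofReal_exp, ← ofReal_sub, norm_real, norm_sub_rev]
            have h5 : ‖-(‖x‖ ^ 2 / 2)‖ ≤ 1 := by
              rw [norm_neg, Real.norm_of_nonneg (by positivity)]
              linarith
            have := Real.norm_exp_sub_one_sub_id_le h5
            have h6 : Real.exp (-(‖x‖ ^ 2 / 2)) - (1 - ‖x‖ ^ 2 / 2)
              = Real.exp (-(‖x‖ ^ 2 / 2)) - 1 - -(‖x‖ ^ 2 / 2) := by ring
            rw [h6]
            refine this.trans ?_
            rw [norm_neg, Real.norm_of_nonneg (by positivity)]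
            nlinarith
          refine (norm_sub_le_norm_sub_add_norm_sub _ ((1 - ‖x‖ ^ 2 / 2 : ℝ) : ℂ) _).trans ?_
          have h7 : 4 * ‖x‖ ^ 2 * truncMoment μ δ ≤ 4 * δ ^ 2 * truncMoment μ δ := by gcongr
          have h8 : (‖x‖ ^ 2) ^ 2 ≤ (δ ^ 2) ^ 2 := by gcongr
          nlinarith
        refine (Finset.sum_le_card_nsmul _ _ _ hterm).trans_eq ?_
        rw [Finset.card_range, nsmul_eq_mul, mul_pow, inv_pow, Real.sq_sqrt hn0'.le]
        field_simp
    · have h3 := tendsto_truncMoment hμ (δ := fun n : ℕ => B * (√n)⁻¹)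
        (fun n => by positivity) hδ
      simpa using (h3.const_mul (4 * B ^ 2)).add ((hδ.pow 2).const_mul (B ^ 2))
  simpa using hdiff.add hlim

end CharFun

/-! ### Joint central limit theorem for several weightings -/

section WeightedCLT

variable {S Ω Ω' : Type*} [MeasurableSpace S] [MeasurableSpace Ω] [MeasurableSpace Ω']
  {ν : Measure S} {P : Measure Ω} {P' : Measure Ω'}

/-- The functions `φ a` are measurable, centred and orthonormal in `L²(ν)`. -/
structure IsCenteredOrthonormal {d : Type*} (ν : Measure S) (φ : d → S → ℝ) : Prop where
  measurable : ∀ a, Measurable (φ a)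
  memLp : ∀ a, MemLp (φ a) 2 ν
  integral_eq_zero : ∀ a, ∫ x, φ a x ∂ν = 0
  integral_sq : ∀ a, ∫ x, φ a x * φ a x ∂ν = 1
  integral_mul : ∀ a b, a ≠ b → ∫ x, φ a x * φ b x ∂ν = 0

theorem IsCenteredOrthonormal.comp {d d' : Type*} {φ : d → S → ℝ}
    (h : IsCenteredOrthonormal ν φ) {e : d' → d} (he : Function.Injective e) :
    IsCenteredOrthonormal ν (fun a => φ (e a)) where
  measurable _ := h.measurable _
  memLp _ := h.memLp _
  integral_eq_zero _ := h.integral_eq_zero _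
  integral_sq _ := h.integral_sq _
  integral_mul _ _ hab := h.integral_mul _ _ (he.ne hab)

theorem charFun_map_gaussian_family {κ : Type*} [Fintype κ] {Z : κ → Ω' → ℝ}
    (hZ : ∀ i, HasLaw (Z i) (gaussianReal 0 1) P') (hZi : iIndepFun Z P')
    (t : EuclideanSpace ℝ κ) :
    charFun (P'.map (fun ω => WithLp.toLp 2 (fun i => Z i ω))) t
      = Complex.exp (-(‖t‖ ^ 2 : ℝ) / 2) := by
  have h1 : HasLaw (fun ω i => Z i ω) (Measure.pi fun _ : κ => gaussianReal 0 1) P' :=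
    hZi.hasLaw_pi hZ
  have h2 : P'.map (fun ω => WithLp.toLp 2 (fun i => Z i ω))
      = stdGaussian (EuclideanSpace ℝ κ) := by
    rw [← map_pi_eq_stdGaussian, ← h1.map_eq,
      AEMeasurable.map_map_of_aemeasurable (by fun_prop) h1.aemeasurable]
    rfl
  rw [h2, charFun_stdGaussian]
  push_cast
  rfl

/-- The central limit theorem for several bounded weightings of a sum of i.i.d. random vectors. -/
theorem tendstoInDistribution_weighted [IsProbabilityMeasure ν] [IsProbabilityMeasure P]
    [IsProbabilityMeasure P'] {d κ : Type*} [Fintype d] [Fintype κ]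
    {X : ℕ → Ω → S} (hXm : ∀ i, Measurable (X i)) (hXlaw : ∀ i, HasLaw (X i) ν P)
    (hXindep : iIndepFun X P) {φ : d → S → ℝ} (hφ : IsCenteredOrthonormal ν φ)
    (w : ℕ → κ → ℕ → ℝ) {B : ℝ} (hB : ∀ n p k, |w n p k| ≤ B)
    (hw : ∀ p, Tendsto (fun n : ℕ => (n : ℝ)⁻¹ * ∑ k ∈ Finset.range n, w n p k * w n p k)
      atTop (𝓝 1))
    (hw' : ∀ p q, p ≠ q →
      Tendsto (fun n : ℕ => (n : ℝ)⁻¹ * ∑ k ∈ Finset.range n, w n p k * w n q k) atTop (𝓝 0))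
    {Z : κ × d → Ω' → ℝ} (hZ : ∀ i, HasLaw (Z i) (gaussianReal 0 1) P') (hZi : iIndepFun Z P') :
    TendstoInDistribution
      (fun (n : ℕ) ω => (WithLp.toLp 2 (fun i : κ × d =>
        (√n)⁻¹ * ∑ k ∈ Finset.range n, w n i.1 k * φ i.2 (X k ω)) : EuclideanSpace ℝ (κ × d)))
      atTop (fun ω => WithLp.toLp 2 (fun i => Z i ω)) (fun _ => P) P' := by
  classical
  have hφm := hφ.measurable
  have hmeas : ∀ n : ℕ, Measurable (fun ω => (WithLp.toLp 2 (fun i : κ × d =>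
        (√n)⁻¹ * ∑ k ∈ Finset.range n, w n i.1 k * φ i.2 (X k ω)) : EuclideanSpace ℝ (κ × d))) := by
    intro n
    refine (WithLp.measurable_toLp 2 _).comp (measurable_pi_lambda _ fun i => ?_)
    exact (Finset.measurable_sum _ fun k _ =>
      (((hφm i.2).comp (hXm k)).const_mul _)).const_mul _
  have hZm : AEMeasurable (fun ω => (WithLp.toLp 2 (fun i => Z i ω) : EuclideanSpace ℝ (κ × d)))
      P' := (WithLp.measurable_toLp 2 _).comp_aemeasurable
        (aemeasurable_pi_lambda _ fun i => (hZ i).aemeasurable)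
  refine ⟨fun n => (hmeas n).aemeasurable, hZm, ?_⟩
  refine ProbabilityMeasure.tendsto_iff_tendsto_charFun.2 fun t => ?_
  simp only [ProbabilityMeasure.coe_mk]
  rw [charFun_map_gaussian_family hZ hZi]
  set Φ : S → EuclideanSpace ℝ d := fun x => WithLp.toLp 2 (fun a => φ a x) with hΦ
  have hΦm : Measurable Φ :=
    (WithLp.measurable_toLp 2 _).comp (measurable_pi_lambda _ fun a => hφm a)
  set μ : Measure (EuclideanSpace ℝ d) := ν.map Φ with hμdef
  have hμp : IsProbabilityMeasure μ := Measure.isProbabilityMeasure_map hΦm.aemeasurable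
  -- Collecting the terms with the same observation, the pairing of the random vector with `t` is
  -- (√n)⁻¹ ∑_k ⟨Φ(X_k), θ n k⟩, a sum of independent terms to which Lindeberg's theorem applies.
  set θ : ℕ → ℕ → EuclideanSpace ℝ d := fun n k => WithLp.toLp 2 (fun a =>
    ∑ p, t (p, a) * w n p k) with hθ
  have hprod : ∀ a b, Integrable (fun x => φ a x * φ b x) ν := fun a b =>
    (hφ.memLp a).integrable_mul (hφ.memLp b)
  have hinner : ∀ (x : S) (θ : EuclideanSpace ℝ d), inner ℝ (Φ x) θ = ∑ a, θ a * φ a x := by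
    intro x θ
    simp [hΦ, PiLp.inner_apply]
  have hμ : Integrable (fun y : EuclideanSpace ℝ d => ‖y‖ ^ 2) μ := by
    rw [hμdef, integrable_map_measure (by fun_prop) hΦm.aemeasurable]
    have : (fun y : EuclideanSpace ℝ d => ‖y‖ ^ 2) ∘ Φ = fun x => ∑ a, φ a x * φ a x := by
      ext x
      rw [Function.comp_apply, EuclideanSpace.real_norm_sq_eq]
      exact Finset.sum_congr rfl fun a _ => sq _
    rw [this]
    exact integrable_finsetSum _ fun a _ => hprod a a
  have h1 : ∀ θ : EuclideanSpace ℝ d, ∫ y, inner ℝ y θ ∂μ = 0 := by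
    intro θ
    rw [hμdef, integral_map hΦm.aemeasurable (by fun_prop)]
    simp_rw [hinner]
    rw [integral_finsetSum _ fun a _ => ((hφ.memLp a).integrable (by norm_num)).const_mul _]
    simp_rw [integral_const_mul, hφ.integral_eq_zero]
    simp
  have h2 : ∀ θ : EuclideanSpace ℝ d, ∫ y, inner ℝ y θ ^ 2 ∂μ = ‖θ‖ ^ 2 := by
    intro θ
    rw [hμdef, integral_map hΦm.aemeasurable (by fun_prop)]
    have h3 : ∀ x, inner ℝ (Φ x) θ ^ 2 = ∑ a, ∑ b, θ a * θ b * (φ a x * φ b x) := by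
      intro x
      rw [hinner, sq, Finset.sum_mul_sum]
      exact Finset.sum_congr rfl fun a _ => Finset.sum_congr rfl fun b _ => by ring
    simp_rw [h3]
    rw [integral_finsetSum _ fun a _ => integrable_finsetSum _ fun b _ =>
      (hprod a b).const_mul _]
    rw [EuclideanSpace.real_norm_sq_eq]
    refine Finset.sum_congr rfl fun a _ => ?_
    rw [integral_finsetSum _ fun b _ => (hprod a b).const_mul _, Finset.sum_eq_single a]
    · rw [integral_const_mul, hφ.integral_sq, mul_one, sq]
    · intro b _ hba
      rw [integral_const_mul, hφ.integral_mul a b hba.symm, mul_zero]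
    · simp
  have hθB : ∀ n k, ‖θ n k‖ ≤ √(∑ a, (∑ p, |t (p, a)| * B) ^ 2) := by
    intro n k
    refine Real.le_sqrt_of_sq_le ?_
    rw [EuclideanSpace.real_norm_sq_eq]
    refine Finset.sum_le_sum fun a _ => ?_
    rw [← sq_abs]
    gcongr
    refine (Finset.abs_sum_le_sum_abs _ _).trans (Finset.sum_le_sum fun p _ => ?_)
    rw [abs_mul]
    exact mul_le_mul_of_nonneg_left (hB n p k) (abs_nonneg _)
  have hτ : Tendsto (fun n : ℕ => (n : ℝ)⁻¹ * ∑ k ∈ Finset.range n, ‖θ n k‖ ^ 2) atTop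
      (𝓝 (‖t‖ ^ 2)) := by
    have h3 : ∀ n : ℕ, (n : ℝ)⁻¹ * ∑ k ∈ Finset.range n, ‖θ n k‖ ^ 2
        = ∑ a, ∑ p, ∑ q, t (p, a) * t (q, a) *
          ((n : ℝ)⁻¹ * ∑ k ∈ Finset.range n, w n p k * w n q k) := by
      intro n
      simp_rw [EuclideanSpace.real_norm_sq_eq, hθ, sq, Finset.sum_mul_sum, Finset.mul_sum]
      rw [Finset.sum_comm]
      refine Finset.sum_congr rfl fun a _ => ?_
      rw [Finset.sum_comm]
      refine Finset.sum_congr rfl fun p _ => ?_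
      rw [Finset.sum_comm]
      refine Finset.sum_congr rfl fun q _ => ?_
      exact Finset.sum_congr rfl fun k _ => by ring
    have h4 : ‖t‖ ^ 2 = ∑ a, ∑ p, ∑ q, t (p, a) * t (q, a) * (if p = q then 1 else 0) := by
      rw [EuclideanSpace.real_norm_sq_eq, Fintype.sum_prod_type, Finset.sum_comm]
      refine Finset.sum_congr rfl fun a _ => Finset.sum_congr rfl fun p _ => ?_
      simp [sq]
    simp_rw [h3]
    rw [h4]
    refine tendsto_finsetSum _ fun a _ => tendsto_finsetSum _ fun p _ =>
      tendsto_finsetSum _ fun q _ => Tendsto.const_mul _ ?_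
    split_ifs with hpq
    · subst hpq
      exact hw p
    · exact hw' p q hpq
  have key := tendsto_prod_charFun hμ h1 h2 θ hθB hτ
  refine key.congr fun n => ?_
  set Y : ℕ → Ω → ℝ := fun k ω => inner ℝ (Φ (X k ω)) ((√n)⁻¹ • θ n k) with hY
  have hYm : ∀ k, Measurable (Y k) := fun k =>
    (hΦm.comp (hXm k)).inner_const
  have hYi : iIndepFun Y P := by
    exact hXindep.comp (fun k x => inner ℝ (Φ x) ((√n)⁻¹ • θ n k))
      (fun k => hΦm.inner_const)
  have hvec : ∀ ω, inner ℝ (WithLp.toLp 2 (fun i : κ × d =>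
      (√n)⁻¹ * ∑ k ∈ Finset.range n, w n i.1 k * φ i.2 (X k ω)) : EuclideanSpace ℝ (κ × d)) t
      = ∑ k ∈ Finset.range n, Y k ω := by
    intro ω
    simp only [hY, hinner, PiLp.inner_apply, Fintype.sum_prod_type, hθ]
    simp only [PiLp.smul_apply, smul_eq_mul, RCLike.inner_apply, conj_trivial, Finset.mul_sum,
      Finset.sum_mul]
    rw [Finset.sum_comm]
    rw [Finset.sum_comm (s := Finset.range n)]
    refine Finset.sum_congr rfl fun a _ => ?_
    rw [Finset.sum_comm]
    refine Finset.sum_congr rfl fun k _ => Finset.sum_congr rfl fun p _ => ?_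
    ring
  have hcf : ∀ k, charFun μ ((√n)⁻¹ • θ n k) = charFun (P.map (Y k)) 1 := by
    intro k
    have e1 : ν = P.map (X k) := (hXlaw k).map_eq.symm
    rw [hμdef, charFun_apply, charFun_apply_real, integral_map hΦm.aemeasurable (by fun_prop),
      integral_map (hYm k).aemeasurable (by fun_prop), e1, integral_map (hXm k).aemeasurable]
    · simp [hY]
    · refine Measurable.aestronglyMeasurable ?_
      have : Measurable (fun x => inner ℝ (Φ x) ((√(n : ℝ))⁻¹ • θ n k)) := hΦm.inner_const
      fun_prop
  simp_rw [hcf]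
  have h5 := congrFun ((hYi.restrict (Finset.range n)).charFun_map_fun_finsetSum_eq_prod
    (fun k _ => (hYm k).aemeasurable)) (1 : ℝ)
  rw [Finset.prod_apply] at h5
  rw [← h5, charFun_apply_real, charFun_apply,
    integral_map (Finset.measurable_sum _ fun k _ => hYm k).aemeasurable (by fun_prop),
    integral_map (hmeas n).aemeasurable (by fun_prop)]
  simp_rw [hvec]
  simp

end WeightedCLT

/-! ### Degenerate kernels: orthogonality and second moments -/

section Degenerate

variable {S Ω : Type*} [MeasurableSpace S] [MeasurableSpace Ω]
  {ν : Measure S} {P : Measure Ω}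

/-- A measurable, square integrable kernel both of whose marginal means vanish. -/
structure IsDegenerate (ν : Measure S) (g : S → S → ℝ) : Prop where
  measurable : Measurable (Function.uncurry g)
  memLp : MemLp (Function.uncurry g) 2 (ν.prod ν)
  left : ∀ᵐ y ∂ν, ∫ x, g x y ∂ν = 0
  right : ∀ᵐ x ∂ν, ∫ y, g x y ∂ν = 0

/-- By independence and Fubini, `A` can be integrated out first, and this already gives zero. If the
product is not integrable, its Bochner integral is zero by convention, so no integrability is
assumed. -/
theorem integral_mul_eq_zero_of_indepFun {β : Type*} [MeasurableSpace β]
    [IsProbabilityMeasure ν] [IsProbabilityMeasure P] {A : Ω → S}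
    {B : Ω → β} (hA : Measurable A) (hB : Measurable B) (hAl : HasLaw A ν P) (hAB : IndepFun A B P)
    {c : β → S} (hc : Measurable c) (hcl : HasLaw (fun ω => c (B ω)) ν P)
    {g : S → S → ℝ} (hg : Measurable (Function.uncurry g)) (hg0 : ∀ᵐ y ∂ν, ∫ x, g x y ∂ν = 0)
    {h : β → ℝ} (hh : Measurable h) :
    ∫ ω, g (A ω) (c (B ω)) * h (B ω) ∂P = 0 := by
  have hBp : IsProbabilityMeasure (P.map B) := Measure.isProbabilityMeasure_map hB.aemeasurable
  have hF : Measurable (fun p : S × β => g p.1 (c p.2) * h p.2) :=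
    (hg.comp (measurable_fst.prodMk (hc.comp measurable_snd))).mul (hh.comp measurable_snd)
  have h1 : P.map (fun ω => (A ω, B ω)) = ν.prod (P.map B) := by
    rw [(indepFun_iff_map_prod_eq_prod_map_map hA.aemeasurable hB.aemeasurable).1 hAB, hAl.map_eq]
  have h2 : ∫ ω, g (A ω) (c (B ω)) * h (B ω) ∂P
      = ∫ p, g p.1 (c p.2) * h p.2 ∂(ν.prod (P.map B)) := by
    rw [← h1, integral_map (hA.prodMk hB).aemeasurable hF.aestronglyMeasurable]
  rw [h2]
  by_cases hi : Integrable (fun p : S × β => g p.1 (c p.2) * h p.2) (ν.prod (P.map B))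
  · rw [integral_prod_symm _ hi]
    have h3 : ∀ᵐ b ∂(P.map B), ∫ x, g x (c b) ∂ν = 0 := by
      have h4 : (P.map B).map c = ν := by
        rw [Measure.map_map hc hB]
        exact hcl.map_eq
      rw [← h4] at hg0
      refine (ae_of_ae_map hc.aemeasurable hg0).mono fun b hb => ?_
      rw [h4] at hb
      exact hb
    refine integral_eq_zero_of_ae (h3.mono fun b hb => ?_)
    simp only [Pi.zero_apply]
    rw [integral_mul_const, hb, zero_mul]
  · exact integral_undef hi

variable {X : ℕ → Ω → S}

theorem hasLaw_pair [IsProbabilityMeasure P] (hXm : ∀ i, Measurable (X i))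
    (hXlaw : ∀ i, HasLaw (X i) ν P)
    (hXindep : iIndepFun X P) {k l : ℕ} (hkl : k ≠ l) :
    HasLaw (fun ω => (X k ω, X l ω)) (ν.prod ν) P where
  aemeasurable := ((hXm k).prodMk (hXm l)).aemeasurable
  map_eq := by
    rw [(indepFun_iff_map_prod_eq_prod_map_map (hXm k).aemeasurable (hXm l).aemeasurable).1
      (hXindep.indepFun hkl), (hXlaw k).map_eq, (hXlaw l).map_eq]

/-- The indices `l`, `k'`, `l'` may coincide with each other, so that pairs sharing an observation
are covered. -/
theorem indepFun_triple [IsProbabilityMeasure P] (hXm : ∀ i, Measurable (X i))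
    (hXindep : iIndepFun X P) {k l k' l' : ℕ} (h1 : k ≠ l) (h2 : k ≠ k') (h3 : k ≠ l') :
    IndepFun (X k) (fun ω => (X l ω, X k' ω, X l' ω)) P := by
  have h := hXindep.indepFun_finset {k} {l, k', l'} (by simp [h1, h2, h3]) hXm
  have hu : Measurable (fun z : (({k} : Finset ℕ) → S) => z ⟨k, by simp⟩) := measurable_pi_apply _
  have hv : Measurable (fun z : (({l, k', l'} : Finset ℕ) → S) =>
      (z ⟨l, by simp⟩, z ⟨k', by simp⟩, z ⟨l', by simp⟩)) :=
    (measurable_pi_apply _).prodMk ((measurable_pi_apply _).prodMk (measurable_pi_apply _))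
  exact h.comp hu hv

theorem integral_sq_sum_of_orthogonal {ι : Type*} (s : Finset ι) (Y : ι → Ω → ℝ)
    (hY : ∀ i ∈ s, MemLp (Y i) 2 P)
    (h0 : ∀ i ∈ s, ∀ j ∈ s, i ≠ j → ∫ ω, Y i ω * Y j ω ∂P = 0) :
    ∫ ω, (∑ i ∈ s, Y i ω) ^ 2 ∂P = ∑ i ∈ s, ∫ ω, Y i ω * Y i ω ∂P := by
  have hi : ∀ i ∈ s, ∀ j ∈ s, Integrable (fun ω => Y i ω * Y j ω) P := fun i h j h' =>
    (hY i h).integrable_mul (hY j h')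
  simp_rw [sq, Finset.sum_mul_sum]
  rw [integral_finsetSum _ fun i h => integrable_finsetSum _ fun j h' => hi i h j h']
  refine Finset.sum_congr rfl fun i h => ?_
  rw [integral_finsetSum _ fun j h' => hi i h j h']
  exact Finset.sum_eq_single_of_mem i h fun j hj hji => h0 i h j hj hji.symm

variable [IsProbabilityMeasure P]

theorem IsDegenerate.memLp_comp {g : S → S → ℝ} (hg : IsDegenerate ν g)
    (hXm : ∀ i, Measurable (X i)) (hXlaw : ∀ i, HasLaw (X i) ν P)
    (hXindep : iIndepFun X P) {k l : ℕ} (hkl : k ≠ l) :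
    MemLp (fun ω => g (X k ω) (X l ω)) 2 P := by
  have h := hasLaw_pair hXm hXlaw hXindep hkl
  have h1 := hg.memLp
  rw [← h.map_eq] at h1
  exact h1.comp_of_map h.aemeasurable

theorem IsDegenerate.integral_comp_sq {g : S → S → ℝ} (hg : IsDegenerate ν g)
    (hXm : ∀ i, Measurable (X i)) (hXlaw : ∀ i, HasLaw (X i) ν P)
    (hXindep : iIndepFun X P) {k l : ℕ} (hkl : k ≠ l) :
    ∫ ω, g (X k ω) (X l ω) * g (X k ω) (X l ω) ∂P = ∫ p, g p.1 p.2 ^ 2 ∂(ν.prod ν) := by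
  have h := hasLaw_pair hXm hXlaw hXindep hkl
  rw [← h.map_eq, integral_map h.aemeasurable]
  · simp only [sq]
  · exact (hg.measurable.pow_const 2).aestronglyMeasurable

/-- Two different increasing pairs of indices cannot contain the same two numbers, so `k` or `l` is
absent from the second pair. That observation is integrated out, using the left or the right
marginal mean respectively. -/
theorem IsDegenerate.integral_comp_mul [IsProbabilityMeasure ν] {g : S → S → ℝ} (hg : IsDegenerate ν g)
    (hXm : ∀ i, Measurable (X i)) (hXlaw : ∀ i, HasLaw (X i) ν P)
    (hXindep : iIndepFun X P) {k l k' l' : ℕ} (hkl : k < l) (hkl' : k' < l')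
    (hne : ¬(k = k' ∧ l = l')) :
    ∫ ω, g (X k ω) (X l ω) * g (X k' ω) (X l' ω) ∂P = 0 := by
  have hh : Measurable (fun b : S × S × S => g b.2.1 b.2.2) :=
    hg.measurable.comp measurable_snd
  by_cases hk : k ≠ k' ∧ k ≠ l'
  · exact integral_mul_eq_zero_of_indepFun (hXm k)
      ((hXm l).prodMk ((hXm k').prodMk (hXm l'))) (hXlaw k)
      (indepFun_triple hXm hXindep hkl.ne hk.1 hk.2) measurable_fst (hXlaw l)
      hg.measurable hg.left hh
  · have hl : l ≠ k' ∧ l ≠ l' := by omega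
    have hsw : Measurable (Function.uncurry fun x y => g y x) := hg.measurable.comp measurable_swap
    exact integral_mul_eq_zero_of_indepFun (g := fun x y => g y x) (hXm l)
      ((hXm k).prodMk ((hXm k').prodMk (hXm l'))) (hXlaw l)
      (indepFun_triple hXm hXindep hkl.ne' hl.1 hl.2) measurable_fst (hXlaw k)
      hsw hg.right hh

/-- The statistic `∑_{k < l < n} c k l * g (x k) (x l)`. -/
def weightedU (c : ℕ → ℕ → ℝ) (g : S → S → ℝ) (n : ℕ) (x : ℕ → S) : ℝ :=
  ∑ l ∈ Finset.range n, ∑ k ∈ Finset.range l, c k l * g (x k) (x l)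

theorem IsDegenerate.memLp_weightedU {g : S → S → ℝ} (hg : IsDegenerate ν g)
    (hXm : ∀ i, Measurable (X i)) (hXlaw : ∀ i, HasLaw (X i) ν P)
    (hXindep : iIndepFun X P) (c : ℕ → ℕ → ℝ) (n : ℕ) :
    MemLp (fun ω => weightedU c g n fun i => X i ω) 2 P :=
  memLp_finsetSum _ fun _ _ => memLp_finsetSum _ fun _ hk =>
    (hg.memLp_comp hXm hXlaw hXindep (Finset.mem_range.1 hk).ne).const_mul _

/-- The second moment of a weighted `U`-statistic with a degenerate kernel. -/
theorem IsDegenerate.integral_weightedU_sq [IsProbabilityMeasure ν] {g : S → S → ℝ} (hg : IsDegenerate ν g)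
    (hXm : ∀ i, Measurable (X i)) (hXlaw : ∀ i, HasLaw (X i) ν P)
    (hXindep : iIndepFun X P) (c : ℕ → ℕ → ℝ) (n : ℕ) :
    ∫ ω, (weightedU c g n fun i => X i ω) ^ 2 ∂P
      = (∑ l ∈ Finset.range n, ∑ k ∈ Finset.range l, c k l ^ 2) *
        ∫ p, g p.1 p.2 ^ 2 ∂(ν.prod ν) := by
  simp only [weightedU]
  have hmem : ∀ {i : Σ _ : ℕ, ℕ}, i ∈ (Finset.range n).sigma (fun l => Finset.range l) →
      i.2 < i.1 := by
    intro i hi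
    exact Finset.mem_range.1 (Finset.mem_sigma.1 hi).2
  simp_rw [Finset.sum_sigma']
  rw [integral_sq_sum_of_orthogonal, Finset.sum_mul]
  · refine Finset.sum_congr rfl fun i hi => ?_
    have h := hg.integral_comp_sq hXm hXlaw hXindep (hmem hi).ne
    rw [← h, ← integral_const_mul]
    exact integral_congr_ae (Eventually.of_forall fun ω => by ring)
  · exact fun i hi => (hg.memLp_comp hXm hXlaw hXindep (hmem hi).ne).const_mul _
  · rintro ⟨l, k⟩ hi ⟨l', k'⟩ hj hij
    have h := hg.integral_comp_mul hXm hXlaw hXindep (hmem hi) (hmem hj) (by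
      rintro ⟨h1, h2⟩
      simp only at h1 h2
      subst h1 h2
      exact hij rfl)
    have h2 : ∀ ω, c k l * g (X k ω) (X l ω) * (c k' l' * g (X k' ω) (X l' ω))
      = c k l * c k' l' * (g (X k ω) (X l ω) * g (X k' ω) (X l' ω)) := fun ω => by ring
    simp only [h2]
    rw [integral_const_mul, h, mul_zero]

end Degenerate

/-! ### Tensor products in L² and operators with an L² kernel -/

section Tensor

variable {S : Type*} [MeasurableSpace S] {ν : Measure S}

theorem memLp_tensor [SFinite ν] {a b : S → ℝ} (ha : MemLp a 2 ν) (hb : MemLp b 2 ν) :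
    MemLp (fun p : S × S => a p.1 * b p.2) 2 (ν.prod ν) := by
  refine (memLp_two_iff_integrable_sq (ha.1.comp_fst.mul hb.1.comp_snd)).2 ?_
  have h := ((memLp_two_iff_integrable_sq ha.1).1 ha).mul_prod
    ((memLp_two_iff_integrable_sq hb.1).1 hb)
  refine h.congr (Eventually.of_forall fun p => ?_)
  simp only [mul_pow, Pi.mul_apply]

theorem ae_fst_of_ae [SFinite ν] {p : S → Prop} (h : ∀ᵐ x ∂ν, p x) : ∀ᵐ q ∂(ν.prod ν), p q.1 :=
  Measure.quasiMeasurePreserving_fst.ae h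

theorem ae_snd_of_ae [SFinite ν] {p : S → Prop} (h : ∀ᵐ x ∂ν, p x) : ∀ᵐ q ∂(ν.prod ν), p q.2 :=
  Measure.quasiMeasurePreserving_snd.ae h

variable [IsProbabilityMeasure ν]

/-- The tensor product `(x, y) ↦ a x * b y` of two square integrable functions. -/
noncomputable def tensor (a b : Lp ℝ 2 ν) : Lp ℝ 2 (ν.prod ν) :=
  (memLp_tensor (Lp.memLp a) (Lp.memLp b)).toLp _

theorem coeFn_tensor (a b : Lp ℝ 2 ν) :
    tensor a b =ᵐ[ν.prod ν] fun p => a p.1 * b p.2 := MemLp.coeFn_toLp _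

theorem inner_tensor (G : Lp ℝ 2 (ν.prod ν)) (a b : Lp ℝ 2 ν) :
    inner ℝ G (tensor a b) = ∫ p, G p * (a p.1 * b p.2) ∂(ν.prod ν) := by
  rw [L2.inner_def]
  refine integral_congr_ae ((coeFn_tensor a b).mono fun p hp => ?_)
  simp [hp, mul_comm]

theorem inner_tensor_tensor (a b c d : Lp ℝ 2 ν) :
    inner ℝ (tensor c d) (tensor a b) = inner ℝ c a * inner ℝ d b := by
  rw [inner_tensor, L2.inner_def, L2.inner_def, ← integral_prod_mul]
  refine integral_congr_ae ((coeFn_tensor c d).mono fun p hp => ?_)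
  simp only [hp, RCLike.inner_apply, conj_trivial]
  ring

theorem norm_tensor (a b : Lp ℝ 2 ν) : ‖tensor a b‖ = ‖a‖ * ‖b‖ := by
  have h := inner_tensor_tensor a b a b
  simp only [real_inner_self_eq_norm_sq] at h
  rw [← mul_pow] at h
  exact (sq_eq_sq₀ (norm_nonneg _) (by positivity)).1 h

/-- The tensor product as a continuous bilinear map. -/
noncomputable def tensorL : Lp ℝ 2 ν →L[ℝ] Lp ℝ 2 ν →L[ℝ] Lp ℝ 2 (ν.prod ν) :=
  LinearMap.mkContinuous₂ (LinearMap.mk₂ ℝ tensor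
    (fun a a' b => by
      refine Lp.ext ?_
      filter_upwards [coeFn_tensor (a + a') b, coeFn_tensor a b, coeFn_tensor a' b,
        Lp.coeFn_add (tensor a b) (tensor a' b), ae_fst_of_ae (Lp.coeFn_add a a')]
        with p h1 h2 h3 h4 h5
      rw [h1, h4, Pi.add_apply, h2, h3, h5, Pi.add_apply, add_mul])
    (fun c a b => by
      refine Lp.ext ?_
      filter_upwards [coeFn_tensor (c • a) b, coeFn_tensor a b,
        Lp.coeFn_smul c (tensor a b), ae_fst_of_ae (Lp.coeFn_smul c a)] with p h1 h2 h3 h4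
      rw [h1, h3, Pi.smul_apply, h2, h4, Pi.smul_apply, smul_eq_mul, smul_eq_mul, mul_assoc])
    (fun a b b' => by
      refine Lp.ext ?_
      filter_upwards [coeFn_tensor a (b + b'), coeFn_tensor a b, coeFn_tensor a b',
        Lp.coeFn_add (tensor a b) (tensor a b'), ae_snd_of_ae (Lp.coeFn_add b b')]
        with p h1 h2 h3 h4 h5
      rw [h1, h4, Pi.add_apply, h2, h3, h5, Pi.add_apply, mul_add])
    (fun c a b => by
      refine Lp.ext ?_
      filter_upwards [coeFn_tensor a (c • b), coeFn_tensor a b,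
        Lp.coeFn_smul c (tensor a b), ae_snd_of_ae (Lp.coeFn_smul c b)] with p h1 h2 h3 h4
      rw [h1, h3, Pi.smul_apply, h2, h4, Pi.smul_apply, smul_eq_mul, smul_eq_mul]
      ring)) 1
    (fun a b => by simp [norm_tensor])

@[simp] theorem tensorL_apply (a b : Lp ℝ 2 ν) : tensorL a b = tensor a b := rfl

/-- Square integrable functions on a product are determined by their inner products with
tensors. -/
theorem eq_zero_of_inner_tensor (G : Lp ℝ 2 (ν.prod ν))
    (hG : ∀ a b, inner ℝ G (tensor a b) = 0) : G = 0 := by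
  have hint : Integrable G (ν.prod ν) := (Lp.memLp G).integrable (by norm_num)
  have hrect : ∀ A B : Set S, MeasurableSet A → MeasurableSet B →
      ∫ p in A ×ˢ B, G p ∂(ν.prod ν) = 0 := by
    intro A B hA hB
    have h := hG (indicatorConstLp 2 hA (measure_ne_top ν A) (1 : ℝ))
      (indicatorConstLp 2 hB (measure_ne_top ν B) (1 : ℝ))
    rw [inner_tensor] at h
    rw [← h, ← integral_indicator (hA.prod hB)]
    refine integral_congr_ae ?_
    filter_upwards [ae_fst_of_ae (indicatorConstLp_coeFn (p := 2) (hs := hA)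
        (hμs := measure_ne_top ν A) (c := (1 : ℝ))),
      ae_snd_of_ae (indicatorConstLp_coeFn (p := 2) (hs := hB)
        (hμs := measure_ne_top ν B) (c := (1 : ℝ)))] with p h1 h2
    rw [h1, h2]
    by_cases ha : p.1 ∈ A <;> by_cases hb : p.2 ∈ B <;> simp [Set.indicator, ha, hb]
  have hall : ∀ C : Set (S × S), MeasurableSet C → ∫ p in C, G p ∂(ν.prod ν) = 0 := by
    intro C hC
    induction C, hC using MeasurableSpace.induction_on_inter generateFrom_prod.symm
      isPiSystem_prod with
    | empty => simp
    | basic C hC =>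
      obtain ⟨A, hA, B, hB, rfl⟩ := hC
      exact hrect A B hA hB
    | compl C hC ih =>
      have h1 := integral_add_compl hC hint
      have h2 := hrect Set.univ Set.univ .univ .univ
      rw [Set.univ_prod_univ, setIntegral_univ] at h2
      rw [ih, h2, zero_add] at h1
      exact h1
    | iUnion C hd hC ih =>
      rw [integral_iUnion hC hd hint.integrableOn]
      simp [ih]
  have h0 : G =ᵐ[ν.prod ν] 0 :=
    hint.ae_eq_zero_of_forall_setIntegral_eq_zero fun s hs _ => hall s hs
  exact (Lp.eq_zero_iff_ae_eq_zero).2 h0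

/-- The operator on `L²(ν)` with the kernel `G`. -/
noncomputable def kernelOperator : Lp ℝ 2 (ν.prod ν) →L[ℝ] Lp ℝ 2 ν →L[ℝ] Lp ℝ 2 ν :=
  LinearMap.mkContinuous₂ (LinearMap.mk₂ ℝ
    (fun G b => (InnerProductSpace.toDual ℝ (Lp ℝ 2 ν)).symm (innerSL ℝ G ∘L tensorL.flip b))
    (fun G G' b => by rw [← map_add]; congr 1; ext; simp)
    (fun c G b => by
      refine ext_inner_right ℝ fun v => ?_
      rw [InnerProductSpace.toDual_symm_apply, inner_smul_left, InnerProductSpace.toDual_symm_apply]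
      simp)
    (fun G b b' => by rw [← map_add]; congr 1; ext; simp)
    (fun c G b => by
      refine ext_inner_right ℝ fun v => ?_
      rw [InnerProductSpace.toDual_symm_apply, inner_smul_left, InnerProductSpace.toDual_symm_apply]
      simp)) 1
    (fun G b => by
      simp only [LinearMap.mk₂_apply, LinearIsometryEquiv.norm_map, one_mul]
      refine ContinuousLinearMap.opNorm_le_bound _ (by positivity) fun a => ?_
      simp only [ContinuousLinearMap.comp_apply, ContinuousLinearMap.flip_apply, tensorL_apply,
        innerSL_apply_apply]
      refine (norm_inner_le_norm _ _).trans_eq ?_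
      rw [norm_tensor]
      ring)

theorem inner_kernelOperator (G : Lp ℝ 2 (ν.prod ν)) (a b : Lp ℝ 2 ν) :
    inner ℝ (kernelOperator G b) a = inner ℝ G (tensor a b) := by
  change inner ℝ ((InnerProductSpace.toDual ℝ (Lp ℝ 2 ν)).symm (innerSL ℝ G ∘L tensorL.flip b)) a
    = _
  rw [InnerProductSpace.toDual_symm_apply]
  simp

/-- A tensor gives an operator of rank at most one. Tensors span a dense subspace, the operator
depends continuously on its kernel, and compact operators form a closed set. -/
theorem isCompactOperator_kernelOperator (G : Lp ℝ 2 (ν.prod ν)) :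
    IsCompactOperator (kernelOperator G) := by
  let V : Submodule ℝ (Lp ℝ 2 (ν.prod ν)) :=
    Submodule.span ℝ (Set.range fun q : Lp ℝ 2 ν × Lp ℝ 2 ν => tensor q.1 q.2)
  have hV : Vᗮ = ⊥ := by
    rw [Submodule.eq_bot_iff]
    intro F hF
    refine eq_zero_of_inner_tensor F fun a b => ?_
    rw [real_inner_comm]
    exact (Submodule.mem_orthogonal _ _).1 hF _ (Submodule.subset_span ⟨(a, b), rfl⟩)
  have htop : V.topologicalClosure = ⊤ := Submodule.topologicalClosure_eq_top_iff.2 hV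
  let W : Submodule ℝ (Lp ℝ 2 (ν.prod ν)) :=
    (compactOperator (RingHom.id ℝ) (Lp ℝ 2 ν) (Lp ℝ 2 ν)).comap
      (kernelOperator (ν := ν)).toLinearMap
  have hWc : IsClosed (W : Set (Lp ℝ 2 (ν.prod ν))) :=
    isClosed_setOfPred_isCompactOperator.preimage (kernelOperator (ν := ν)).continuous
  have hVW : V ≤ W := by
    refine Submodule.span_le.2 ?_
    rintro _ ⟨⟨c, d⟩, rfl⟩
    change IsCompactOperator (kernelOperator (tensor c d))
    have h1 : kernelOperator (tensor c d)
        = (ContinuousLinearMap.toSpanSingleton ℝ c) ∘L (innerSL ℝ d) := by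
      ext1 b
      refine ext_inner_right ℝ fun a => ?_
      rw [inner_kernelOperator, inner_tensor_tensor]
      simp [inner_smul_left, mul_comm]
    rw [h1]
    have h2 : IsCompactOperator (innerSL ℝ d) :=
      isCompactOperator_of_locallyCompactSpace_dom (innerSL ℝ d)
    exact h2.clm_comp (ContinuousLinearMap.toSpanSingleton ℝ c)
  have hG : G ∈ V.topologicalClosure := htop ▸ Submodule.mem_top
  exact Submodule.topologicalClosure_minimal V hVW hWc hG

theorem isSymmetric_kernelOperator {G : Lp ℝ 2 (ν.prod ν)}
    (hG : ∀ᵐ p ∂(ν.prod ν), G p = G p.swap) : (kernelOperator G).IsSymmetric := by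
  intro b a
  change inner ℝ (kernelOperator G b) a = inner ℝ b (kernelOperator G a)
  rw [real_inner_comm (kernelOperator G a) b, inner_kernelOperator, inner_kernelOperator, inner_tensor, inner_tensor,
    ← (Measure.measurePreserving_swap (μ := ν) (ν := ν)).integral_comp
      MeasurableEquiv.prodComm.measurableEmbedding]
  refine integral_congr_ae (hG.mono fun p hp => ?_)
  simp only [Prod.fst_swap, Prod.snd_swap]
  rw [← hp]
  ring

/-- The operator defined by duality with tensors is the pointwise one, by Fubini. This carries the
spectral results over to `integralOperator`. -/
theorem kernelOperator_toLp {f : S → S → ℝ} (hf : MemLp (Function.uncurry f) 2 (ν.prod ν)) :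
    (kernelOperator (hf.toLp _)).toLinearMap = integralOperator f hf := by
  ext1 b
  refine ext_inner_right ℝ fun a => ?_
  change inner ℝ (kernelOperator (hf.toLp _) b) a = _
  rw [inner_kernelOperator, inner_tensor, L2.inner_def]
  have h1 : ∫ p, (hf.toLp _ : S × S → ℝ) p * (a p.1 * b p.2) ∂(ν.prod ν)
      = ∫ p, f p.1 p.2 * (a p.1 * b p.2) ∂(ν.prod ν) :=
    integral_congr_ae (hf.coeFn_toLp.mono fun p hp => by
      simp only [hp, Function.uncurry])
  have hi : Integrable (fun p : S × S => f p.1 p.2 * (a p.1 * b p.2)) (ν.prod ν) :=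
    hf.integrable_mul (memLp_tensor (Lp.memLp a) (Lp.memLp b))
  rw [h1, integral_prod _ hi]
  refine integral_congr_ae ?_
  have h2 := (memLp_integral_kernel hf (Lp.memLp b)).coeFn_toLp
  filter_upwards [h2] with x hx
  change _ = inner ℝ ((memLp_integral_kernel hf (Lp.memLp b)).toLp _ x) (a x)
  rw [hx]
  simp only [RCLike.inner_apply, conj_trivial]
  rw [← integral_const_mul]
  refine integral_congr_ae (Eventually.of_forall fun y => ?_)
  simp only
  ring

end Tensor

/-! ### Spectral theory of compact symmetric operators -/

section Spectral

variable {H : Type*} [NormedAddCommGroup H] [InnerProductSpace ℝ H]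

theorem exists_orthonormal_of_encard_eq {E : Submodule ℝ H} [FiniteDimensional ℝ E] {ι : Type*}
    {A : Set ι} (h : A.encard = Cardinal.toENat (Module.rank ℝ E)) :
    ∃ b : A → H, Orthonormal ℝ b ∧ Submodule.span ℝ (Set.range b) = E := by
  have h1 : A.encard = (Module.finrank ℝ E : ℕ∞) := by
    rw [h, ← Module.finrank_eq_rank]
    simp
  have hfin : A.Finite := Set.finite_of_encard_eq_coe h1
  have : Fintype A := hfin.fintype
  have hcard : Fintype.card A = Module.finrank ℝ E := by
    have h2 : A.encard = (Fintype.card A : ℕ∞) := by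
      rw [← Set.coe_fintypeCard]
    rw [h2] at h1
    exact_mod_cast h1
  let e : Fin (Module.finrank ℝ E) ≃ A := (Fintype.equivFinOfCardEq hcard).symm
  let b := (stdOrthonormalBasis ℝ E).reindex e
  refine ⟨fun a => (b a : H), ?_, ?_⟩
  · exact b.orthonormal.comp_linearIsometry E.subtypeₗᵢ
  · have h3 : Set.range (fun a => (b a : H)) = E.subtype '' Set.range b := by
      rw [← Set.range_comp]
      rfl
    rw [h3, Submodule.span_image, ← OrthonormalBasis.coe_toBasis, b.toBasis.span_eq]
    simp

/-- The indices r with `lam r = c` are as many as the dimension of the eigenspace of c, so they can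
label an orthonormal basis of it. Different eigenspaces are orthogonal by symmetry. If b is
orthogonal to the whole family, then `T b` is orthogonal to every eigenspace, the kernel included,
and the spectral theorem gives `T b = 0`. -/
theorem exists_orthonormal_eigenfamily [CompleteSpace H] {T : H →L[ℝ] H} (hT : IsCompactOperator T)
    (hs : T.IsSymmetric) {ι : Type*} {lam : ι → ℝ}
    (hlam : IsNonzeroEigenvalues (T : Module.End ℝ H) lam) :
    ∃ φ : ι → H, Orthonormal ℝ φ ∧ (∀ r, T (φ r) = lam r • φ r) ∧
      ∀ b, (∀ r, inner ℝ (φ r) b = 0) → T b = 0 := by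
  classical
  have hex : ∀ c : ℝ, ∃ b : {r | lam r = c} → H, Orthonormal ℝ b ∧
      (∀ r, b r ∈ Module.End.eigenspace (T : Module.End ℝ H) c) ∧
      (c ≠ 0 → Submodule.span ℝ (Set.range b) = Module.End.eigenspace (T : Module.End ℝ H) c) := by
    intro c
    by_cases hc : c = 0
    · subst hc
      have : IsEmpty {r | lam r = 0} := ⟨fun r => hlam.1 r.1 r.2⟩
      exact ⟨fun _ => 0, ⟨fun r => isEmptyElim r, fun r => isEmptyElim r⟩,
        fun r => isEmptyElim r, fun h => absurd rfl h⟩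
    · have := ContinuousLinearMap.finite_dimensional_eigenspace hT c hc
      obtain ⟨b, hb1, hb2⟩ := exists_orthonormal_of_encard_eq (hlam.2 c hc)
      exact ⟨b, hb1, fun r => hb2 ▸ Submodule.subset_span ⟨r, rfl⟩, fun _ => hb2⟩
  choose b hb1 hb2 hb3 using hex
  -- The index type of `b c` depends on c; this identity moves vectors between equal values of c.
  have hφ : ∀ (c : ℝ) (r : ι) (h : lam r = c), b (lam r) ⟨r, rfl⟩ = b c ⟨r, h⟩ := by
    rintro _ r rfl
    rfl
  have heig : ∀ r, T (b (lam r) ⟨r, rfl⟩) = lam r • b (lam r) ⟨r, rfl⟩ := fun r =>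
    Module.End.mem_eigenspace_iff.1 (hb2 (lam r) ⟨r, rfl⟩)
  refine ⟨fun r => b (lam r) ⟨r, rfl⟩, ⟨fun r => (hb1 _).1 _, ?_⟩, heig, ?_⟩
  · intro r s hrs
    by_cases h : lam s = lam r
    · simp only
      rw [hφ (lam r) s h]
      exact (hb1 (lam r)).2 fun h' => hrs (congrArg Subtype.val h')
    · have h1 : inner ℝ (T (b (lam r) ⟨r, rfl⟩)) (b (lam s) ⟨s, rfl⟩)
          = inner ℝ (b (lam r) ⟨r, rfl⟩) (T (b (lam s) ⟨s, rfl⟩)) := hs _ _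
      rw [heig, heig, inner_smul_left, inner_smul_right] at h1
      simp only [conj_trivial] at h1
      have h2 : (lam s - lam r) * inner ℝ (b (lam r) ⟨r, rfl⟩) (b (lam s) ⟨s, rfl⟩) = 0 := by
        linarith
      exact (mul_eq_zero.1 h2).resolve_left (sub_ne_zero.2 h)
  · intro v hv
    have hbot := ContinuousLinearMap.orthogonalComplement_iSup_eigenspaces_eq_bot hT hs
    have hmem : T v ∈ (⨆ μ, Module.End.eigenspace (T : Module.End ℝ H) μ)ᗮ := by
      rw [← Submodule.iInf_orthogonal, Submodule.mem_iInf]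
      intro c
      rw [Submodule.mem_orthogonal]
      intro u hu
      have hTu : T u = c • u := Module.End.mem_eigenspace_iff.1 hu
      have h1 : inner ℝ u (T v) = c * inner ℝ u v := by
        have h2 : inner ℝ (T u) v = inner ℝ u (T v) := hs _ _
        rw [← h2, hTu, inner_smul_left]
        simp
      rw [h1]
      by_cases hc : c = 0
      · rw [hc, zero_mul]
      · have h3 : u ∈ Submodule.span ℝ (Set.range (b c)) := by
          rw [hb3 c hc]
          exact hu
        have h4 : Submodule.span ℝ (Set.range (b c)) ≤ (ℝ ∙ v)ᗮ := by
          refine Submodule.span_le.2 ?_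
          rintro _ ⟨⟨r, hr⟩, rfl⟩
          rw [SetLike.mem_coe, Submodule.mem_orthogonal_singleton_iff_inner_left, ← hφ c r hr]
          exact hv r
        rw [(Submodule.mem_orthogonal_singleton_iff_inner_left).1 (h4 h3), mul_zero]
    rw [hbot] at hmem
    exact (Submodule.mem_bot ℝ).1 hmem

/-- Every nonzero real is taken with as many labels as its eigenspace has dimensions; a number that
is not an eigenvalue gets none. -/
theorem exists_isNonzeroEigenvalues_sigma [CompleteSpace H] {T : H →L[ℝ] H} (hT : IsCompactOperator T) :
    ∃ (ι : Type) (lam : ι → ℝ), IsNonzeroEigenvalues (T : Module.End ℝ H) lam := by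
  refine ⟨Σ c : {c : ℝ // c ≠ 0}, Fin (Module.finrank ℝ
    (Module.End.eigenspace (T : Module.End ℝ H) c.1)), fun i => i.1.1, fun i => i.1.2, ?_⟩
  intro c hc
  have := ContinuousLinearMap.finite_dimensional_eigenspace hT c hc
  have h1 : {r : Σ c : {c : ℝ // c ≠ 0}, Fin (Module.finrank ℝ
      (Module.End.eigenspace (T : Module.End ℝ H) c.1)) | r.1.1 = c}
      = Set.range (fun j => ⟨⟨c, hc⟩, j⟩) := by
    ext ⟨⟨c', hc'⟩, j⟩
    constructor
    · intro h
      obtain rfl : c' = c := h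
      exact ⟨j, rfl⟩
    · rintro ⟨j', hj'⟩
      exact (congrArg (fun r => r.1.1) hj').symm
  rw [h1, ← Set.image_univ, Function.Injective.encard_image, Set.encard_univ, ENat.card_eq_coe_fintype_card,
    Fintype.card_fin, ← Module.finrank_eq_rank]
  · simp
  · intro j j' h
    simpa using h

theorem IsNonzeroEigenvalues.comp_equiv {T : Module.End ℝ H} {ι κ : Type*} {lam : ι → ℝ}
    (h : IsNonzeroEigenvalues T lam) (e : κ ≃ ι) : IsNonzeroEigenvalues T (lam ∘ e) := by
  refine ⟨fun r => h.1 _, fun c hc => ?_⟩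
  rw [← h.2 c hc]
  have h1 : {r | lam r = c} = e '' {r | (lam ∘ e) r = c} := by
    ext r
    simp only [Set.mem_ofPred_eq, Set.mem_image, Function.comp_apply]
    exact ⟨fun h => ⟨e.symm r, by simpa using h, by simp⟩, by rintro ⟨s, hs, rfl⟩; exact hs⟩
  rw [h1, e.injective.encard_image]

theorem exists_equiv_idx (ι : Type*) [Countable ι] : ∃ R : ℕ∞, Nonempty (Idx R ≃ ι) := by
  cases finite_or_infinite ι with
  | inl h =>
    have := Fintype.ofFinite ι
    refine ⟨(Fintype.card ι : ℕ∞), ⟨?_⟩⟩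
    let e1 : Idx (Fintype.card ι : ℕ∞) ≃ Fin (Fintype.card ι) :=
      { toFun := fun r => ⟨r.1, by exact_mod_cast r.2⟩
        invFun := fun r => ⟨r.1, by exact_mod_cast r.2⟩
        left_inv := fun _ => rfl
        right_inv := fun _ => rfl }
    exact e1.trans (Fintype.equivFin ι).symm
  | inr h =>
    obtain ⟨e⟩ := nonempty_equiv_of_countable (α := ℕ) (β := ι)
    exact ⟨⊤, ⟨(Equiv.subtypeUnivEquiv fun r => ENat.natCast_lt_top r).trans e⟩⟩

end Spectral

/-! ### Eigenfunction expansion of a kernel -/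

section KernelExpansion

variable {S : Type*} [MeasurableSpace S] {ν : Measure S} [IsProbabilityMeasure ν]

theorem orthonormal_tensor_self {ι : Type*} {φ : ι → Lp ℝ 2 ν} (hφ : Orthonormal ℝ φ) :
    Orthonormal ℝ (fun r => tensor (φ r) (φ r)) := by
  refine ⟨fun r => by rw [norm_tensor, hφ.1 r, mul_one], fun r s hrs => ?_⟩
  simp only
  rw [inner_tensor_tensor, hφ.2 hrs, zero_mul]

/-- Since λ_r = ⟨F, φ_r ⊗ φ_r⟩ and these tensors are orthonormal, this is Bessel's inequality. -/
theorem summable_sq_eigenvalues (F : Lp ℝ 2 (ν.prod ν)) {ι : Type*} {φ : ι → Lp ℝ 2 ν}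
    (hφ : Orthonormal ℝ φ) {lam : ι → ℝ} (heig : ∀ r, kernelOperator F (φ r) = lam r • φ r) :
    Summable fun r => lam r ^ 2 := by
  have h := (orthonormal_tensor_self hφ).inner_products_summable F
  refine h.congr fun r => ?_
  rw [real_inner_comm, ← inner_kernelOperator, heig, inner_smul_left, real_inner_self_eq_norm_sq,
    hφ.1 r]
  simp

theorem summable_smul_of_orthonormal {G : Type*} [NormedAddCommGroup G] [InnerProductSpace ℝ G]
    [CompleteSpace G] {ι : Type*} {v : ι → G} (hv : Orthonormal ℝ v) {c : ι → ℝ}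
    (hc : Summable fun r => c r ^ 2) : Summable fun r => c r • v r := by
  have h := hv.orthogonalFamily.summable_iff_norm_sq_summable (fun r => c r)
  simp only [LinearIsometry.toSpanSingleton_apply, Real.norm_eq_abs, sq_abs] at h
  exact h.2 hc

/-- The expansion of a symmetric kernel in the eigenfunctions of its operator. -/
theorem hasSum_eigenfunctions (F : Lp ℝ 2 (ν.prod ν)) {ι : Type*} {φ : ι → Lp ℝ 2 ν}
    (hφ : Orthonormal ℝ φ) {lam : ι → ℝ} (heig : ∀ r, kernelOperator F (φ r) = lam r • φ r)
    (hker : ∀ b, (∀ r, inner ℝ (φ r) b = 0) → kernelOperator F b = 0) :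
    HasSum (fun r => lam r • tensor (φ r) (φ r)) F := by
  have hsum : Summable fun r => lam r • tensor (φ r) (φ r) :=
    summable_smul_of_orthonormal (orthonormal_tensor_self hφ) (summable_sq_eigenvalues F hφ heig)
  obtain ⟨G, hG⟩ := hsum
  suffices h : F - G = 0 by
    rw [sub_eq_zero.1 h]
    exact hG
  have hGin : ∀ a b, HasSum (fun r => lam r * (inner ℝ (φ r) a * inner ℝ (φ r) b))
      (inner ℝ G (tensor a b)) := by
    intro a b
    have h1 := hG.mapL (innerSL ℝ (tensor a b))
    simp only [innerSL_apply_apply, inner_smul_right] at h1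
    rw [real_inner_comm]
    refine h1.congr_fun fun r => ?_
    rw [inner_tensor_tensor, real_inner_comm a, real_inner_comm b]
  have hφr : ∀ a s, inner ℝ (F - G) (tensor a (φ s)) = 0 := by
    intro a s
    have h1 : inner ℝ G (tensor a (φ s)) = lam s * inner ℝ (φ s) a := by
      refine (hGin a (φ s)).unique ?_
      convert hasSum_single s fun r hr => ?_ using 1
      · rw [real_inner_self_eq_norm_sq, hφ.1 s]
        ring
      · rw [hφ.2 hr]
        ring
    rw [inner_sub_left, h1, ← inner_kernelOperator, heig, inner_smul_left]
    simp
  have hperp : ∀ a b, (∀ r, inner ℝ (φ r) b = 0) → inner ℝ (F - G) (tensor a b) = 0 := by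
    intro a b hb
    have h1 : inner ℝ G (tensor a b) = 0 := by
      refine (hGin a b).unique ?_
      simp [hb, hasSum_zero]
    rw [inner_sub_left, h1, ← inner_kernelOperator, hker b hb]
    simp
  refine eq_zero_of_inner_tensor _ fun a b => ?_
  -- The vector `v` represents b ↦ ⟨F − G, a ⊗ b⟩. By `hφr` it is orthogonal to every φ_s, so
  -- `hperp` applies to b = v and gives ⟨v, v⟩ = 0.
  set v := (InnerProductSpace.toDual ℝ (Lp ℝ 2 ν)).symm (innerSL ℝ (F - G) ∘L tensorL a) with hvdef
  have hv : ∀ b, inner ℝ v b = inner ℝ (F - G) (tensor a b) := by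
    intro b
    rw [hvdef, InnerProductSpace.toDual_symm_apply]
    simp only [ContinuousLinearMap.comp_apply, tensorL_apply, innerSL_apply_apply]
  have h0 : v = 0 := by
    rw [← inner_self_eq_zero (𝕜 := ℝ), hv]
    refine hperp a v fun r => ?_
    rw [real_inner_comm, hv]
    exact hφr a r
  rw [← hv, h0, inner_zero_left]

end KernelExpansion

/-! ### Degenerate kernels and their eigenfunctions -/

section Kernel

variable {S : Type*} [MeasurableSpace S] {ν : Measure S} [IsProbabilityMeasure ν]

/-- Cancelling `f` leaves ∫ f(x, ·) + ∫ f(·, y) = f_∅ for almost all (x, y). Integrating one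
variable turns one of the summands into f_∅, so the other vanishes. -/
theorem isDegenerate_of_ae_eq_hoeffding12 {f : S → S → ℝ} (hfm : Measurable (Function.uncurry f))
    (hf : MemLp (Function.uncurry f) 2 (ν.prod ν))
    (hdeg : ∀ᵐ p ∂(ν.prod ν), f p.1 p.2 = hoeffding12 ν f p.1 p.2) : IsDegenerate ν f := by
  have hi : Integrable (fun p : S × S => f p.1 p.2) (ν.prod ν) := hf.integrable (by norm_num)
  have hA : Integrable (fun x => ∫ y, f x y ∂ν) ν := hi.integral_prod_left
  have hB : Integrable (fun y => ∫ x, f x y ∂ν) ν := hi.integral_prod_right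
  have hA0 : ∫ x, ∫ y, f x y ∂ν ∂ν = hoeffding0 ν f := (integral_prod _ hi).symm
  have hB0 : ∫ y, ∫ x, f x y ∂ν ∂ν = hoeffding0 ν f := (integral_prod_symm _ hi).symm
  have h : ∀ᵐ p ∂(ν.prod ν),
      ∫ y, f p.1 y ∂ν + ∫ x, f x p.2 ∂ν = hoeffding0 ν f := by
    filter_upwards [hdeg] with p hp
    simp only [hoeffding12, hoeffding1, hoeffding2] at hp
    linarith
  have h' : ∀ᵐ p ∂(ν.prod ν),
      ∫ y, f p.2 y ∂ν + ∫ x, f x p.1 ∂ν = hoeffding0 ν f :=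
    Measure.measurePreserving_swap.quasiMeasurePreserving.ae h
  refine ⟨hfm, hf, ?_, ?_⟩
  · filter_upwards [Measure.ae_ae_of_ae_prod h'] with y hy
    have h1 := integral_congr_ae hy
    simp only [integral_const, probReal_univ, one_smul] at h1
    rw [integral_add hA (integrable_const _), hA0] at h1
    simpa using h1
  · filter_upwards [Measure.ae_ae_of_ae_prod h] with x hx
    have h1 := integral_congr_ae hx
    simp only [integral_const, probReal_univ, one_smul] at h1
    rw [integral_add (integrable_const _) hB, hB0] at h1
    simpa using h1

omit [IsProbabilityMeasure ν] in
theorem integral_mul_eq_inner (a b : Lp ℝ 2 ν) : ∫ x, a x * b x ∂ν = inner ℝ a b := by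
  rw [L2.inner_def]
  refine integral_congr_ae (Eventually.of_forall fun x => ?_)
  simp [mul_comm]

/-- Pairing with the constant 1 gives c ∫ φ = ⟨T φ, 1⟩ = ∬ f(x, y) φ(y), and the integral over x
vanishes first. -/
theorem IsDegenerate.integral_eigenfunction {f : S → S → ℝ} (hf : IsDegenerate ν f)
    {φ : Lp ℝ 2 ν} {c : ℝ} (hc : c ≠ 0)
    (hφ : kernelOperator (hf.memLp.toLp _) φ = c • φ) : ∫ x, φ x ∂ν = 0 := by
  set e : Lp ℝ 2 ν := (memLp_const (1 : ℝ)).toLp _ with he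
  have he1 : e =ᵐ[ν] fun _ => 1 := MemLp.coeFn_toLp _
  have h1 : inner ℝ (kernelOperator (hf.memLp.toLp _) φ) e = c * ∫ x, φ x ∂ν := by
    rw [hφ, inner_smul_left, ← integral_mul_eq_inner]
    simp only [conj_trivial]
    congr 1
    exact integral_congr_ae (he1.mono fun x hx => by simp [hx])
  have h2 : inner ℝ (kernelOperator (hf.memLp.toLp _) φ) e = 0 := by
    rw [inner_kernelOperator, inner_tensor]
    have h3 : ∫ p, (hf.memLp.toLp _ : S × S → ℝ) p * (e p.1 * φ p.2) ∂(ν.prod ν)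
        = ∫ p, f p.1 p.2 * φ p.2 ∂(ν.prod ν) := by
      refine integral_congr_ae ?_
      filter_upwards [hf.memLp.coeFn_toLp, ae_fst_of_ae he1] with p hp hp'
      rw [hp, hp', one_mul]
      rfl
    have hi : Integrable (fun p : S × S => f p.1 p.2 * φ p.2) (ν.prod ν) := by
      have h5 := memLp_tensor (memLp_const (μ := ν) (p := 2) (1 : ℝ)) (Lp.memLp φ)
      simp only [one_mul] at h5
      exact hf.memLp.integrable_mul h5
    rw [h3, integral_prod_symm _ hi]
    refine integral_eq_zero_of_ae (hf.left.mono fun y hy => ?_)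
    simp only [Pi.zero_apply]
    rw [integral_mul_const, hy, zero_mul]
  exact (mul_eq_zero.1 (h1.symm.trans h2)).resolve_left hc

/-- The kernel `∑_{r ∈ s} lam r * φ_r(x) * φ_r(y)`. -/
def finiteKernel {ι : Type*} (lam : ι → ℝ) (φ : ι → S → ℝ) (s : Finset ι) (x y : S) : ℝ :=
  ∑ r ∈ s, lam r * (φ r x * φ r y)

theorem IsCenteredOrthonormal.isDegenerate_finiteKernel {ι : Type*} {φ : ι → S → ℝ}
    (hφ : IsCenteredOrthonormal ν φ) (lam : ι → ℝ) (s : Finset ι) :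
    IsDegenerate ν (finiteKernel lam φ s) where
  measurable := by
    refine Finset.measurable_sum _ fun r _ => Measurable.const_mul ?_ _
    exact ((hφ.measurable r).comp measurable_fst).mul ((hφ.measurable r).comp measurable_snd)
  memLp := memLp_finsetSum _ fun r _ =>
    (memLp_tensor (hφ.memLp r) (hφ.memLp r)).const_mul (lam r)
  left := by
    refine Eventually.of_forall fun y => ?_
    simp only [finiteKernel]
    rw [integral_finsetSum _ fun r _ =>
      (((hφ.memLp r).integrable (by norm_num)).mul_const _).const_mul _]
    refine Finset.sum_eq_zero fun r _ => ?_
    rw [integral_const_mul, integral_mul_const, hφ.integral_eq_zero]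
    simp
  right := by
    refine Eventually.of_forall fun x => ?_
    simp only [finiteKernel]
    rw [integral_finsetSum _ fun r _ =>
      (((hφ.memLp r).integrable (by norm_num)).const_mul _).const_mul _]
    refine Finset.sum_eq_zero fun r _ => ?_
    rw [integral_const_mul, integral_const_mul, hφ.integral_eq_zero]
    simp

theorem ae_integrable_of_memLp {g : S → S → ℝ} (hg : MemLp (Function.uncurry g) 2 (ν.prod ν)) :
    (∀ᵐ x ∂ν, Integrable (fun y => g x y) ν) ∧ ∀ᵐ y ∂ν, Integrable (fun x => g x y) ν := by
  have hi : Integrable (Function.uncurry g) (ν.prod ν) := hg.integrable (by norm_num)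
  exact ⟨hi.prod_right_ae, hi.prod_left_ae⟩

theorem IsDegenerate.sub {f g : S → S → ℝ} (hf : IsDegenerate ν f) (hg : IsDegenerate ν g) :
    IsDegenerate ν (fun x y => f x y - g x y) where
  measurable := hf.measurable.sub hg.measurable
  memLp := hf.memLp.sub hg.memLp
  left := by
    filter_upwards [hf.left, hg.left, (ae_integrable_of_memLp hf.memLp).2,
      (ae_integrable_of_memLp hg.memLp).2] with y h1 h2 h3 h4
    rw [integral_sub h3 h4, h1, h2, sub_zero]
  right := by
    filter_upwards [hf.right, hg.right, (ae_integrable_of_memLp hf.memLp).1,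
      (ae_integrable_of_memLp hg.memLp).1] with y h1 h2 h3 h4
    rw [integral_sub h3 h4, h1, h2, sub_zero]

theorem coeFn_sum_smul_tensor {ι : Type*} (lam : ι → ℝ) (φ : ι → Lp ℝ 2 ν) (s : Finset ι) :
    (∑ r ∈ s, lam r • tensor (φ r) (φ r) : Lp ℝ 2 (ν.prod ν))
      =ᵐ[ν.prod ν] fun p => finiteKernel lam (fun r => φ r) s p.1 p.2 := by
  have h1 : ∀ᵐ p ∂(ν.prod ν), ∀ r ∈ s,
      (lam r • tensor (φ r) (φ r) : Lp ℝ 2 (ν.prod ν)) p = lam r * (φ r p.1 * φ r p.2) := by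
    refine (ae_ball_iff s.countable_toSet).2 fun r _ => ?_
    filter_upwards [Lp.coeFn_smul (lam r) (tensor (φ r) (φ r)), coeFn_tensor (φ r) (φ r)]
      with p h1 h2
    rw [h1, Pi.smul_apply, h2, smul_eq_mul]
  have h2 := Lp.coeFn_finsetSum s (fun r => (lam r • tensor (φ r) (φ r) : Lp ℝ 2 (ν.prod ν)))
  filter_upwards [h1, h2] with p h3 h4
  rw [h4, Finset.sum_apply]
  exact Finset.sum_congr rfl fun r hr => h3 r hr

theorem isSymmetric_of_ae {f : S → S → ℝ} (hf : MemLp (Function.uncurry f) 2 (ν.prod ν))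
    (hsymm : ∀ᵐ p ∂(ν.prod ν), f p.1 p.2 = f p.2 p.1) :
    (kernelOperator (hf.toLp _)).IsSymmetric := by
  refine isSymmetric_kernelOperator ?_
  have h1 := hf.coeFn_toLp
  have h2 := Measure.measurePreserving_swap.quasiMeasurePreserving.ae h1
  filter_upwards [hsymm, h1, h2] with p h3 h4 h5
  rw [h4, h5]
  exact h3

/-- The eigenfunction expansion of a symmetric degenerate kernel. -/
theorem IsDegenerate.exists_eigenfunctions {f : S → S → ℝ} (hf : IsDegenerate ν f)
    (hsymm : ∀ᵐ p ∂(ν.prod ν), f p.1 p.2 = f p.2 p.1) {ι : Type*} {lam : ι → ℝ}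
    (hlam : IsNonzeroEigenvalues (integralOperator f hf.memLp) lam) :
    ∃ φ : ι → S → ℝ, IsCenteredOrthonormal ν φ ∧ Summable (fun r => lam r ^ 2) ∧
      Tendsto (fun s : Finset ι =>
        ∫ p, (f p.1 p.2 - finiteKernel lam φ s p.1 p.2) ^ 2 ∂(ν.prod ν)) atTop (𝓝 0) := by
  set F := hf.memLp.toLp _ with hF
  rw [← kernelOperator_toLp] at hlam
  obtain ⟨φ, hφ, heig, hker⟩ := exists_orthonormal_eigenfamily
    (isCompactOperator_kernelOperator F) (isSymmetric_of_ae hf.memLp hsymm) hlam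
  refine ⟨fun r => φ r, ⟨fun r => (Lp.stronglyMeasurable _).measurable, fun r => Lp.memLp _,
    fun r => hf.integral_eigenfunction (hlam.1 r) (heig r), fun r => ?_, fun r s hrs => ?_⟩,
    summable_sq_eigenvalues F hφ heig, ?_⟩
  · rw [integral_mul_eq_inner, real_inner_self_eq_norm_sq, hφ.1 r, one_pow]
  · rw [integral_mul_eq_inner, hφ.2 hrs]
  · have h1 := hasSum_eigenfunctions F hφ heig hker
    have h2 : Tendsto (fun s : Finset ι => ‖F - ∑ r ∈ s, lam r • tensor (φ r) (φ r)‖ ^ 2) atTop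
        (𝓝 0) := by
      have h3 : Tendsto (fun s : Finset ι => ∑ r ∈ s, lam r • tensor (φ r) (φ r)) atTop (𝓝 F) := h1
      have h4 := ((tendsto_const_nhds (x := F)).sub h3).norm.pow 2
      simpa using h4
    refine h2.congr fun s => ?_
    rw [← real_inner_self_eq_norm_sq, ← integral_mul_eq_inner]
    refine integral_congr_ae ?_
    filter_upwards [Lp.coeFn_sub F (∑ r ∈ s, lam r • tensor (φ r) (φ r)),
      coeFn_sum_smul_tensor lam φ s, hf.memLp.coeFn_toLp] with p h3 h4 h5
    rw [h3, Pi.sub_apply, h4, hF, h5, sq]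
    rfl

/-- The labels can be numbered because a summable family of nonzero squares has a countable index
set. -/
theorem exists_isNonzeroEigenvalues {f : S → S → ℝ}
    (hf : MemLp (Function.uncurry f) 2 (ν.prod ν))
    (hsymm : ∀ᵐ p ∂(ν.prod ν), f p.1 p.2 = f p.2 p.1) :
    ∃ (R : ℕ∞) (lam : Idx R → ℝ), IsNonzeroEigenvalues (integralOperator f hf) lam := by
  rw [← kernelOperator_toLp]
  have hc := isCompactOperator_kernelOperator (hf.toLp _)
  obtain ⟨ι, lam, hlam⟩ := exists_isNonzeroEigenvalues_sigma hc
  obtain ⟨φ, hφ, heig, -⟩ := exists_orthonormal_eigenfamily hc (isSymmetric_of_ae hf hsymm) hlam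
  have hcount := (summable_sq_eigenvalues _ hφ heig).countable_support
  have huniv : Function.support (fun r => lam r ^ 2) = Set.univ := by
    ext r
    simp [hlam.1 r]
  rw [huniv, Set.countable_univ_iff] at hcount
  obtain ⟨R, ⟨e⟩⟩ := exists_equiv_idx ι
  exact ⟨R, lam ∘ e, hlam.comp_equiv e⟩

end Kernel

/-! ### Exact characteristic function of the discrete stochastic integral -/

section GaussianArea

open Complex

/-- Completing the square about g = −B s / (1 + B). -/
theorem integral_exp_neg_sq_gaussianReal {B : ℝ} (hB : 0 ≤ B) (s : ℝ) :
    ∫ g, Real.exp (-(B * (s + g) ^ 2 / 2)) ∂(gaussianReal 0 1)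
      = (√(1 + B))⁻¹ * Real.exp (-(B / (1 + B) * s ^ 2 / 2)) := by
  have hB1 : (0 : ℝ) < 1 + B := by linarith
  rw [integral_gaussianReal_eq_integral_smul one_ne_zero]
  have h1 : ∀ g : ℝ, gaussianPDFReal 0 1 g • Real.exp (-(B * (s + g) ^ 2 / 2))
      = ((√(2 * Real.pi))⁻¹ * Real.exp (-(B / (1 + B) * s ^ 2 / 2))) *
        Real.exp (-((1 + B) / 2) * (g + B * s / (1 + B)) ^ 2) := by
    intro g
    rw [gaussianPDFReal, smul_eq_mul]
    simp only [NNReal.coe_one, mul_one, sub_zero]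
    rw [mul_assoc, mul_assoc, ← Real.exp_add, ← Real.exp_add]
    congr 2
    field_simp
    ring
  simp_rw [h1]
  rw [integral_const_mul,
    integral_add_right_eq_self (fun g : ℝ => Real.exp (-((1 + B) / 2) * g ^ 2)),
    integral_gaussian]
  have h2 : √(Real.pi / ((1 + B) / 2)) = √(2 * Real.pi) * (√(1 + B))⁻¹ := by
    rw [← Real.sqrt_inv, ← Real.sqrt_mul (by positivity)]
    congr 1
    field_simp
  rw [h2]
  have h3 : √(2 * Real.pi) ≠ 0 := by positivity
  field_simp

theorem integral_exp_mul_I_gaussianReal (ε s : ℝ) :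
    ∫ h, cexp (ε * (s * h) * I) ∂(gaussianReal 0 1) = Real.exp (-(ε ^ 2 * s ^ 2 / 2)) := by
  have h1 := charFun_gaussianReal (μ := 0) (v := 1) (ε * s)
  rw [charFun_apply_real] at h1
  push_cast at h1 ⊢
  have h2 : ∀ h : ℝ, cexp (ε * (s * h) * I) = cexp (ε * s * h * I) := fun h => by ring_nf
  simp_rw [h2]
  rw [h1]
  congr 1
  simp
  ring

variable {Ω : Type*} [MeasurableSpace Ω] {P : Measure Ω} [IsProbabilityMeasure P]

/-- Partial sums of the variables `Z (p, false)`. -/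
def walk (Z : ℕ × Bool → Ω → ℝ) (m : ℕ) (ω : Ω) : ℝ := ∑ p ∈ Finset.range m, Z (p, false) ω

/-- The discrete stochastic integral `∑_{p < q < m} Z (p, false) * Z (q, true)`. -/
def area (Z : ℕ × Bool → Ω → ℝ) (m : ℕ) (ω : Ω) : ℝ :=
  ∑ q ∈ Finset.range m, ∑ p ∈ Finset.range q, Z (p, false) ω * Z (q, true) ω

omit [MeasurableSpace Ω] in
theorem area_succ (Z : ℕ × Bool → Ω → ℝ) (m : ℕ) (ω : Ω) :
    area Z (m + 1) ω = area Z m ω + walk Z m ω * Z (m, true) ω := by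
  simp only [area, walk]
  rw [Finset.sum_range_succ, Finset.sum_mul]

omit [MeasurableSpace Ω] in
theorem walk_succ (Z : ℕ × Bool → Ω → ℝ) (m : ℕ) (ω : Ω) :
    walk Z (m + 1) ω = walk Z m ω + Z (m, false) ω := by
  simp only [walk]
  rw [Finset.sum_range_succ]

theorem measurable_walk {Z : ℕ × Bool → Ω → ℝ} (hZ : ∀ i, Measurable (Z i)) (m : ℕ) :
    Measurable (walk Z m) := Finset.measurable_sum _ fun _ _ => hZ _

theorem measurable_area {Z : ℕ × Bool → Ω → ℝ} (hZ : ∀ i, Measurable (Z i)) (m : ℕ) :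
    Measurable (area Z m) :=
  Finset.measurable_sum _ fun _ _ => Finset.measurable_sum _ fun _ _ => (hZ _).mul (hZ _)

omit [IsProbabilityMeasure P] in
theorem indepFun_walk_area {Z : ℕ × Bool → Ω → ℝ} (hZ : ∀ i, Measurable (Z i))
    (hZi : iIndepFun Z P) (m : ℕ) :
    IndepFun (fun ω => (walk Z m ω, area Z m ω)) (fun ω => (Z (m, false) ω, Z (m, true) ω)) P := by
  classical
  have h := hZi.indepFun_finset (Finset.range m ×ˢ Finset.univ) {(m, false), (m, true)}
    (by
      rw [Finset.disjoint_left]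
      rintro ⟨p, b⟩ hp hq
      simp at hp hq
      omega) hZ
  -- Extension by zero, which exhibits `walk` and `area` at time m as measurable functions of the
  -- variables with first index below m.
  let ex : ((Finset.range m ×ˢ (Finset.univ : Finset Bool) : Finset (ℕ × Bool)) → ℝ) →
      ℕ × Bool → ℝ := fun z i => if hi : i ∈ Finset.range m ×ˢ Finset.univ then z ⟨i, hi⟩ else 0
  have hex : ∀ i, Measurable fun z => ex z i := by
    intro i
    by_cases hi : i ∈ Finset.range m ×ˢ (Finset.univ : Finset Bool)
    · simp only [ex, dif_pos hi]
      exact measurable_pi_apply _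
    · simp only [ex, dif_neg hi]
      exact measurable_const
  have hu : Measurable (fun z => (walk (fun i z => ex z i) m z, area (fun i z => ex z i) m z)) :=
    (measurable_walk hex m).prodMk (measurable_area hex m)
  have hv : Measurable (fun z : (({(m, false), (m, true)} : Finset (ℕ × Bool)) → ℝ) =>
      (z ⟨(m, false), by simp⟩, z ⟨(m, true), by simp⟩)) :=
    (measurable_pi_apply _).prodMk (measurable_pi_apply _)
  have h2 := h.comp hu hv
  have h3 : ∀ ω p b, p < m → ex (fun i => Z i ω) (p, b) = Z (p, b) ω := by
    intro ω p b hp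
    simp [ex, hp]
  convert h2 using 1
  · ext1 ω
    simp only [Function.comp_apply, Prod.mk.injEq, walk, area]
    refine ⟨Finset.sum_congr rfl fun p hp => ?_, Finset.sum_congr rfl fun q hq =>
      Finset.sum_congr rfl fun p hp => ?_⟩
    · rw [h3 _ _ _ (Finset.mem_range.1 hp)]
    · rw [h3 _ _ _ (Finset.mem_range.1 hq),
        h3 _ _ _ ((Finset.mem_range.1 hp).trans (Finset.mem_range.1 hq))]
  · rfl

/-- One step of the recursion for the Fourier-Laplace transform of `(area, walk)`. -/
theorem integral_exp_area_succ {Z : ℕ × Bool → Ω → ℝ} (hZ : ∀ i, Measurable (Z i))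
    (hZl : ∀ i, HasLaw (Z i) (gaussianReal 0 1) P) (hZi : iIndepFun Z P) (m : ℕ) (ε : ℝ) {B : ℝ}
    (hB : 0 ≤ B) :
    ∫ ω, cexp (ε * area Z (m + 1) ω * I) * Real.exp (-(B * walk Z (m + 1) ω ^ 2 / 2)) ∂P
      = (√(1 + B))⁻¹ * ∫ ω, cexp (ε * area Z m ω * I) *
        Real.exp (-((ε ^ 2 + B / (1 + B)) * walk Z m ω ^ 2 / 2)) ∂P := by
  set U : Ω → ℝ × ℝ := fun ω => (walk Z m ω, area Z m ω) with hU
  have hUm : Measurable U := (measurable_walk hZ m).prodMk (measurable_area hZ m)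
  set γ := gaussianReal 0 1
  have hUp : IsProbabilityMeasure (P.map U) := Measure.isProbabilityMeasure_map hUm.aemeasurable
  have hlaw : P.map (fun ω => (U ω, (Z (m, false) ω, Z (m, true) ω)))
      = (P.map U).prod (γ.prod γ) := by
    rw [(indepFun_iff_map_prod_eq_prod_map_map hUm.aemeasurable
      ((hZ _).prodMk (hZ _)).aemeasurable).1 (indepFun_walk_area hZ hZi m),
      (indepFun_iff_map_prod_eq_prod_map_map (hZ _).aemeasurable (hZ _).aemeasurable).1
      (hZi.indepFun (by simp)), (hZl _).map_eq, (hZl _).map_eq]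
  -- For a fixed past, the integrand is a product of functions of the two new normals. The one in
  -- `walk` turns B into B / (1 + B); the one in `area` contributes exp(−ε² walk² / 2).
  let Ψ : (ℝ × ℝ) × (ℝ × ℝ) → ℂ := fun p =>
    (cexp (ε * p.1.2 * I)) * ((Real.exp (-(B * (p.1.1 + p.2.1) ^ 2 / 2)) : ℂ) *
      cexp (ε * (p.1.1 * p.2.2) * I))
  have hΨm : Measurable Ψ := by fun_prop
  have hΨb : ∀ p, ‖Ψ p‖ ≤ 1 := by
    intro p
    simp only [Ψ, norm_mul]
    rw [← ofReal_mul, ← ofReal_mul, ← ofReal_mul, norm_exp_ofReal_mul_I, norm_exp_ofReal_mul_I,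
      norm_real, one_mul, mul_one, Real.norm_of_nonneg (Real.exp_pos _).le, Real.exp_le_one_iff]
    have : 0 ≤ B * (p.1.1 + p.2.1) ^ 2 / 2 := by positivity
    linarith
  have hΨi : Integrable Ψ ((P.map U).prod (γ.prod γ)) :=
    Integrable.of_bound hΨm.aestronglyMeasurable 1 (Eventually.of_forall hΨb)
  have h1 : ∫ ω, cexp (ε * area Z (m + 1) ω * I) * Real.exp (-(B * walk Z (m + 1) ω ^ 2 / 2)) ∂P
      = ∫ p, Ψ p ∂((P.map U).prod (γ.prod γ)) := by
    rw [← hlaw, integral_map (hUm.prodMk ((hZ _).prodMk (hZ _))).aemeasurable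
      hΨm.aestronglyMeasurable]
    refine integral_congr_ae (Eventually.of_forall fun ω => ?_)
    simp only [Ψ, hU, area_succ, walk_succ]
    push_cast
    rw [mul_add, add_mul, Complex.exp_add]
    ring
  rw [h1, integral_prod _ hΨi, integral_map hUm.aemeasurable, ← integral_const_mul]
  · refine integral_congr_ae (Eventually.of_forall fun ω => ?_)
    simp only [Ψ, hU]
    rw [integral_const_mul, integral_prod_mul
      (f := fun g : ℝ => ((Real.exp (-(B * (walk Z m ω + g) ^ 2 / 2)) : ℝ) : ℂ))
      (g := fun h : ℝ => cexp (ε * (walk Z m ω * h) * I)), integral_exp_mul_I_gaussianReal,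
      integral_complex_ofReal, integral_exp_neg_sq_gaussianReal hB]
    have h2 : Real.exp (-((ε ^ 2 + B / (1 + B)) * walk Z m ω ^ 2 / 2))
        = Real.exp (-(B / (1 + B) * walk Z m ω ^ 2 / 2)) *
          Real.exp (-(ε ^ 2 * walk Z m ω ^ 2 / 2)) := by
      rw [← Real.exp_add]
      congr 1
      ring
    rw [h2]
    push_cast
    ring
  · exact (hΨm.stronglyMeasurable.integral_prod_right (ν := γ.prod γ)).aestronglyMeasurable

/-- The numerators `cosh ((j - 1/2) θ)` in the characteristic function of `area`. -/
noncomputable def coshSeq (θ : ℝ) (j : ℕ) : ℝ := Real.cosh ((j - 1 / 2) * θ)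

theorem coshSeq_pos (θ : ℝ) (j : ℕ) : 0 < coshSeq θ j := Real.cosh_pos _

theorem coshSeq_succ_sub (θ : ℝ) (j : ℕ) :
    coshSeq θ (j + 1) - coshSeq θ j = 2 * (Real.sinh (j * θ) * Real.sinh (θ / 2)) := by
  simp only [coshSeq]
  have h1 : ((j + 1 : ℕ) - 1 / 2 : ℝ) * θ = j * θ + θ / 2 := by push_cast; ring
  have h2 : ((j : ℝ) - 1 / 2) * θ = j * θ - θ / 2 := by ring
  rw [h1, h2, Real.cosh_add, Real.cosh_sub]
  ring

theorem coshSeq_le_succ (θ : ℝ) (j : ℕ) : coshSeq θ j ≤ coshSeq θ (j + 1) := by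
  have h := coshSeq_succ_sub θ j
  have h2 : 0 ≤ Real.sinh (j * θ) * Real.sinh (θ / 2) := by
    rcases le_total 0 θ with hθ | hθ
    · exact mul_nonneg (Real.sinh_nonneg_iff.2 (by positivity))
        (Real.sinh_nonneg_iff.2 (by positivity))
    · exact mul_nonneg_of_nonpos_of_nonpos
        (Real.sinh_nonpos_iff.2 (mul_nonpos_of_nonneg_of_nonpos (by positivity) hθ))
        (Real.sinh_nonpos_iff.2 (by linarith))
  linarith

/-- With ε = 2 sinh(θ/2) and B_j = (c_{j+1} − c_j) / c_j, this linear recurrence is equivalent to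
the Riccati recursion B_{j+1} = ε² + B_j / (1 + B_j) of `integral_exp_area_succ`. -/
theorem coshSeq_recurrence (θ : ℝ) (j : ℕ) :
    coshSeq θ (j + 2) - coshSeq θ (j + 1)
      = (coshSeq θ (j + 1) - coshSeq θ j) + (2 * Real.sinh (θ / 2)) ^ 2 * coshSeq θ (j + 1) := by
  rw [coshSeq_succ_sub, coshSeq_succ_sub]
  simp only [coshSeq]
  have h1 : ((j + 1 : ℕ) : ℝ) * θ = (j * θ + θ / 2) + θ / 2 := by push_cast; ring
  have h2 : (j : ℝ) * θ = (j * θ + θ / 2) - θ / 2 := by ring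
  have h3 : ((j + 1 : ℕ) - 1 / 2 : ℝ) * θ = j * θ + θ / 2 := by push_cast; ring
  rw [h1, h3]
  nth_rewrite 2 [h2]
  rw [Real.sinh_add _ (θ / 2), Real.sinh_sub]
  ring

/-- Each step contributes (1 + B_j)^(−1/2) = √(c_j / c_{j+1}), and the product telescopes. The start
`j` is left free because removing one step advances it by one. -/
theorem integral_exp_area {Z : ℕ × Bool → Ω → ℝ} (hZ : ∀ i, Measurable (Z i))
    (hZl : ∀ i, HasLaw (Z i) (gaussianReal 0 1) P) (hZi : iIndepFun Z P) (θ : ℝ) (m j : ℕ) :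
    ∫ ω, cexp ((2 * Real.sinh (θ / 2) : ℝ) * area Z m ω * I) *
      Real.exp (-((coshSeq θ (j + 1) - coshSeq θ j) / coshSeq θ j * walk Z m ω ^ 2 / 2)) ∂P
      = √(coshSeq θ j / coshSeq θ (j + m)) := by
  induction m generalizing j with
  | zero =>
    have := (coshSeq_pos θ j).ne'
    simp [walk, area, this]
  | succ m ih =>
    have h0 := coshSeq_pos θ j
    have h1 := coshSeq_pos θ (j + 1)
    have hB : 0 ≤ (coshSeq θ (j + 1) - coshSeq θ j) / coshSeq θ j :=
      div_nonneg (sub_nonneg.2 (coshSeq_le_succ θ j)) h0.le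
    rw [integral_exp_area_succ hZ hZl hZi m _ hB]
    have h2 : 1 + (coshSeq θ (j + 1) - coshSeq θ j) / coshSeq θ j
        = coshSeq θ (j + 1) / coshSeq θ j := by
      field_simp
      ring
    have h3 : (2 * Real.sinh (θ / 2)) ^ 2 + (coshSeq θ (j + 1) - coshSeq θ j) / coshSeq θ j /
        (coshSeq θ (j + 1) / coshSeq θ j)
        = (coshSeq θ (j + 1 + 1) - coshSeq θ (j + 1)) / coshSeq θ (j + 1) := by
      have h4 := coshSeq_recurrence θ j
      rw [h4]
      field_simp
      ring
    rw [h2, h3, ih (j + 1), ← ofReal_mul, ← Real.sqrt_inv,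
      ← Real.sqrt_mul (by positivity)]
    have h5 := coshSeq_pos θ (j + 1 + m)
    rw [show j + (m + 1) = j + 1 + m by ring]
    congr 2
    field_simp

/-- The half-integer shift in `coshSeq` makes c_0 = c_1, so at j = 0 the quadratic weight in `walk`
disappears and the transform of `area` alone remains. -/
theorem charFun_area {Z : ℕ × Bool → Ω → ℝ} (hZ : ∀ i, Measurable (Z i))
    (hZl : ∀ i, HasLaw (Z i) (gaussianReal 0 1) P) (hZi : iIndepFun Z P) (θ : ℝ) (m : ℕ) :
    charFun (P.map (area Z m)) (2 * Real.sinh (θ / 2))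
      = √(Real.cosh (θ / 2) / Real.cosh ((m - 1 / 2) * θ)) := by
  have h := integral_exp_area hZ hZl hZi θ m 0
  rw [coshSeq_succ_sub] at h
  rw [charFun_apply_real, integral_map (measurable_area hZ m).aemeasurable (by fun_prop)]
  simp only [Nat.cast_zero, zero_mul, Real.sinh_zero, mul_zero, zero_div, neg_zero, Real.exp_zero,
    ofReal_one, mul_one, zero_add] at h
  rw [h]
  simp only [coshSeq]
  congr 3
  rw [← Real.cosh_neg]
  congr 1
  push_cast
  ring

theorem tendsto_charFun_area {Z : ℕ × Bool → Ω → ℝ} (hZ : ∀ i, Measurable (Z i))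
    (hZl : ∀ i, HasLaw (Z i) (gaussianReal 0 1) P) (hZi : iIndepFun Z P) (t : ℝ) :
    Tendsto (fun m : ℕ => charFun (P.map fun ω => (m : ℝ)⁻¹ * area Z m ω) t) atTop
      (𝓝 ((1 / √(Real.cosh t) : ℝ) : ℂ)) := by
  -- Chosen so that 2 sinh(θ m / 2) = t / m. The derivative at zero of u ↦ 2 arsinh(u t / 2) is t,
  -- hence m θ m → t.
  set θ : ℕ → ℝ := fun m => 2 * Real.arsinh ((m : ℝ)⁻¹ * t / 2) with hθ
  have h1 : ∀ m : ℕ, charFun (P.map fun ω => (m : ℝ)⁻¹ * area Z m ω) t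
      = √(Real.cosh (θ m / 2) / Real.cosh ((m - 1 / 2) * θ m)) := by
    intro m
    rw [charFun_map_mul_comp (measurable_area hZ m).aemeasurable, ← charFun_area hZ hZl hZi]
    congr 1
    simp only [hθ]
    rw [mul_div_cancel_left₀ _ two_ne_zero, Real.sinh_arsinh]
    ring
  simp_rw [h1]
  have hderiv : HasDerivAt (fun u : ℝ => 2 * Real.arsinh (u * t / 2)) t 0 := by
    have h2 : HasDerivAt (fun u : ℝ => u * t / 2) (t / 2) 0 := by
      simpa using ((hasDerivAt_id (0 : ℝ)).mul_const t).div_const 2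
    have h3 : HasDerivAt (fun u : ℝ => 2 * Real.arsinh (u * t / 2))
        (2 * ((√(1 + ((0 : ℝ) * t / 2) ^ 2))⁻¹ * (t / 2))) 0 :=
      h2.arsinh.const_mul 2
    have h4 : 2 * ((√(1 + ((0 : ℝ) * t / 2) ^ 2))⁻¹ * (t / 2)) = t := by
      norm_num
      ring
    rwa [h4] at h3
  have hinv : Tendsto (fun m : ℕ => (m : ℝ)⁻¹) atTop (𝓝[≠] 0) := by
    refine tendsto_nhdsWithin_iff.2 ⟨tendsto_inv_atTop_nhds_zero_nat, ?_⟩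
    filter_upwards [eventually_gt_atTop 0] with m hm
    exact inv_ne_zero (Nat.cast_ne_zero.2 hm.ne')
  have hmθ : Tendsto (fun m : ℕ => (m : ℝ) * θ m) atTop (𝓝 t) := by
    have h4 := (hasDerivAt_iff_tendsto_slope_zero.1 hderiv).comp hinv
    simpa [Function.comp_def, hθ] using h4
  have hθ0 : Tendsto θ atTop (𝓝 0) := by
    have h5 := hderiv.continuousAt.tendsto.comp (hinv.mono_right nhdsWithin_le_nhds)
    simpa [Function.comp_def, hθ] using h5
  have hlim : Tendsto (fun m : ℕ => √(Real.cosh (θ m / 2) / Real.cosh ((m - 1 / 2) * θ m))) atTop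
      (𝓝 (√(Real.cosh (0 / 2) / Real.cosh (t - 1 / 2 * 0)))) := by
    refine (Real.continuous_sqrt.tendsto _).comp (Tendsto.div ?_ ?_ (Real.cosh_pos _).ne')
    · exact (Real.continuous_cosh.tendsto _).comp (hθ0.div_const 2)
    · refine (Real.continuous_cosh.tendsto _).comp ?_
      refine (hmθ.sub (hθ0.const_mul (1 / 2))).congr fun m => ?_
      ring
  have h6 : √(Real.cosh (0 / 2) / Real.cosh (t - 1 / 2 * 0)) = 1 / √(Real.cosh t) := by
    simp [Real.sqrt_inv]
  rw [h6] at hlim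
  exact (continuous_ofReal.tendsto _).comp hlim

end GaussianArea

/-! ### Independent rows of Gaussian variables -/

section GaussianFamilies

/-- The law of countably many independent standard normal variables for each index `r : ι`. -/
noncomputable def gaussianArrays (ι : Type*) : Measure (ι → ℕ × Bool → ℝ) :=
  Measure.infinitePi fun _ => Measure.infinitePi fun _ => gaussianReal 0 1

instance (ι : Type*) : IsProbabilityMeasure (gaussianArrays ι) := by
  unfold gaussianArrays
  infer_instance

theorem iIndepFun_gaussianArrays (ι : Type*) :
    iIndepFun (fun (p : ι × (ℕ × Bool)) (ω : ι → ℕ × Bool → ℝ) => ω p.1 p.2)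
      (gaussianArrays ι) :=
  iIndepFun_uncurry_infinitePi' (X := fun _ _ x => x) (fun _ _ => gaussianReal 0 1)
    fun _ _ => measurable_id

theorem iIndepFun_gaussianArrays_row {ι : Type*} (r : ι) :
    iIndepFun (fun (i : ℕ × Bool) (ω : ι → ℕ × Bool → ℝ) => ω r i) (gaussianArrays ι) :=
  (iIndepFun_gaussianArrays ι).precomp (g := fun i => (r, i)) fun _ _ h => (Prod.ext_iff.1 h).2

theorem hasLaw_gaussianArrays {ι : Type*} (r : ι) (i : ℕ × Bool) :
    HasLaw (fun ω : ι → ℕ × Bool → ℝ => ω r i) (gaussianReal 0 1) (gaussianArrays ι) := by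
  have h1 : MeasurePreserving (Function.eval r) (gaussianArrays ι)
      (Measure.infinitePi fun _ : ℕ × Bool => gaussianReal 0 1) :=
    measurePreserving_eval_infinitePi _ r
  have h2 : MeasurePreserving (Function.eval i)
      (Measure.infinitePi fun _ : ℕ × Bool => gaussianReal 0 1) (gaussianReal 0 1) :=
    measurePreserving_eval_infinitePi _ i
  exact (h2.comp h1).hasLaw

theorem measurable_eval_eval {ι : Type*} (r : ι) (i : ℕ × Bool) :
    Measurable fun ω : ι → ℕ × Bool → ℝ => ω r i :=
  (measurable_pi_apply i).comp (measurable_pi_apply r)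

/-- The normalised area of the `r`-th row. -/
noncomputable def rowArea {ι : Type*} (r : ι) (M : ℕ) (ω : ι → ℕ × Bool → ℝ) : ℝ :=
  (M : ℝ)⁻¹ * area (fun i x => x r i) M ω

theorem measurable_rowArea {ι : Type*} (r : ι) (M : ℕ) : Measurable (rowArea r M) :=
  (measurable_area (fun i => measurable_eval_eval r i) M).const_mul _

theorem tendsto_charFun_rowArea {ι : Type*} (r : ι) (t : ℝ) :
    Tendsto (fun M => charFun ((gaussianArrays ι).map (rowArea r M)) t) atTop
      (𝓝 ((1 / √(Real.cosh t) : ℝ) : ℂ)) :=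
  tendsto_charFun_area (fun i => measurable_eval_eval r i) (hasLaw_gaussianArrays r)
    (iIndepFun_gaussianArrays_row r) t

theorem tendsto_charFun_sum_rowArea {ι : Type*} (lam : ι → ℝ) (s : Finset ι) (t : ℝ) :
    Tendsto (fun M => charFun ((gaussianArrays ι).map fun ω => ∑ r ∈ s, lam r * rowArea r M ω) t)
      atTop (𝓝 (∏ r ∈ s, ((1 / √(Real.cosh (lam r * t)) : ℝ) : ℂ))) := by
  have h : ∀ M : ℕ, charFun ((gaussianArrays ι).map fun ω => ∑ r ∈ s, lam r * rowArea r M ω) t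
      = ∏ r ∈ s, charFun ((gaussianArrays ι).map (rowArea r M)) (lam r * t) := by
    intro M
    have hind : iIndepFun (fun (r : ι) ω => lam r * rowArea r M ω) (gaussianArrays ι) := by
      refine iIndepFun_infinitePi
        (P := fun _ : ι => Measure.infinitePi fun _ : ℕ × Bool => gaussianReal 0 1)
        (X := fun r x => lam r * ((M : ℝ)⁻¹ * area (fun i x => x i) M x)) fun r => ?_
      exact ((measurable_area (fun i => measurable_pi_apply i) M).const_mul _).const_mul _
    have h1 := congrFun ((hind.restrict s).charFun_map_fun_finsetSum_eq_prod
      (fun r _ => ((measurable_rowArea r M).const_mul _).aemeasurable)) t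
    rw [h1, Finset.prod_apply]
    refine Finset.prod_congr rfl fun r _ => ?_
    rw [charFun_map_mul_comp (measurable_rowArea r M).aemeasurable]
  simp_rw [h]
  exact tendsto_finsetProd _ fun r _ => tendsto_charFun_rowArea r (lam r * t)

end GaussianFamilies

/-! ### The law with characteristic function 1/√(cosh t) -/

section InvSqrtCosh

/-- The characteristic functions of the normalised areas converge to a function continuous at zero,
so their laws are tight, and any subsequential weak limit has the right characteristic function. -/
theorem exists_hasInvSqrtCoshCharFun :
    ∃ ρ : Measure ℝ, IsProbabilityMeasure ρ ∧ HasInvSqrtCoshCharFun ρ id := by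
  let μ : ℕ → ProbabilityMeasure ℝ := fun M => ⟨(gaussianArrays Unit).map (rowArea () M),
    Measure.isProbabilityMeasure_map (measurable_rowArea () M).aemeasurable⟩
  have hlim : ∀ t, Tendsto (fun M => charFun (μ M : Measure ℝ) t) atTop
      (𝓝 ((1 / √(Real.cosh t) : ℝ) : ℂ)) := tendsto_charFun_rowArea ()
  have hcont : Continuous fun t : ℝ => ((1 / √(Real.cosh t) : ℝ) : ℂ) := by
    refine Complex.continuous_ofReal.comp (continuous_const.div (by fun_prop) fun t => ?_)
    exact (Real.sqrt_pos.2 (Real.cosh_pos t)).ne'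
  have htight := isTightMeasureSet_of_tendsto_charFun hcont.continuousAt hlim
  have hcomp : IsCompact (closure (Set.range μ)) := by
    refine isCompact_closure_of_isTightMeasureSet ?_
    convert htight using 1
    ext m
    simp
  obtain ⟨ρ, -, e, he, hρ⟩ := hcomp.isSeqCompact (fun M => subset_closure (Set.mem_range_self M))
  refine ⟨ρ, inferInstance, aemeasurable_id, fun t => ?_⟩
  rw [Measure.map_id]
  have h1 := ProbabilityMeasure.tendsto_iff_tendsto_charFun.1 hρ t
  exact tendsto_nhds_unique h1 ((hlim t).comp he.tendsto_atTop)

variable {ρ : Measure ℝ} [IsProbabilityMeasure ρ]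

/-- The functions 2m² (1 − cos(x/m)) = (2m sin(x/(2m)))² tend to x², and their integrals, read off
from the characteristic function, are at most 1/2. Fatou's lemma bounds the second moment. -/
theorem memLp_two_of_charFun (hρ : ∀ t : ℝ, charFun ρ t = ((1 / √(Real.cosh t) : ℝ) : ℂ)) :
    MemLp id 2 ρ := by
  have hcos : ∀ t : ℝ, ∫ x, Real.cos (t * x) ∂ρ = 1 / √(Real.cosh t) := by
    intro t
    have h1 := congrArg Complex.re (hρ t)
    rw [charFun_apply_real, Complex.ofReal_re] at h1
    rw [← h1, ← RCLike.re_eq_complex_re, ← integral_re]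
    · refine integral_congr_ae (Eventually.of_forall fun x => ?_)
      simp only [RCLike.re_eq_complex_re]
      rw [← Complex.ofReal_mul, Complex.exp_ofReal_mul_I_re]
    · refine Integrable.of_bound (C := 1) (by fun_prop) (Eventually.of_forall fun x => ?_)
      rw [← Complex.ofReal_mul, Complex.norm_exp_ofReal_mul_I]
  let g : ℕ → ℝ → ℝ := fun m x => ((m : ℝ) * (2 * Real.sin ((m : ℝ)⁻¹ * x / 2))) ^ 2
  have hgm : ∀ m, Measurable (g m) := fun m => by fun_prop
  have hgi : ∀ m, ∫ x, g m x ∂ρ ≤ 1 / 2 := by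
    intro m
    have h1 : ∀ x, g m x = 2 * (m : ℝ) ^ 2 * (1 - Real.cos ((m : ℝ)⁻¹ * x)) := by
      intro x
      have h2 : (m : ℝ)⁻¹ * x = 2 * ((m : ℝ)⁻¹ * x / 2) := by ring
      have h3 := Real.cos_sq' ((m : ℝ)⁻¹ * x / 2)
      rw [h2, Real.cos_two_mul, h3]
      simp only [g]
      rw [h2]
      ring_nf
    have hci : Integrable (fun x => Real.cos ((m : ℝ)⁻¹ * x)) ρ := by
      refine Integrable.of_bound (C := 1) (by fun_prop) (Eventually.of_forall fun x => ?_)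
      exact Real.abs_cos_le_one _
    simp_rw [h1]
    rw [integral_const_mul, integral_sub (integrable_const _) hci, hcos]
    simp only [integral_const, probReal_univ, one_smul]
    rcases Nat.eq_zero_or_pos m with rfl | hm
    · simp
    have hm' : (0 : ℝ) < m := by exact_mod_cast hm
    -- From cosh u ≤ exp(u²/2) and exp(−u²/4) ≥ 1 − u²/4.
    have h4 : 1 - ((m : ℝ)⁻¹) ^ 2 / 4 ≤ 1 / √(Real.cosh ((m : ℝ)⁻¹)) := by
      set u := (m : ℝ)⁻¹
      have h5 : √(Real.cosh u) ≤ Real.exp (u ^ 2 / 4) := by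
        refine Real.sqrt_le_iff.2 ⟨(Real.exp_pos _).le, ?_⟩
        rw [← Real.exp_nat_mul]
        refine (Real.cosh_le_exp_half_sq u).trans_eq ?_
        congr 1
        push_cast
        ring
      have h6 : Real.exp (-(u ^ 2 / 4)) ≤ 1 / √(Real.cosh u) := by
        rw [Real.exp_neg, ← one_div]
        exact one_div_le_one_div_of_le (Real.sqrt_pos.2 (Real.cosh_pos _)) h5
      have h7 := Real.add_one_le_exp (-(u ^ 2 / 4))
      linarith
    calc 2 * (m : ℝ) ^ 2 * (1 - 1 / √(Real.cosh ((m : ℝ)⁻¹)))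
        ≤ 2 * (m : ℝ) ^ 2 * (((m : ℝ)⁻¹) ^ 2 / 4) := by gcongr; linarith
      _ = 1 / 2 := by field_simp; norm_num
  have hlim : ∀ x, Tendsto (fun m => g m x) atTop (𝓝 (x ^ 2)) := by
    intro x
    have h1 : HasDerivAt (fun u : ℝ => 2 * Real.sin (u * x / 2)) x 0 := by
      have h2 : HasDerivAt (fun u : ℝ => u * x / 2) (x / 2) 0 := by
        simpa using ((hasDerivAt_id (0 : ℝ)).mul_const x).div_const 2
      have h3 := h2.sin.const_mul 2
      have h4 : 2 * (Real.cos (0 * x / 2) * (x / 2)) = x := by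
        norm_num
        ring
      rwa [h4] at h3
    have hinv : Tendsto (fun m : ℕ => (m : ℝ)⁻¹) atTop (𝓝[≠] 0) := by
      refine tendsto_nhdsWithin_iff.2 ⟨tendsto_inv_atTop_nhds_zero_nat, ?_⟩
      filter_upwards [eventually_gt_atTop 0] with m hm
      exact inv_ne_zero (Nat.cast_ne_zero.2 hm.ne')
    have h5 := ((hasDerivAt_iff_tendsto_slope_zero.1 h1).comp hinv).pow 2
    simpa [Function.comp_def, g] using h5
  refine (memLp_two_iff_integrable_sq aestronglyMeasurable_id).2 ⟨by fun_prop, ?_⟩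
  rw [hasFiniteIntegral_iff_ofReal (Eventually.of_forall fun x => sq_nonneg _)]
  have hF := lintegral_liminf_le (μ := ρ) (u := atTop)
    (fun m => (hgm m).ennreal_ofReal)
  have h1 : ∀ x, liminf (fun m => ENNReal.ofReal (g m x)) atTop = ENNReal.ofReal (x ^ 2) :=
    fun x => ((ENNReal.continuous_ofReal.tendsto _).comp (hlim x)).liminf_eq
  rw [lintegral_congr h1] at hF
  refine (hF.trans ?_).trans_lt (ENNReal.ofReal_lt_top (r := 1 / 2))
  refine liminf_le_of_le ⟨0, by simp⟩ fun b hb => ?_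
  obtain ⟨m, hm⟩ := hb.exists
  refine hm.trans ?_
  rw [← ofReal_integral_eq_lintegral_ofReal]
  · exact ENNReal.ofReal_le_ofReal (hgi m)
  · refine Integrable.of_bound (C := (m * 2 : ℝ) ^ 2) (hgm m).aestronglyMeasurable
      (Eventually.of_forall fun x => ?_)
    rw [Real.norm_of_nonneg (sq_nonneg _)]
    rw [← sq_abs, abs_mul, abs_mul, abs_two, Nat.abs_cast]
    gcongr
    exact mul_le_of_le_one_right two_pos.le (Real.abs_sin_le_one _)
  · exact Eventually.of_forall fun x => sq_nonneg _

/-- The characteristic function is even, so the law is invariant under x ↦ −x. -/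
theorem integral_eq_zero_of_charFun (hρ : ∀ t : ℝ, charFun ρ t = ((1 / √(Real.cosh t) : ℝ) : ℂ)) :
    ∫ x, x ∂ρ = 0 := by
  have h1 : ρ.map (fun x => -1 * x) = ρ := by
    have : IsProbabilityMeasure (ρ.map fun x => -1 * x) :=
      Measure.isProbabilityMeasure_map (by fun_prop)
    refine Measure.ext_of_charFun (funext fun t => ?_)
    rw [charFun_map_mul, hρ, hρ, neg_one_mul, Real.cosh_neg]
  have h2 : ∫ x, x ∂(ρ.map fun x => -1 * x) = ∫ x, -1 * x ∂ρ :=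
    integral_map (by fun_prop) (by fun_prop)
  rw [h1, integral_const_mul] at h2
  linarith

end InvSqrtCosh

/-! ### Unconditional L² convergence of orthogonal series -/

section L2Series

variable {Ω : Type*} [MeasurableSpace Ω] {P : Measure Ω}

/-- By Pythagoras, the Cauchy criterion over finite sets for the vectors is the one for their
squared norms. The second form of the convergence is the one that `norm_charFun_sub_le` consumes. -/
theorem exists_isL2Sum_of_orthogonal {ι : Type*} {Y : ι → Ω → ℝ} (hY : ∀ r, MemLp (Y r) 2 P)
    (h0 : ∀ r s, r ≠ s → ∫ ω, Y r ω * Y s ω ∂P = 0)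
    (hsum : Summable fun r => ∫ ω, Y r ω * Y r ω ∂P) :
    ∃ W : Ω → ℝ, IsL2Sum P Y W ∧
      Tendsto (fun s : Finset ι => ∫ ω, (W ω - ∑ r ∈ s, Y r ω) ^ 2 ∂P) atTop (𝓝 0) := by
  classical
  set y : ι → Lp ℝ 2 P := fun r => (hY r).toLp (Y r) with hy
  have hin : ∀ r s, inner ℝ (y r) (y s) = ∫ ω, Y r ω * Y s ω ∂P := by
    intro r s
    rw [← integral_mul_eq_inner]
    refine integral_congr_ae ?_
    filter_upwards [(hY r).coeFn_toLp, (hY s).coeFn_toLp] with ω h1 h2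
    rw [h1, h2]
  have hnorm : ∀ t : Finset ι, ‖∑ r ∈ t, y r‖ ^ 2 = ∑ r ∈ t, ∫ ω, Y r ω * Y r ω ∂P := by
    intro t
    rw [← real_inner_self_eq_norm_sq, sum_inner]
    refine Finset.sum_congr rfl fun r hr => ?_
    rw [inner_sum, ← hin]
    refine Finset.sum_eq_single_of_mem r hr fun s _ hsr => ?_
    rw [hin, h0 r s hsr.symm]
  have hsumm : Summable y := by
    rw [summable_iff_vanishing_norm]
    intro ε hε
    obtain ⟨s, hs⟩ := summable_iff_vanishing_norm.1 hsum (ε ^ 2) (by positivity)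
    refine ⟨s, fun t ht => ?_⟩
    have h1 := hs t ht
    rw [← hnorm, Real.norm_of_nonneg (sq_nonneg _)] at h1
    exact lt_of_pow_lt_pow_left₀ 2 hε.le h1
  obtain ⟨w, hw⟩ := hsumm
  have hlim : Tendsto (fun s : Finset ι => ‖w - ∑ r ∈ s, y r‖) atTop (𝓝 0) := by
    have h1 : Tendsto (fun s : Finset ι => ∑ r ∈ s, y r) atTop (𝓝 w) := hw
    have h2 := ((tendsto_const_nhds (x := w)).sub h1).norm
    simpa using h2
  have hae : ∀ s : Finset ι, (w - ∑ r ∈ s, y r : Lp ℝ 2 P) =ᵐ[P]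
      fun ω => w ω - ∑ r ∈ s, Y r ω := by
    intro s
    have h1 : ∀ᵐ ω ∂P, ∀ r ∈ s, y r ω = Y r ω :=
      (ae_ball_iff s.countable_toSet).2 fun r _ => (hY r).coeFn_toLp
    filter_upwards [Lp.coeFn_sub w (∑ r ∈ s, y r), Lp.coeFn_finsetSum s y, h1] with ω h2 h3 h4
    rw [h2, Pi.sub_apply, h3, Finset.sum_apply, Finset.sum_congr rfl h4]
  refine ⟨w, ⟨Lp.memLp w, ?_⟩, ?_⟩
  · have h1 := ENNReal.tendsto_ofReal hlim
    rw [ENNReal.ofReal_zero] at h1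
    refine h1.congr fun s => ?_
    rw [← eLpNorm_congr_ae (hae s), ofReal_norm, Lp.enorm_def]
  · have h1 := hlim.pow 2
    rw [zero_pow two_ne_zero] at h1
    refine h1.congr fun s => ?_
    rw [← real_inner_self_eq_norm_sq, ← integral_mul_eq_inner]
    refine integral_congr_ae ((hae s).mono fun ω hω => ?_)
    simp only
    rw [hω, sq]

theorem exists_isL2Sum_of_iid {ι : Type*} {V : ι → Ω → ℝ} {μ : Measure ℝ}
    (hV : ∀ r, HasLaw (V r) μ P) (hVi : iIndepFun V P) (hμ : MemLp id 2 μ) (hμ0 : ∫ x, x ∂μ = 0)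
    {lam : ι → ℝ} (hlam : Summable fun r => lam r ^ 2) :
    ∃ W : Ω → ℝ, IsL2Sum P (fun r ω => lam r * V r ω) W ∧
      Tendsto (fun s : Finset ι => ∫ ω, (W ω - ∑ r ∈ s, lam r * V r ω) ^ 2 ∂P) atTop (𝓝 0) := by
  have hL : ∀ r, MemLp (V r) 2 P := by
    intro r
    have h1 := hμ
    rw [← (hV r).map_eq] at h1
    exact h1.comp_of_map (hV r).aemeasurable
  refine exists_isL2Sum_of_orthogonal (fun r => (hL r).const_mul _) (fun r s hrs => ?_) ?_
  · have h1 : ∀ ω, lam r * V r ω * (lam s * V s ω) = lam r * lam s * (V r ω * V s ω) :=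
      fun ω => by ring
    simp_rw [h1]
    rw [integral_const_mul]
    have h2 : ∫ ω, V r ω * V s ω ∂P = (∫ ω, V r ω ∂P) * ∫ ω, V s ω ∂P :=
      (hVi.indepFun hrs).integral_mul_eq_mul_integral (hL r).1 (hL s).1
    have h3 : ∫ ω, V r ω ∂P = 0 := by
      rw [← hμ0, ← (hV r).integral_eq]
    rw [h2, h3]
    simp
  · refine (hlam.mul_right (∫ x, x * x ∂μ)).congr fun r => ?_
    have h1 : ∀ ω, lam r * V r ω * (lam r * V r ω) = lam r ^ 2 * (V r ω * V r ω) :=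
      fun ω => by ring
    simp_rw [h1]
    rw [integral_const_mul, ← (hV r).map_eq, integral_map (hV r).aemeasurable (by fun_prop)]

end L2Series

/-! ### Finite rank kernels with weights w_k w_l -/

section QuadraticForms

theorem sum_sum_lt_mul_eq (a : ℕ → ℝ) (n : ℕ) :
    ∑ l ∈ Finset.range n, ∑ k ∈ Finset.range l, a k * a l
      = 1 / 2 * ((∑ k ∈ Finset.range n, a k) ^ 2 - ∑ k ∈ Finset.range n, a k ^ 2) := by
  induction n with
  | zero => simp
  | succ n ih =>
    rw [Finset.sum_range_succ, ih, Finset.sum_range_succ, Finset.sum_range_succ, ← Finset.sum_mul]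
    ring

theorem weightedU_finiteKernel {S ι : Type*} (c : ℕ → ℕ → ℝ) (lam : ι → ℝ) (φ : ι → S → ℝ)
    (s : Finset ι) (n : ℕ) (x : ℕ → S) :
    weightedU c (finiteKernel lam φ s) n x
      = ∑ r ∈ s, lam r * ∑ l ∈ Finset.range n, ∑ k ∈ Finset.range l,
          c k l * (φ r (x k) * φ r (x l)) := by
  simp only [weightedU, finiteKernel, Finset.mul_sum]
  conv_rhs => rw [Finset.sum_comm]
  refine Finset.sum_congr rfl fun l _ => ?_
  conv_rhs => rw [Finset.sum_comm]
  exact Finset.sum_congr rfl fun k _ => Finset.sum_congr rfl fun r _ => by ring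

variable {S Ω Ω' : Type*} [MeasurableSpace S] [MeasurableSpace Ω] [MeasurableSpace Ω']
  {ν : Measure S} [IsProbabilityMeasure ν] {P : Measure Ω} [IsProbabilityMeasure P]
  {P' : Measure Ω'} [IsProbabilityMeasure P']

/-- The limit theorem for the quadratic forms of finite rank with a product weight. -/
theorem tendstoInDistribution_weightedU_finiteKernel
    {X : ℕ → Ω → S} (hXm : ∀ i, Measurable (X i)) (hXlaw : ∀ i, HasLaw (X i) ν P)
    (hXindep : iIndepFun X P) {ι : Type*} {φ : ι → S → ℝ} (hφ : IsCenteredOrthonormal ν φ)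
    (lam : ι → ℝ) (s : Finset ι) {w : ℕ → ℝ} (hw : ∀ k, w k ^ 2 = 1)
    {ζ : ι → Ω' → ℝ} (hζ : ∀ r, HasLaw (ζ r) (gaussianReal 0 1) P') (hζi : iIndepFun ζ P') :
    TendstoInDistribution (fun (n : ℕ) ω => (n : ℝ)⁻¹ *
        weightedU (fun k l => w k * w l) (finiteKernel lam φ s) n fun i => X i ω) atTop
      (fun ω => ∑ r ∈ s, 1 / 2 * lam r * (ζ r ω ^ 2 - 1)) (fun _ => P) P' := by
  have hφm := hφ.measurable
  have hclt := tendstoInDistribution_weighted (κ := Unit) (d := s) (P' := P') hXm hXlaw hXindep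
    (hφ.comp (e := ((↑) : s → ι)) Subtype.val_injective) (fun _ _ k => w k) (B := 1)
    (fun _ _ k => by
      rw [← sq_le_one_iff_abs_le_one]
      exact (hw k).le)
    (fun _ => by
      refine tendsto_const_nhds.congr' ?_
      filter_upwards [eventually_gt_atTop 0] with n hn
      have hn' : (n : ℝ) ≠ 0 := Nat.cast_ne_zero.2 hn.ne'
      simp only [← sq, hw]
      simp [hn'])
    (fun p q h => absurd (Subsingleton.elim p q) h)
    (Z := fun i => ζ i.2) (fun i => hζ _)
    (hζi.precomp (g := fun i : Unit × s => (i.2 : ι)) fun i j h =>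
      Prod.ext rfl (Subtype.val_injective h))
  -- The diagonal part of the quadratic form. The signs square to one, so it consists of averages of
  -- φ_r(X_k)², which tend to 1 by the strong law; this is the −1 in ζ_r² − 1.
  let D : ℕ → Ω → ℝ := fun n ω => -∑ r ∈ s, 1 / 2 * lam r *
    ((∑ k ∈ Finset.range n, φ r (X k ω) ^ 2) / n)
  have hDm : ∀ n, Measurable (D n) := fun n =>
    (Finset.measurable_sum _ fun r _ => ((Finset.measurable_sum _ fun k _ =>
      ((hφm r).comp (hXm k)).pow_const 2).div_const _).const_mul _).neg
  have hDlim : TendstoInMeasure P D atTop (fun _ => -∑ r ∈ s, 1 / 2 * lam r * 1) := by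
    refine tendstoInMeasure_of_tendsto_ae (fun n => (hDm n).aestronglyMeasurable) ?_
    have hr : ∀ r ∈ s, ∀ᵐ ω ∂P, Tendsto (fun n : ℕ =>
        (∑ k ∈ Finset.range n, φ r (X k ω) ^ 2) / n) atTop (𝓝 1) := by
      intro r _
      have hm : Measurable fun x => φ r x ^ 2 := (hφm r).pow_const 2
      have hint : Integrable (fun ω => φ r (X 0 ω) ^ 2) P := by
        have h1 := (memLp_two_iff_integrable_sq (hφ.memLp r).1).1 (hφ.memLp r)
        rw [← (hXlaw 0).map_eq] at h1
        exact h1.comp_measurable (hXm 0)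
      have h0 : ∫ ω, φ r (X 0 ω) ^ 2 ∂P = 1 := by
        have h1 := hφ.integral_sq r
        rw [← (hXlaw 0).map_eq, integral_map (hXm 0).aemeasurable (by
          have := (hφm r).aestronglyMeasurable (μ := Measure.map (X 0) P)
          fun_prop)] at h1
        simpa [sq] using h1
      have h := strong_law_ae_real (fun k ω => φ r (X k ω) ^ 2) hint
        (fun i j hij => (hXindep.indepFun hij).comp hm hm)
        (fun i => (IdentDistrib.mk (hXm i).aemeasurable (hXm 0).aemeasurable
          ((hXlaw i).map_eq.trans (hXlaw 0).map_eq.symm)).comp hm)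
      rw [h0] at h
      exact h
    filter_upwards [(ae_ball_iff s.countable_toSet).2 hr] with ω hω
    exact (tendsto_finsetSum _ fun r hr => (hω r hr).const_mul _).neg
  have hg : Continuous fun q : EuclideanSpace ℝ (Unit × s) × ℝ =>
      (∑ r : s, 1 / 2 * lam r * q.1 ((), r) ^ 2) + q.2 := by
    fun_prop
  have key := hclt.continuous_comp_prodMk_of_tendstoInMeasure_const hg hDlim
    (fun n => (hDm n).aemeasurable)
  refine key.congr (fun n => Eventually.of_forall fun ω => ?_) (Eventually.of_forall fun ω => ?_)
  · simp only [D]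
    rw [weightedU_finiteKernel, Finset.mul_sum, Finset.sum_coe_sort s (fun r => 1 / 2 * lam r *
      ((√n)⁻¹ * ∑ k ∈ Finset.range n, w k * φ r (X k ω)) ^ 2), ← sub_eq_add_neg,
      ← Finset.sum_sub_distrib]
    refine Finset.sum_congr rfl fun r _ => ?_
    have h1 : ∑ l ∈ Finset.range n, ∑ k ∈ Finset.range l,
        w k * w l * (φ r (X k ω) * φ r (X l ω))
        = ∑ l ∈ Finset.range n, ∑ k ∈ Finset.range l,
          (w k * φ r (X k ω)) * (w l * φ r (X l ω)) :=
      Finset.sum_congr rfl fun l _ => Finset.sum_congr rfl fun k _ => by ring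
    rw [h1, sum_sum_lt_mul_eq (fun k => w k * φ r (X k ω)), mul_pow, inv_pow,
      Real.sq_sqrt (Nat.cast_nonneg n)]
    simp only [mul_pow, hw, one_mul]
    ring
  · simp only
    rw [Finset.sum_coe_sort s (fun r => 1 / 2 * lam r * ζ r ω ^ 2), ← sub_eq_add_neg,
      ← Finset.sum_sub_distrib]
    exact Finset.sum_congr rfl fun r _ => by ring

end QuadraticForms

/-! ### Cutting the indices into blocks -/

section Blocks

/-- The number, among `M` blocks of nearly equal length, of the block of `{0, …, n - 1}` which
contains `k`. -/
def block (M n k : ℕ) : ℕ := k * M / n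

theorem block_lt {M n k : ℕ} (hk : k < n) (hM : 0 < M) : block M n k < M := by
  rw [block, Nat.div_lt_iff_lt_mul (by omega), mul_comm]
  exact Nat.mul_lt_mul_of_pos_left hk hM

theorem block_mono (M n : ℕ) : Monotone (block M n) := fun _ _ h =>
  Nat.div_le_div_right (Nat.mul_le_mul_right _ h)

theorem filter_block_eq {M n : ℕ} (hM : 0 < M) (hn : 0 < n) {p : ℕ} (hp : p < M) :
    (Finset.range n).filter (fun k => block M n k = p)
      = Finset.Ico ((p * n + (M - 1)) / M) (((p + 1) * n + (M - 1)) / M) := by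
  -- The quotient (a + (M − 1)) / M is a/M rounded up, and block p consists of the k with p n ≤ k M
  -- < (p + 1) n.
  have h1 : ∀ a k : ℕ, (a + (M - 1)) / M ≤ k ↔ a ≤ k * M := by
    intro a k
    rw [← Nat.lt_succ_iff, Nat.div_lt_iff_lt_mul hM, Nat.succ_mul]
    omega
  have h1' : ∀ a k : ℕ, k < (a + (M - 1)) / M ↔ k * M < a := fun a k => by
    rw [← not_le, h1, not_le]
  ext k
  rw [Finset.mem_filter, Finset.mem_range, Finset.mem_Ico, h1, h1', block, Nat.div_eq_iff hn]
  constructor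
  · rintro ⟨_, h2, h3⟩
    rw [Nat.succ_mul]
    omega
  · rintro ⟨h2, h3⟩
    have h4 : k * M < n * M := by
      refine h3.trans_le ?_
      rw [mul_comm n]
      exact Nat.mul_le_mul_right _ hp
    refine ⟨?_, h2, ?_⟩
    · have h5 := lt_of_mul_lt_mul_right h4 (Nat.zero_le M)
      exact h5
    · rw [Nat.succ_mul] at h3
      omega

theorem abs_card_block_sub_le {M n : ℕ} (hM : 0 < M) (hn : 0 < n) {p : ℕ} (hp : p < M) :
    |(M : ℝ) * ((Finset.range n).filter fun k => block M n k = p).card - n| ≤ M := by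
  rw [filter_block_eq hM hn hp, Nat.card_Ico]
  set a := (p * n + (M - 1)) / M
  set b := ((p + 1) * n + (M - 1)) / M
  have ha1 : a * M ≤ p * n + (M - 1) := Nat.div_mul_le_self _ _
  have ha2 : p * n + (M - 1) < a * M + M := Nat.lt_div_mul_add hM
  have hb1 : b * M ≤ (p + 1) * n + (M - 1) := Nat.div_mul_le_self _ _
  have hb2 : (p + 1) * n + (M - 1) < b * M + M := Nat.lt_div_mul_add hM
  have hab : a ≤ b := Nat.div_le_div_right (by rw [Nat.succ_mul]; omega)
  have hpn : (p + 1) * n = p * n + n := Nat.succ_mul p n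
  rw [hpn] at hb1 hb2
  rw [Nat.cast_sub hab]
  have hM' : M - 1 + 1 = M := by omega
  have e1 : a * M + 1 ≤ p * n + M := by omega
  have e2 : p * n ≤ a * M := by omega
  have e3 : b * M + 1 ≤ p * n + n + M := by omega
  have e4 : p * n + n ≤ b * M := by omega
  have r1 : (a : ℝ) * M + 1 ≤ p * n + M := by exact_mod_cast e1
  have r2 : (p : ℝ) * n ≤ a * M := by exact_mod_cast e2
  have r3 : (b : ℝ) * M + 1 ≤ p * n + n + M := by exact_mod_cast e3
  have r4 : (p : ℝ) * n + n ≤ b * M := by exact_mod_cast e4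
  rw [abs_le]
  constructor <;> nlinarith

/-- A block is an interval, so its sum is a difference of two initial sums, each at most 1 in
absolute value. -/
theorem abs_sum_block_le {M n : ℕ} (hM : 0 < M) (hn : 0 < n) {p : ℕ} (hp : p < M) {a : ℕ → ℝ}
    (ha : ∀ m, |∑ k ∈ Finset.range m, a k| ≤ 1) :
    |∑ k ∈ (Finset.range n).filter (fun k => block M n k = p), a k| ≤ 2 := by
  rw [filter_block_eq hM hn hp]
  have hab : (p * n + (M - 1)) / M ≤ ((p + 1) * n + (M - 1)) / M :=
    Nat.div_le_div_right (by rw [Nat.succ_mul]; omega)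
  rw [Finset.sum_Ico_eq_sub _ hab]
  have h1 := ha ((p * n + (M - 1)) / M)
  have h2 := ha (((p + 1) * n + (M - 1)) / M)
  rw [abs_le] at *
  constructor <;> linarith

theorem sum_block_pairs {M n : ℕ} (hM : 0 < M) (a b : ℕ → ℝ) :
    ∑ q ∈ Finset.range M, ∑ p ∈ Finset.range q,
      (∑ k ∈ Finset.range n, if block M n k = p then a k else 0) *
        (∑ l ∈ Finset.range n, if block M n l = q then b l else 0)
      = ∑ l ∈ Finset.range n, ∑ k ∈ Finset.range l,
        (if block M n k < block M n l then 1 else 0) * (a k * b l) := by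
  have h1 : ∀ m, ∑ p ∈ Finset.range m, (∑ k ∈ Finset.range n, if block M n k = p then a k else 0)
      = ∑ k ∈ Finset.range n, if block M n k < m then a k else 0 := by
    intro m
    rw [Finset.sum_comm]
    refine Finset.sum_congr rfl fun k _ => ?_
    rw [Finset.sum_ite_eq]
    simp
  simp_rw [← Finset.sum_mul, h1, Finset.mul_sum]
  rw [Finset.sum_comm]
  refine Finset.sum_congr rfl fun l hl => ?_
  rw [Finset.sum_eq_single_of_mem (block M n l)
    (Finset.mem_range.2 (block_lt (Finset.mem_range.1 hl) hM))
    (fun q _ hq => by rw [if_neg hq.symm, mul_zero]), if_pos rfl, Finset.sum_mul]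
  symm
  have h2 : ∀ k, (if block M n k < block M n l then (1 : ℝ) else 0) * (a k * b l)
      = (if block M n k < block M n l then a k else 0) * b l := by
    intro k
    split_ifs <;> ring
  simp_rw [h2]
  -- Block numbers increase with the index, so the terms with k ≥ l contribute nothing.
  refine Finset.sum_subset (Finset.range_mono (Finset.mem_range.1 hl).le) fun k _ hk => ?_
  have h3 : block M n l ≤ block M n k := block_mono M n (by simpa using hk)
  rw [if_neg (not_lt.2 h3), zero_mul]

/-- Only pairs inside one block count, and each `l` has at most n/M predecessors in its own block.
-/
theorem sum_same_block_le {M n : ℕ} (hM : 0 < M) :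
    ∑ l ∈ Finset.range n, ∑ k ∈ Finset.range l,
      (1 - if block M n k < block M n l then (1 : ℝ) else 0) ^ 2 ≤ (n : ℝ) ^ 2 / M := by
  have h1 : ∀ l ∈ Finset.range n, ∑ k ∈ Finset.range l,
      (1 - if block M n k < block M n l then (1 : ℝ) else 0) ^ 2 ≤ (n : ℝ) / M := by
    intro l hl
    have hl' := Finset.mem_range.1 hl
    have hn : 0 < n := by omega
    have h2 : ∀ k, (1 - if block M n k < block M n l then (1 : ℝ) else 0) ^ 2
        = if block M n l ≤ block M n k then 1 else 0 := by
      intro k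
      by_cases h : block M n k < block M n l
      · simp [h]
      · simp [h, not_lt.1 h]
    simp_rw [h2]
    rw [← Finset.sum_filter, Finset.sum_const, nsmul_eq_mul, mul_one]
    have hsub : (Finset.range l).filter (fun k => block M n l ≤ block M n k)
        ⊆ Finset.Ico (l - n / M) l := by
      intro k hk
      rw [Finset.mem_filter, Finset.mem_range] at hk
      rw [Finset.mem_Ico]
      refine ⟨?_, hk.1⟩
      have h3 : block M n l * n ≤ k * M :=
        (Nat.mul_le_mul_right n hk.2).trans (Nat.div_mul_le_self _ _)
      have h4 : l * M < block M n l * n + n := Nat.lt_div_mul_add hn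
      have h5 : (l - k) * M ≤ n := by
        rw [Nat.sub_mul]
        omega
      have h6 : l - k ≤ n / M := (Nat.le_div_iff_mul_le hM).2 h5
      omega
    have hcard := Finset.card_le_card hsub
    rw [Nat.card_Ico] at hcard
    have h7 : ((Finset.range l).filter (fun k => block M n l ≤ block M n k)).card ≤ n / M :=
      hcard.trans (tsub_le_iff_left.2 le_tsub_add)
    calc (((Finset.range l).filter (fun k => block M n l ≤ block M n k)).card : ℝ)
        ≤ ((n / M : ℕ) : ℝ) := by exact_mod_cast h7
      _ ≤ (n : ℝ) / M := Nat.cast_div_le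
  refine (Finset.sum_le_card_nsmul _ _ _ h1).trans_eq ?_
  rw [Finset.card_range, nsmul_eq_mul]
  ring

end Blocks

/-! ### Limit of the block approximation for fixed M -/

section BlockLimit

variable {S Ω : Type*} [MeasurableSpace S] [MeasurableSpace Ω]
  {ν : Measure S} [IsProbabilityMeasure ν] {P : Measure Ω} [IsProbabilityMeasure P]

/-- The weights which restrict two sign sequences to the blocks. -/
noncomputable def blockWeight (u v : ℕ → ℝ) (M n : ℕ) (p : Fin M × Bool) (k : ℕ) : ℝ :=
  √M * if block M n k = p.1 then (if p.2 then v k else u k) else 0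

/-- A block has n/M elements up to an error of at most 1, which the square of the factor `√M`
compensates. -/
theorem tendsto_blockWeight_sq {u v : ℕ → ℝ} (hu : ∀ k, u k ^ 2 = 1) (hv : ∀ k, v k ^ 2 = 1)
    {M : ℕ} (hM : 0 < M) (p : Fin M × Bool) :
    Tendsto (fun n : ℕ => (n : ℝ)⁻¹ * ∑ k ∈ Finset.range n,
      blockWeight u v M n p k * blockWeight u v M n p k) atTop (𝓝 1) := by
  rw [tendsto_iff_norm_sub_tendsto_zero]
  have h0 : Tendsto (fun n : ℕ => (n : ℝ)⁻¹ * M) atTop (𝓝 0) := by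
    simpa using (tendsto_inv_atTop_nhds_zero_nat (𝕜 := ℝ)).mul_const (M : ℝ)
  refine squeeze_zero' (Eventually.of_forall fun _ => norm_nonneg _) ?_ h0
  filter_upwards [eventually_gt_atTop 0] with n hn
  have hn' : (0 : ℝ) < n := by exact_mod_cast hn
  have h1 : ∑ k ∈ Finset.range n, blockWeight u v M n p k * blockWeight u v M n p k
      = M * ((Finset.range n).filter fun k => block M n k = p.1).card := by
    have h2 : ∀ k, blockWeight u v M n p k * blockWeight u v M n p k
        = if block M n k = p.1 then (M : ℝ) else 0 := by
      intro k
      have h3 : (if p.2 then v k else u k) * (if p.2 then v k else u k) = 1 := by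
        rw [← sq]
        split_ifs
        · exact hv k
        · exact hu k
      rw [blockWeight, mul_mul_mul_comm, Real.mul_self_sqrt (Nat.cast_nonneg _)]
      by_cases h : block M n k = p.1
      · rw [if_pos h, if_pos h, h3, mul_one]
      · rw [if_neg h, if_neg h, mul_zero, mul_zero]
    simp_rw [h2]
    rw [← Finset.sum_filter, Finset.sum_const, nsmul_eq_mul, mul_comm]
  rw [h1]
  have h4 := abs_card_block_sub_le hM hn p.1.2
  have h5 : (n : ℝ)⁻¹ * (M * ((Finset.range n).filter fun k => block M n k = p.1).card) - 1
      = (n : ℝ)⁻¹ * (M * ((Finset.range n).filter fun k => block M n k = p.1).card - n) := by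
    field_simp
  rw [h5, Real.norm_eq_abs, abs_mul, abs_of_pos (inv_pos.2 hn')]
  exact mul_le_mul_of_nonneg_left h4 (inv_pos.2 hn').le

/-- Different blocks have disjoint supports. In one block the sum of u v is at most 2 in absolute
value, however long the block is; this is where the orthogonality of the two sign sequences enters.
-/
theorem tendsto_blockWeight_mul {u v : ℕ → ℝ}
    (huv : ∀ m, |∑ k ∈ Finset.range m, u k * v k| ≤ 1)
    {M : ℕ} (hM : 0 < M) (p q : Fin M × Bool) (hpq : p ≠ q) :
    Tendsto (fun n : ℕ => (n : ℝ)⁻¹ * ∑ k ∈ Finset.range n,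
      blockWeight u v M n p k * blockWeight u v M n q k) atTop (𝓝 0) := by
  obtain ⟨p, b⟩ := p
  obtain ⟨q, b'⟩ := q
  by_cases hp : p = q
  · subst hp
    have hb : b ≠ b' := fun h => hpq (by rw [h])
    have h2 : ∀ n k, blockWeight u v M n (p, b) k * blockWeight u v M n (p, b') k
        = if block M n k = p then (M : ℝ) * (u k * v k) else 0 := by
      intro n k
      rw [blockWeight, blockWeight, mul_mul_mul_comm, Real.mul_self_sqrt (Nat.cast_nonneg _)]
      by_cases h : block M n k = p
      · rw [if_pos h, if_pos h, if_pos h]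
        cases b <;> cases b' <;> first | exact absurd rfl hb | simp [mul_comm]
      · rw [if_neg h, if_neg h, if_neg h, mul_zero, mul_zero]
    have h0 : Tendsto (fun n : ℕ => (n : ℝ)⁻¹ * (M * 2)) atTop (𝓝 0) := by
      simpa using (tendsto_inv_atTop_nhds_zero_nat (𝕜 := ℝ)).mul_const ((M : ℝ) * 2)
    refine squeeze_zero_norm' ?_ h0
    filter_upwards [eventually_gt_atTop 0] with n hn
    have hn' : (0 : ℝ) < n := by exact_mod_cast hn
    simp_rw [h2]
    rw [← Finset.sum_filter, ← Finset.mul_sum, Real.norm_eq_abs, abs_mul, abs_mul,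
      abs_of_pos (inv_pos.2 hn'), Nat.abs_cast]
    have h3 := abs_sum_block_le hM hn p.2 huv
    gcongr
  · have h2 : ∀ n k, blockWeight u v M n (p, b) k * blockWeight u v M n (q, b') k = 0 := by
      intro n k
      simp only [blockWeight]
      by_cases h : block M n k = p
      · have h3 : block M n k ≠ q := fun h' => hp (Fin.ext (h.symm.trans h'))
        rw [if_neg h3]
        simp
      · rw [if_neg h]
        simp
    simp_rw [h2]
    simp

/-- The limit theorem for the block approximations of a sign-alternating quadratic form. -/
theorem tendstoInDistribution_weightedU_block
    {X : ℕ → Ω → S} (hXm : ∀ i, Measurable (X i)) (hXlaw : ∀ i, HasLaw (X i) ν P)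
    (hXindep : iIndepFun X P) {ι : Type*} {φ : ι → S → ℝ} (hφ : IsCenteredOrthonormal ν φ)
    (lam : ι → ℝ) (s : Finset ι) {u v : ℕ → ℝ} (hu : ∀ k, u k ^ 2 = 1) (hv : ∀ k, v k ^ 2 = 1)
    (huv : ∀ m, |∑ k ∈ Finset.range m, u k * v k| ≤ 1) {M : ℕ} (hM : 0 < M) :
    TendstoInDistribution (fun (n : ℕ) ω => (n : ℝ)⁻¹ *
        weightedU (fun k l => u k * v l * if block M n k < block M n l then 1 else 0)
          (finiteKernel lam φ s) n fun i => X i ω) atTop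
      (fun ω => ∑ r ∈ s, lam r * rowArea r M ω) (fun _ => P) (gaussianArrays ι) := by
  have hclt := tendstoInDistribution_weighted (κ := Fin M × Bool) (d := s)
    (P' := gaussianArrays ι) hXm hXlaw hXindep
    (hφ.comp (e := ((↑) : s → ι)) Subtype.val_injective) (blockWeight u v M) (B := √M)
    (fun n p k => by
      have h1 : |if block M n k = p.1 then (if p.2 then v k else u k) else 0| ≤ 1 := by
        rw [← sq_le_one_iff_abs_le_one]
        split_ifs
        · exact (hv k).le
        · exact (hu k).le
        · simp
      rw [blockWeight, abs_mul, abs_of_nonneg (Real.sqrt_nonneg _)]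
      exact mul_le_of_le_one_right (Real.sqrt_nonneg _) h1)
    (tendsto_blockWeight_sq hu hv hM) (tendsto_blockWeight_mul huv hM)
    (Z := fun i ω => ω i.2 (i.1.1, i.1.2)) (fun i => hasLaw_gaussianArrays _ _)
    ((iIndepFun_gaussianArrays ι).precomp
      (g := fun i : (Fin M × Bool) × s => ((i.2 : ι), ((i.1.1 : ℕ), i.1.2)))
      (by
        rintro ⟨⟨p, b⟩, r⟩ ⟨⟨p', b'⟩, r'⟩ h
        simp only [Prod.mk.injEq] at h
        obtain ⟨h1, h2, h3⟩ := h
        rw [Subtype.ext h1, Fin.ext h2, h3]))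
  -- Coordinates extended by zero from `Fin M` to ℕ, to match the sums in `area`. Only indices below
  -- M are evaluated, so the default value plays no role.
  let co : EuclideanSpace ℝ ((Fin M × Bool) × s) → s → ℕ × Bool → ℝ := fun x r i =>
    if h : i.1 < M then x ((⟨i.1, h⟩, i.2), r) else 0
  have hco : ∀ r i, Continuous fun x => co x r i := by
    intro r i
    by_cases h : i.1 < M
    · simp only [co, dif_pos h]
      fun_prop
    · simp only [co, dif_neg h]
      fun_prop
  have hg : Continuous fun x : EuclideanSpace ℝ ((Fin M × Bool) × s) =>
      ∑ r : s, lam r * ((M : ℝ)⁻¹ * ∑ q ∈ Finset.range M, ∑ p ∈ Finset.range q,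
        co x r (p, false) * co x r (q, true)) := by
    refine continuous_finsetSum _ fun r _ => continuous_const.mul (continuous_const.mul ?_)
    exact continuous_finsetSum _ fun q _ => continuous_finsetSum _ fun p _ =>
      (hco r _).mul (hco r _)
  have key := hclt.continuous_comp hg
  refine key.congr (fun n => Eventually.of_forall fun ω => ?_) (Eventually.of_forall fun ω => ?_)
  · simp only [Function.comp_apply]
    rw [weightedU_finiteKernel, Finset.mul_sum]
    conv_rhs => rw [← Finset.sum_coe_sort s]
    refine Finset.sum_congr rfl fun r _ => ?_
    have h1 : ∑ l ∈ Finset.range n, ∑ k ∈ Finset.range l,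
        (u k * v l * if block M n k < block M n l then 1 else 0) *
          (φ r (X k ω) * φ r (X l ω))
        = ∑ l ∈ Finset.range n, ∑ k ∈ Finset.range l,
          (if block M n k < block M n l then 1 else 0) *
            ((u k * φ r (X k ω)) * (v l * φ r (X l ω))) :=
      Finset.sum_congr rfl fun l _ => Finset.sum_congr rfl fun k _ => by ring
    rw [h1, ← sum_block_pairs hM, mul_left_comm (n : ℝ)⁻¹]
    congr 1
    rw [Finset.mul_sum, Finset.mul_sum]
    refine Finset.sum_congr rfl fun q hq => ?_
    rw [Finset.mul_sum, Finset.mul_sum]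
    refine Finset.sum_congr rfl fun p hp => ?_
    have hq' := Finset.mem_range.1 hq
    have hp' := (Finset.mem_range.1 hp).trans hq'
    simp only [co, dif_pos hq', dif_pos hp']
    have h2 : ∀ (p : Fin M) (b : Bool), ∑ k ∈ Finset.range n,
        blockWeight u v M n (p, b) k * φ r (X k ω)
        = √M * ∑ k ∈ Finset.range n,
          if block M n k = p then (if b then v k else u k) * φ r (X k ω) else 0 := by
      intro p b
      rw [Finset.mul_sum]
      refine Finset.sum_congr rfl fun k _ => ?_
      rw [blockWeight]
      by_cases h : block M n k = p
      · simp only [h, if_true]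
        ring
      · simp [h]
    rw [h2, h2]
    simp only [Bool.false_eq_true, if_false, if_true]
    have hM' : (0 : ℝ) < M := by exact_mod_cast hM
    -- The factors `√M` of the two block weights cancel the normalisation M⁻¹ of `rowArea`.
    have h3 : (M : ℝ)⁻¹ * (√M * √M) = 1 := by
      rw [Real.mul_self_sqrt hM'.le, inv_mul_cancel₀ hM'.ne']
    have h4 : (√n)⁻¹ * (√n)⁻¹ = (n : ℝ)⁻¹ := by
      rw [← mul_inv, Real.mul_self_sqrt (Nat.cast_nonneg n)]
    rw [← h4]
    linear_combination ((√n)⁻¹ * (√n)⁻¹ *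
      ((∑ k ∈ Finset.range n, if block M n k = p then u k * φ r (X k ω) else 0) *
        ∑ k ∈ Finset.range n, if block M n k = q then v k * φ r (X k ω) else 0)) * h3
  · simp only [Function.comp_apply, rowArea, area]
    rw [← Finset.sum_coe_sort s]
    refine Finset.sum_congr rfl fun r _ => ?_
    congr 2
    refine Finset.sum_congr rfl fun q hq => Finset.sum_congr rfl fun p hp => ?_
    have hq' := Finset.mem_range.1 hq
    have hp' := (Finset.mem_range.1 hp).trans hq'
    simp only [co, dif_pos hq', dif_pos hp']

end BlockLimit

/-! ### Convergence in distribution by approximating characteristic functions -/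

section Approximation

variable {Ω Ω' : Type*} [MeasurableSpace Ω] [MeasurableSpace Ω']
  {P : Measure Ω} [IsProbabilityMeasure P] {P' : Measure Ω'} [IsProbabilityMeasure P']

theorem tendstoInDistribution_iff_charFun {V : ℕ → Ω → ℝ} {W : Ω' → ℝ}
    (hV : ∀ n, AEMeasurable (V n) P) (hW : AEMeasurable W P') :
    TendstoInDistribution V atTop W (fun _ => P) P' ↔
      ∀ t, Tendsto (fun n => charFun (P.map (V n)) t) atTop (𝓝 (charFun (P'.map W) t)) :=
  ⟨fun h => ProbabilityMeasure.tendsto_iff_tendsto_charFun.1 h.tendsto,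
    fun h => ⟨hV, hW, ProbabilityMeasure.tendsto_iff_tendsto_charFun.2 h⟩⟩

/-- A sequence converges in distribution when its characteristic functions can be approximated,
up to any error, by convergent sequences whose limits are close to the right one. -/
theorem tendstoInDistribution_of_charFun_approx {V : ℕ → Ω → ℝ} {W : Ω' → ℝ}
    (hV : ∀ n, AEMeasurable (V n) P) (hW : AEMeasurable W P')
    (h : ∀ t ε : ℝ, 0 < ε → ∃ (a : ℕ → ℂ) (c : ℂ), Tendsto a atTop (𝓝 c) ∧
      (∀ᶠ n in atTop, ‖charFun (P.map (V n)) t - a n‖ ≤ ε) ∧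
        ‖c - charFun (P'.map W) t‖ ≤ ε) :
    TendstoInDistribution V atTop W (fun _ => P) P' := by
  rw [tendstoInDistribution_iff_charFun hV hW]
  intro t
  rw [Metric.tendsto_nhds]
  intro ε hε
  obtain ⟨a, c, ha, h1, h2⟩ := h t (ε / 4) (by positivity)
  filter_upwards [h1, Metric.tendsto_nhds.1 ha (ε / 4) (by positivity)] with n h3 h4
  rw [dist_eq_norm] at h4 ⊢
  calc ‖charFun (P.map (V n)) t - charFun (P'.map W) t‖
      = ‖(charFun (P.map (V n)) t - a n) + (a n - c) + (c - charFun (P'.map W) t)‖ := by ring_nf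
    _ ≤ ‖charFun (P.map (V n)) t - a n‖ + ‖a n - c‖ + ‖c - charFun (P'.map W) t‖ :=
        norm_add₃_le
    _ < ε := by linarith

theorem tendsto_mul_sqrt_zero {α : Type*} {l : Filter α} {g : α → ℝ} (hg : Tendsto g l (𝓝 0))
    (t : ℝ) : Tendsto (fun x => |t| * √(g x)) l (𝓝 0) := by
  simpa using (hg.sqrt).const_mul |t|

/-- Convergence in distribution is not affected by an error which vanishes in `L²`. -/
theorem tendstoInDistribution_of_integral_sub_sq {V V' : ℕ → Ω → ℝ} {W : Ω' → ℝ}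
    (hV : TendstoInDistribution V atTop W (fun _ => P) P') (hV' : ∀ n, AEMeasurable (V' n) P)
    (hVV' : ∀ n, MemLp (fun ω => V' n ω - V n ω) 2 P)
    (h : Tendsto (fun n => ∫ ω, (V' n ω - V n ω) ^ 2 ∂P) atTop (𝓝 0)) :
    TendstoInDistribution V' atTop W (fun _ => P) P' := by
  have hVc := (tendstoInDistribution_iff_charFun hV.forall_aemeasurable
    hV.aemeasurable_limit).1 hV
  refine tendstoInDistribution_of_charFun_approx hV' hV.aemeasurable_limit fun t ε hε =>
    ⟨fun n => charFun (P.map (V n)) t, _, hVc t, ?_, by simpa using hε.le⟩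
  filter_upwards [(tendsto_mul_sqrt_zero h t).eventually_le_const hε] with n hn
  exact (norm_charFun_sub_le (hV' n) (hV.forall_aemeasurable n) (hVV' n) t).trans hn

end Approximation

/-! ### From finite rank to general kernels, and from blocks to full sums -/

section WeightedU

variable {S Ω Ω' : Type*} [MeasurableSpace S] [MeasurableSpace Ω] [MeasurableSpace Ω']
  {ν : Measure S} [IsProbabilityMeasure ν] {P : Measure Ω} [IsProbabilityMeasure P]
  {P' : Measure Ω'} [IsProbabilityMeasure P'] {X : ℕ → Ω → S}

omit [MeasurableSpace S] in
theorem weightedU_sub_kernel (c : ℕ → ℕ → ℝ) (f g : S → S → ℝ) (n : ℕ) (x : ℕ → S) :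
    weightedU c (fun x y => f x y - g x y) n x = weightedU c f n x - weightedU c g n x := by
  simp only [weightedU, mul_sub, Finset.sum_sub_distrib]

omit [MeasurableSpace S] in
theorem weightedU_sub_weight (c d : ℕ → ℕ → ℝ) (f : S → S → ℝ) (n : ℕ) (x : ℕ → S) :
    weightedU (fun k l => c k l - d k l) f n x = weightedU c f n x - weightedU d f n x := by
  simp only [weightedU, sub_mul, Finset.sum_sub_distrib]

theorem sum_sum_lt_sq_le {c : ℕ → ℕ → ℝ} (hc : ∀ k l, c k l ^ 2 ≤ 1) (n : ℕ) :
    ∑ l ∈ Finset.range n, ∑ k ∈ Finset.range l, c k l ^ 2 ≤ (n : ℝ) ^ 2 := by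
  calc ∑ l ∈ Finset.range n, ∑ k ∈ Finset.range l, c k l ^ 2
      ≤ ∑ l ∈ Finset.range n, ∑ k ∈ Finset.range n, c k l ^ 2 :=
        Finset.sum_le_sum fun l hl => Finset.sum_le_sum_of_subset_of_nonneg
          (Finset.range_mono (Finset.mem_range.1 hl).le) fun _ _ _ => sq_nonneg _
    _ ≤ ∑ l ∈ Finset.range n, ∑ k ∈ Finset.range n, (1 : ℝ) :=
        Finset.sum_le_sum fun l _ => Finset.sum_le_sum fun k _ => hc k l
    _ = (n : ℝ) ^ 2 := by simp [sq]

omit [IsProbabilityMeasure ν] in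
theorem IsDegenerate.memLp_inv_mul_weightedU {g : S → S → ℝ} (hg : IsDegenerate ν g)
    (hXm : ∀ i, Measurable (X i)) (hXlaw : ∀ i, HasLaw (X i) ν P) (hXindep : iIndepFun X P)
    (c : ℕ → ℕ → ℝ) (n : ℕ) :
    MemLp (fun ω => (n : ℝ)⁻¹ * weightedU c g n fun i => X i ω) 2 P :=
  (hg.memLp_weightedU hXm hXlaw hXindep c n).const_mul _

theorem IsDegenerate.integral_inv_mul_weightedU_sq_le {g : S → S → ℝ} (hg : IsDegenerate ν g)
    (hXm : ∀ i, Measurable (X i)) (hXlaw : ∀ i, HasLaw (X i) ν P) (hXindep : iIndepFun X P)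
    {c : ℕ → ℕ → ℝ} {n : ℕ} {B : ℝ} (hB : 0 ≤ B)
    (hc : ∑ l ∈ Finset.range n, ∑ k ∈ Finset.range l, c k l ^ 2 ≤ (n : ℝ) ^ 2 * B) :
    ∫ ω, ((n : ℝ)⁻¹ * weightedU c g n fun i => X i ω) ^ 2 ∂P
      ≤ B * ∫ p, g p.1 p.2 ^ 2 ∂(ν.prod ν) := by
  simp_rw [mul_pow]
  rw [integral_const_mul, hg.integral_weightedU_sq hXm hXlaw hXindep, ← mul_assoc]
  refine mul_le_mul_of_nonneg_right ?_ (integral_nonneg fun _ => sq_nonneg _)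
  rcases Nat.eq_zero_or_pos n with rfl | hn
  · simpa using hB
  · have hn' : (0 : ℝ) < n := by exact_mod_cast hn
    rw [inv_pow]
    exact (inv_mul_le_iff₀ (by positivity)).2 hc

theorem IsDegenerate.norm_charFun_weightedU_sub_kernel_le {f g : S → S → ℝ}
    (hf : IsDegenerate ν f) (hg : IsDegenerate ν g)
    (hXm : ∀ i, Measurable (X i)) (hXlaw : ∀ i, HasLaw (X i) ν P) (hXindep : iIndepFun X P)
    {c : ℕ → ℕ → ℝ} (hc : ∀ k l, c k l ^ 2 ≤ 1) (n : ℕ) (t : ℝ) :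
    ‖charFun (P.map fun ω => (n : ℝ)⁻¹ * weightedU c f n fun i => X i ω) t
        - charFun (P.map fun ω => (n : ℝ)⁻¹ * weightedU c g n fun i => X i ω) t‖
      ≤ |t| * √(∫ p, (f p.1 p.2 - g p.1 p.2) ^ 2 ∂(ν.prod ν)) := by
  have hA := hf.memLp_inv_mul_weightedU hXm hXlaw hXindep c n
  have hB := hg.memLp_inv_mul_weightedU hXm hXlaw hXindep c n
  refine (norm_charFun_sub_le hA.1.aemeasurable hB.1.aemeasurable (hA.sub hB) t).trans ?_
  gcongr
  have h := (hf.sub hg).integral_inv_mul_weightedU_sq_le hXm hXlaw hXindep (c := c) (n := n)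
    zero_le_one (by simpa using sum_sum_lt_sq_le hc n)
  simp only [weightedU_sub_kernel, mul_sub, one_mul] at h
  exact h

theorem IsDegenerate.norm_charFun_weightedU_sub_weight_le {g : S → S → ℝ}
    (hg : IsDegenerate ν g)
    (hXm : ∀ i, Measurable (X i)) (hXlaw : ∀ i, HasLaw (X i) ν P) (hXindep : iIndepFun X P)
    {c d : ℕ → ℕ → ℝ} {n : ℕ} {B : ℝ} (hB : 0 ≤ B)
    (hc : ∑ l ∈ Finset.range n, ∑ k ∈ Finset.range l, (c k l - d k l) ^ 2 ≤ (n : ℝ) ^ 2 * B)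
    (t : ℝ) :
    ‖charFun (P.map fun ω => (n : ℝ)⁻¹ * weightedU c g n fun i => X i ω) t
        - charFun (P.map fun ω => (n : ℝ)⁻¹ * weightedU d g n fun i => X i ω) t‖
      ≤ |t| * √(B * ∫ p, g p.1 p.2 ^ 2 ∂(ν.prod ν)) := by
  have hA := hg.memLp_inv_mul_weightedU hXm hXlaw hXindep c n
  have hD := hg.memLp_inv_mul_weightedU hXm hXlaw hXindep d n
  refine (norm_charFun_sub_le hA.1.aemeasurable hD.1.aemeasurable (hA.sub hD) t).trans ?_
  gcongr
  have h := hg.integral_inv_mul_weightedU_sq_le hXm hXlaw hXindep hB hc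
  simp only [weightedU_sub_weight, mul_sub] at h
  exact h

/-- The passage from the finite sections of the kernel to the kernel. -/
theorem IsDegenerate.tendstoInDistribution_weightedU_of_finiteKernel {f : S → S → ℝ}
    (hf : IsDegenerate ν f)
    (hXm : ∀ i, Measurable (X i)) (hXlaw : ∀ i, HasLaw (X i) ν P) (hXindep : iIndepFun X P)
    {ι : Type*} {φ : ι → S → ℝ} (hφ : IsCenteredOrthonormal ν φ) {lam : ι → ℝ}
    (hfφ : Tendsto (fun s => ∫ p, (f p.1 p.2 - finiteKernel lam φ s p.1 p.2) ^ 2 ∂(ν.prod ν))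
      atTop (𝓝 0))
    {V : ι → Ω' → ℝ} (hV : ∀ r, MemLp (V r) 2 P') {W : Ω' → ℝ} (hW : MemLp W 2 P')
    (hVW : Tendsto (fun s => ∫ ω, (W ω - ∑ r ∈ s, lam r * V r ω) ^ 2 ∂P') atTop (𝓝 0))
    {c : ℕ → ℕ → ℝ} (hc : ∀ k l, c k l ^ 2 ≤ 1)
    (h : ∀ s, TendstoInDistribution (fun (n : ℕ) ω => (n : ℝ)⁻¹ *
        weightedU c (finiteKernel lam φ s) n fun i => X i ω) atTop
      (fun ω => ∑ r ∈ s, lam r * V r ω) (fun _ => P) P') :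
    TendstoInDistribution (fun (n : ℕ) ω => (n : ℝ)⁻¹ * weightedU c f n fun i => X i ω) atTop
      W (fun _ => P) P' := by
  refine tendstoInDistribution_of_charFun_approx
    (fun n => (hf.memLp_inv_mul_weightedU hXm hXlaw hXindep c n).1.aemeasurable)
    hW.1.aemeasurable fun t ε hε => ?_
  -- A single finite set serves both the kernel and the limit series; the error in the kernel is
  -- uniform in n.
  obtain ⟨s, hs1, hs2⟩ := (((tendsto_mul_sqrt_zero hfφ t).eventually_le_const hε).and
    ((tendsto_mul_sqrt_zero hVW t).eventually_le_const hε)).exists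
  have hVs : MemLp (fun ω => ∑ r ∈ s, lam r * V r ω) 2 P' :=
    memLp_finsetSum s fun r _ => (hV r).const_mul (lam r)
  refine ⟨_, _, (tendstoInDistribution_iff_charFun (h s).forall_aemeasurable
    (h s).aemeasurable_limit).1 (h s) t, Eventually.of_forall fun n => ?_, ?_⟩
  · exact (hf.norm_charFun_weightedU_sub_kernel_le (hφ.isDegenerate_finiteKernel lam s) hXm hXlaw
      hXindep hc n t).trans hs1
  · rw [norm_sub_rev]
    exact (norm_charFun_sub_le hW.1.aemeasurable hVs.1.aemeasurable (hW.sub hVs) t).trans hs2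

omit [IsProbabilityMeasure P] in
theorem memLp_two_of_hasLaw {Y : Ω → ℝ} {μ : Measure ℝ} (hY : HasLaw Y μ P) (hμ : MemLp id 2 μ) :
    MemLp Y 2 P := by
  rw [← hY.map_eq] at hμ
  exact (memLp_map_measure_iff hμ.1 hY.aemeasurable).1 hμ

omit [IsProbabilityMeasure P'] in
-- The variables ½(ζ_r² − 1) are independent with a common law, which is centred since Var ζ_r = 1
-- and square integrable since ζ_r has a fourth moment.
theorem exists_isL2Sum_of_gaussian {ι : Type*} {lam : ι → ℝ} (hlam : Summable fun r => lam r ^ 2)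
    {ζ : ι → Ω' → ℝ} (hζ : ∀ r, HasLaw (ζ r) (gaussianReal 0 1) P') (hζi : iIndepFun ζ P') :
    (∀ r, MemLp (fun ω => 1 / 2 * (ζ r ω ^ 2 - 1)) 2 P') ∧ ∃ W,
      IsL2Sum P' (fun r ω => lam r * (1 / 2 * (ζ r ω ^ 2 - 1))) W ∧
      Tendsto (fun s => ∫ ω, (W ω - ∑ r ∈ s, lam r * (1 / 2 * (ζ r ω ^ 2 - 1))) ^ 2 ∂P')
        atTop (𝓝 0) := by
  have hg : Measurable fun x : ℝ => 1 / 2 * (x ^ 2 - 1) := by fun_prop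
  have hVlaw : ∀ r, HasLaw (fun ω => 1 / 2 * (ζ r ω ^ 2 - 1))
      ((gaussianReal 0 1).map fun x : ℝ => 1 / 2 * (x ^ 2 - 1)) P' := fun r =>
    ⟨hg.comp_aemeasurable (hζ r).aemeasurable, by
      rw [← (hζ r).map_eq, AEMeasurable.map_map_of_aemeasurable hg.aemeasurable
        (hζ r).aemeasurable]
      rfl⟩
  have h4 : MemLp (fun x : ℝ => x ^ 2) 2 (gaussianReal 0 1) := by
    rw [memLp_two_iff_integrable_sq (by fun_prop)]
    have := (memLp_id_gaussianReal (μ := 0) (v := 1) 4).integrable_norm_pow (by norm_num)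
    refine this.congr (Eventually.of_forall fun x => ?_)
    simp only [id, Real.norm_eq_abs]
    rw [← pow_mul, show 2 * 2 = 4 from rfl, Even.pow_abs (by decide)]
  have hμ : MemLp id 2 ((gaussianReal 0 1).map fun x : ℝ => 1 / 2 * (x ^ 2 - 1)) := by
    rw [memLp_map_measure_iff (by fun_prop) hg.aemeasurable]
    exact (h4.sub (memLp_const 1)).const_mul (1 / 2)
  have hμ0 : ∫ x, x ∂((gaussianReal 0 1).map fun x : ℝ => 1 / 2 * (x ^ 2 - 1)) = 0 := by
    rw [integral_map hg.aemeasurable (by fun_prop), integral_const_mul,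
      integral_sub (h4.integrable one_le_two) (integrable_const _)]
    have h := variance_id_gaussianReal (μ := 0) (v := 1)
    rw [variance_eq_integral aemeasurable_id] at h
    simp only [id, integral_id_gaussianReal, sub_zero, NNReal.coe_one] at h
    rw [h]
    simp
  refine ⟨fun r => memLp_two_of_hasLaw (hVlaw r) hμ, exists_isL2Sum_of_iid hVlaw ?_ hμ hμ0 hlam⟩
  exact hζi.comp (fun _ x => 1 / 2 * (x ^ 2 - 1)) fun _ => hg

theorem HasInvSqrtCoshCharFun.hasLaw {Y : Ω → ℝ} (hY : HasInvSqrtCoshCharFun P Y) {ρ : Measure ℝ}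
    [IsProbabilityMeasure ρ] (hρ : ∀ t : ℝ, charFun ρ t = ((1 / √(Real.cosh t) : ℝ) : ℂ)) :
    HasLaw Y ρ P := by
  have := Measure.isProbabilityMeasure_map hY.1
  refine ⟨hY.1, Measure.ext_of_charFun (funext fun t => ?_)⟩
  rw [hY.2, hρ]

theorem exists_isL2Sum_of_invSqrtCosh {ι : Type*} {lam : ι → ℝ}
    (hlam : Summable fun r => lam r ^ 2) {ξ : ι → Ω' → ℝ}
    (hξ : ∀ r, HasInvSqrtCoshCharFun P' (ξ r)) (hξi : iIndepFun ξ P') :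
    (∀ r, MemLp (ξ r) 2 P') ∧ ∃ W, IsL2Sum P' (fun r ω => lam r * ξ r ω) W ∧
      Tendsto (fun s => ∫ ω, (W ω - ∑ r ∈ s, lam r * ξ r ω) ^ 2 ∂P') atTop (𝓝 0) := by
  obtain ⟨ρ, hρp, -, hρ⟩ := exists_hasInvSqrtCoshCharFun
  rw [Measure.map_id] at hρ
  have hμ := memLp_two_of_charFun hρ
  exact ⟨fun r => memLp_two_of_hasLaw ((hξ r).hasLaw hρ) hμ,
    exists_isL2Sum_of_iid (fun r => (hξ r).hasLaw hρ) hξi hμ (integral_eq_zero_of_charFun hρ) hlam⟩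

omit [IsProbabilityMeasure P'] in
theorem charFun_map_sum_invSqrtCosh {ι : Type*} {ξ : ι → Ω' → ℝ}
    (hξ : ∀ r, HasInvSqrtCoshCharFun P' (ξ r)) (hξi : iIndepFun ξ P') (lam : ι → ℝ)
    (s : Finset ι) (t : ℝ) :
    charFun (P'.map fun ω => ∑ r ∈ s, lam r * ξ r ω) t
      = ∏ r ∈ s, ((1 / √(Real.cosh (lam r * t)) : ℝ) : ℂ) := by
  have hi : iIndepFun (fun r ω => lam r * ξ r ω) P' :=
    hξi.comp (fun r x => lam r * x) fun r => by fun_prop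
  rw [iIndepFun.charFun_map_fun_finsetSum_eq_prod (fun r _ => (hξ r).1.const_mul _)
    (hi.restrict s), Finset.prod_apply]
  exact Finset.prod_congr rfl fun r _ => by rw [charFun_map_mul_comp (hξ r).1, (hξ r).2]

/-- The limit theorem for the quadratic forms of finite rank with two orthogonal sign sequences. -/
theorem tendstoInDistribution_weightedU_finiteKernel_of_orthogonal
    (hXm : ∀ i, Measurable (X i)) (hXlaw : ∀ i, HasLaw (X i) ν P) (hXindep : iIndepFun X P)
    {ι : Type*} {φ : ι → S → ℝ} (hφ : IsCenteredOrthonormal ν φ) (lam : ι → ℝ) (s : Finset ι)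
    {u v : ℕ → ℝ} (hu : ∀ k, u k ^ 2 = 1) (hv : ∀ k, v k ^ 2 = 1)
    (huv : ∀ m, |∑ k ∈ Finset.range m, u k * v k| ≤ 1)
    {ξ : ι → Ω' → ℝ} (hξ : ∀ r, HasInvSqrtCoshCharFun P' (ξ r)) (hξi : iIndepFun ξ P') :
    TendstoInDistribution (fun (n : ℕ) ω => (n : ℝ)⁻¹ *
        weightedU (fun k l => u k * v l) (finiteKernel lam φ s) n fun i => X i ω) atTop
      (fun ω => ∑ r ∈ s, lam r * ξ r ω) (fun _ => P) P' := by
  have hg := hφ.isDegenerate_finiteKernel lam s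
  refine tendstoInDistribution_of_charFun_approx
    (fun n => (hg.memLp_inv_mul_weightedU hXm hXlaw hXindep _ n).1.aemeasurable)
    (Finset.aemeasurable_fun_sum _ fun r _ => (hξ r).1.const_mul _) fun t ε hε => ?_
  rw [charFun_map_sum_invSqrtCosh hξ hξi]
  have h1 : Tendsto (fun M : ℕ => (M : ℝ)⁻¹ * ∫ p, finiteKernel lam φ s p.1 p.2 ^ 2 ∂(ν.prod ν))
      atTop (𝓝 0) := by
    simpa using (tendsto_inv_atTop_nhds_zero_nat (𝕜 := ℝ)).mul_const _
  -- M is fixed before n → ∞, large enough for both the pairs lost inside blocks and the distance of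
  -- the discrete areas from their limit.
  obtain ⟨M, hM, hM1, hM2⟩ := ((eventually_gt_atTop 0).and
    (((tendsto_mul_sqrt_zero h1 t).eventually_le_const hε).and
      ((tendsto_iff_norm_sub_tendsto_zero.1
        (tendsto_charFun_sum_rowArea lam s t)).eventually_le_const hε))).exists
  have hblock := tendstoInDistribution_weightedU_block hXm hXlaw hXindep hφ lam s hu hv huv hM
  refine ⟨_, _, (tendstoInDistribution_iff_charFun hblock.forall_aemeasurable
    hblock.aemeasurable_limit).1 hblock t, Eventually.of_forall fun n => ?_, hM2⟩
  refine (hg.norm_charFun_weightedU_sub_weight_le hXm hXlaw hXindep (by positivity) ?_ t).trans hM1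
  have h2 : ∀ k l, (u k * v l - u k * v l * if block M n k < block M n l then (1 : ℝ) else 0) ^ 2
      = (1 - if block M n k < block M n l then (1 : ℝ) else 0) ^ 2 := by
    intro k l
    rw [← mul_one_sub, mul_pow, mul_pow, hu, hv, one_mul, one_mul]
  simp_rw [h2]
  exact sum_same_block_le hM

end WeightedU

/-! ### The five statistics as weighted sums over increasing pairs -/

section Statistics

variable {S : Type*} (f : S → S → ℝ) (n : ℕ) (x : ℕ → S)

theorem U_eq_weightedU : U f n x = weightedU (fun _ _ => 1 * 1) f n x := by
  simp [U, weightedU]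

theorem Umm_eq_weightedU :
    Umm f n x = weightedU (fun k l => (-1) ^ (k + 1) * (-1) ^ (l + 1)) f n x := by
  simp only [Umm, weightedU, pow_add]

theorem Upm_eq_weightedU : Upm f n x = weightedU (fun _ l => 1 * (-1) ^ (l + 1)) f n x := by
  simp only [Upm, weightedU, one_mul]

theorem Ump_eq_weightedU : Ump f n x = weightedU (fun k _ => (-1) ^ (k + 1 + 1) * 1) f n x := by
  simp only [Ump, weightedU, mul_one]

/-- The second index m = (k + j) mod n replaces the step j. Without wrapping, m > k and j = m − k;
with wrapping, m < k and j = n − (k − m), so 2j < n becomes n < 2(k − m). -/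
theorem sum_cyclic_eq (G : ℕ → ℝ) {n k : ℕ} (hk : k < n) :
    ∑ j ∈ (Finset.range n).filter (fun j => 1 ≤ j ∧ 2 * j < n), G ((k + j) % n)
      = ∑ m ∈ (Finset.range n).filter
          (fun m => k < m ∧ 2 * (m - k) < n ∨ m < k ∧ n < 2 * (k - m)), G m := by
  refine Finset.sum_nbij' (fun j => (k + j) % n) (fun m => if k < m then m - k else n + m - k)
    ?_ ?_ ?_ ?_ fun _ _ => rfl
  · intro j hj
    simp only [Finset.mem_filter, Finset.mem_range] at hj ⊢
    refine ⟨Nat.mod_lt _ (by omega), ?_⟩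
    rcases lt_or_ge (k + j) n with h | h
    · rw [Nat.mod_eq_of_lt h]
      omega
    · rw [Nat.mod_eq_sub_mod h, Nat.mod_eq_of_lt (by omega)]
      omega
  · intro m hm
    simp only [Finset.mem_filter, Finset.mem_range] at hm ⊢
    split_ifs <;> omega
  · intro j hj
    simp only [Finset.mem_filter, Finset.mem_range] at hj
    rcases lt_or_ge (k + j) n with h | h
    · rw [Nat.mod_eq_of_lt h]
      split_ifs <;> omega
    · rw [Nat.mod_eq_sub_mod h, Nat.mod_eq_of_lt (by omega)]
      split_ifs <;> omega
  · intro m hm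
    simp only [Finset.mem_filter, Finset.mem_range] at hm
    split_ifs with h
    · rw [Nat.add_sub_cancel' h.le, Nat.mod_eq_of_lt hm.1]
    · rw [show k + (n + m - k) = n + m by omega, Nat.add_mod_left, Nat.mod_eq_of_lt hm.1]

theorem sum_sum_range_lt (G : ℕ → ℕ → ℝ) (n : ℕ) :
    ∑ l ∈ Finset.range n, ∑ k ∈ Finset.range l, G k l
      = ∑ l ∈ Finset.range n, ∑ k ∈ Finset.range n, if k < l then G k l else 0 := by
  refine Finset.sum_congr rfl fun l hl => ?_
  rw [← Finset.sum_filter]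
  refine Finset.sum_congr ?_ fun _ _ => rfl
  ext k
  have := Finset.mem_range.1 hl
  simp only [Finset.mem_filter, Finset.mem_range]
  omega

/-- For a kernel which is symmetric on the sample, the cyclic statistic misses only the pairs of
antipodal observations. -/
theorem Uc_eq_weightedU (h : ∀ k l, k ≠ l → f (x k) (x l) = f (x l) (x k)) :
    Uc f n x = weightedU (fun k l => 1 * 1 - if 2 * (l - k) = n then 1 else 0) f n x := by
  have h1 : Uc f n x = ∑ k ∈ Finset.range n, ∑ m ∈ Finset.range n,
      ((if k < m ∧ 2 * (m - k) < n then f (x k) (x m) else 0)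
        + if m < k ∧ n < 2 * (k - m) then f (x k) (x m) else 0) := by
    refine Finset.sum_congr rfl fun k hk => ?_
    rw [sum_cyclic_eq (fun m => f (x k) (x m)) (Finset.mem_range.1 hk), Finset.sum_filter]
    refine Finset.sum_congr rfl fun m _ => ?_
    rcases lt_trichotomy k m with h | h | h
    · simp [h, h.not_gt]
    · simp [h]
    · simp [h, h.not_gt]
  simp only [h1, weightedU, Finset.sum_add_distrib]
  -- The wrapped terms are transposed, so that each pair k < l is met once: directly if 2(l − k) <
  -- n, by wrapping if 2(l − k) > n, and never in the case of equality.
  rw [sum_sum_range_lt, Finset.sum_comm, ← Finset.sum_add_distrib]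
  refine Finset.sum_congr rfl fun l _ => ?_
  rw [← Finset.sum_add_distrib]
  refine Finset.sum_congr rfl fun k _ => ?_
  by_cases hkl : k < l
  · rw [if_pos hkl, h l k hkl.ne']
    rcases lt_trichotomy (2 * (l - k)) n with h2 | h2 | h2
    · simp [hkl, h2, h2.not_gt, h2.ne]
    · simp [h2]
    · simp [hkl, h2, h2.not_gt, h2.ne']
  · simp [hkl]

theorem sum_antipodal_sq_le :
    ∑ l ∈ Finset.range n, ∑ k ∈ Finset.range l, (if 2 * (l - k) = n then (1 : ℝ) else 0) ^ 2
      ≤ n := by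
  have h1 : ∀ l ∈ Finset.range n,
      ∑ k ∈ Finset.range l, (if 2 * (l - k) = n then (1 : ℝ) else 0) ^ 2 ≤ 1 := by
    intro l _
    simp only [ite_pow, one_pow, ne_eq, OfNat.ofNat_ne_zero, not_false_eq_true, zero_pow]
    rw [← Finset.sum_filter, Finset.sum_const, nsmul_eq_mul, mul_one]
    have : ((Finset.range l).filter fun k => 2 * (l - k) = n).card ≤ 1 := by
      rw [Finset.card_le_one]
      intro a ha b hb
      simp only [Finset.mem_filter, Finset.mem_range] at ha hb
      omega
    exact_mod_cast this
  exact (Finset.sum_le_card_nsmul _ _ _ h1).trans_eq (by simp)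

end Statistics

theorem abs_sum_neg_one_pow_add_le (a m : ℕ) :
    |∑ k ∈ Finset.range m, (-1 : ℝ) ^ (k + a)| ≤ 1 := by
  simp_rw [pow_add]
  rw [← Finset.sum_mul, neg_one_geom_sum, abs_mul, abs_pow, abs_neg, abs_one, one_pow, mul_one]
  split_ifs <;> simp

/-! ### Limit theorems for symmetric degenerate kernels -/

section Limits

variable {S Ω Ω' : Type*} [MeasurableSpace S] [MeasurableSpace Ω] [MeasurableSpace Ω']
  {ν : Measure S} [IsProbabilityMeasure ν] {P : Measure Ω} [IsProbabilityMeasure P]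
  {P' : Measure Ω'} [IsProbabilityMeasure P'] {X : ℕ → Ω → S} {f : S → S → ℝ}

/-- `W` is chosen before the signs `w`, so that the different statistics share one limit variable.
-/
theorem IsDegenerate.exists_limit_gaussian (hf : IsDegenerate ν f)
    (hsymm : ∀ᵐ p ∂(ν.prod ν), f p.1 p.2 = f p.2 p.1)
    (hXm : ∀ i, Measurable (X i)) (hXlaw : ∀ i, HasLaw (X i) ν P) (hXindep : iIndepFun X P)
    {ι : Type*} {lam : ι → ℝ} (hlam : IsNonzeroEigenvalues (integralOperator f hf.memLp) lam)
    {ζ : ι → Ω' → ℝ} (hζ : ∀ r, HasLaw (ζ r) (gaussianReal 0 1) P') (hζi : iIndepFun ζ P') :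
    ∃ W, IsL2Sum P' (fun r ω => 1 / 2 * lam r * (ζ r ω ^ 2 - 1)) W ∧
      ∀ w : ℕ → ℝ, (∀ k, w k ^ 2 = 1) →
        TendstoInDistribution (fun (n : ℕ) ω =>
          (n : ℝ)⁻¹ * weightedU (fun k l => w k * w l) f n fun i => X i ω) atTop W
          (fun _ => P) P' := by
  obtain ⟨φ, hφ, hsum, hfφ⟩ := hf.exists_eigenfunctions hsymm hlam
  obtain ⟨hV, W, hW, hVW⟩ := exists_isL2Sum_of_gaussian hsum hζ hζi
  have hcomm : ∀ r ω, lam r * (1 / 2 * (ζ r ω ^ 2 - 1)) = 1 / 2 * lam r * (ζ r ω ^ 2 - 1) :=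
    fun r ω => by ring
  refine ⟨W, by simpa only [hcomm] using hW, fun w hw => ?_⟩
  refine hf.tendstoInDistribution_weightedU_of_finiteKernel hXm hXlaw hXindep hφ hfφ hV hW.1 hVW
    (fun k l => by rw [mul_pow, hw, hw, one_mul]) fun s => ?_
  simp only [hcomm]
  exact tendstoInDistribution_weightedU_finiteKernel hXm hXlaw hXindep hφ lam s hw hζ hζi

theorem IsDegenerate.exists_limit_invSqrtCosh (hf : IsDegenerate ν f)
    (hsymm : ∀ᵐ p ∂(ν.prod ν), f p.1 p.2 = f p.2 p.1)
    (hXm : ∀ i, Measurable (X i)) (hXlaw : ∀ i, HasLaw (X i) ν P) (hXindep : iIndepFun X P)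
    {ι : Type*} {lam : ι → ℝ} (hlam : IsNonzeroEigenvalues (integralOperator f hf.memLp) lam)
    {ξ : ι → Ω' → ℝ} (hξ : ∀ r, HasInvSqrtCoshCharFun P' (ξ r)) (hξi : iIndepFun ξ P') :
    ∃ W, IsL2Sum P' (fun r ω => lam r * ξ r ω) W ∧
      ∀ u v : ℕ → ℝ, (∀ k, u k ^ 2 = 1) → (∀ k, v k ^ 2 = 1) →
        (∀ m, |∑ k ∈ Finset.range m, u k * v k| ≤ 1) →
        TendstoInDistribution (fun (n : ℕ) ω =>
          (n : ℝ)⁻¹ * weightedU (fun k l => u k * v l) f n fun i => X i ω) atTop W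
          (fun _ => P) P' := by
  obtain ⟨φ, hφ, hsum, hfφ⟩ := hf.exists_eigenfunctions hsymm hlam
  obtain ⟨hV, W, hW, hVW⟩ := exists_isL2Sum_of_invSqrtCosh hsum hξ hξi
  refine ⟨W, hW, fun u v hu hv huv => ?_⟩
  exact hf.tendstoInDistribution_weightedU_of_finiteKernel hXm hXlaw hXindep hφ hfφ hV hW.1 hVW
    (fun k l => by rw [mul_pow, hu, hv, one_mul]) fun s =>
    tendstoInDistribution_weightedU_finiteKernel_of_orthogonal hXm hXlaw hXindep hφ lam s hu hv
      huv hξ hξi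

omit [IsProbabilityMeasure ν] in
theorem ae_symm_sample (hsymm : ∀ᵐ p ∂(ν.prod ν), f p.1 p.2 = f p.2 p.1)
    (hXm : ∀ i, Measurable (X i)) (hXlaw : ∀ i, HasLaw (X i) ν P) (hXindep : iIndepFun X P) :
    ∀ᵐ ω ∂P, ∀ k l, k ≠ l → f (X k ω) (X l ω) = f (X l ω) (X k ω) := by
  simp only [ae_all_iff, eventually_imp_distrib_left]
  intro k l hkl
  have h := hasLaw_pair hXm hXlaw hXindep hkl
  rw [← h.map_eq] at hsymm
  exact ae_of_ae_map h.aemeasurable hsymm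

/-- The limits of the cyclic and of the ordinary `U`-statistic are the same. -/
theorem IsDegenerate.tendstoInDistribution_Uc (hf : IsDegenerate ν f)
    (hsymm : ∀ᵐ p ∂(ν.prod ν), f p.1 p.2 = f p.2 p.1)
    (hXm : ∀ i, Measurable (X i)) (hXlaw : ∀ i, HasLaw (X i) ν P) (hXindep : iIndepFun X P)
    {W : Ω' → ℝ}
    (h : TendstoInDistribution (fun (n : ℕ) ω =>
      (n : ℝ)⁻¹ * weightedU (fun _ _ => 1 * 1) f n fun i => X i ω) atTop W (fun _ => P) P') :
    TendstoInDistribution (fun (n : ℕ) ω => (n : ℝ)⁻¹ * Uc f n fun i => X i ω) atTop W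
      (fun _ => P) P' := by
  have hmem := fun (c : ℕ → ℕ → ℝ) (n : ℕ) =>
    hf.memLp_inv_mul_weightedU hXm hXlaw hXindep c n
  -- The omitted antipodal pairs depend on n. There are at most n of them, so after division by n
  -- their sum has second moment at most ‖f‖² / n.
  let c : ℕ → ℕ → ℕ → ℝ := fun n k l => 1 * 1 - if 2 * (l - k) = n then 1 else 0
  have key : TendstoInDistribution (fun (n : ℕ) ω =>
      (n : ℝ)⁻¹ * weightedU (c n) f n fun i => X i ω) atTop W (fun _ => P) P' := by
    refine tendstoInDistribution_of_integral_sub_sq h (fun n => (hmem _ n).1.aemeasurable)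
      (fun n => (hmem _ n).sub (hmem _ n)) ?_
    have h0 : Tendsto (fun n : ℕ => (n : ℝ)⁻¹ * ∫ p, f p.1 p.2 ^ 2 ∂(ν.prod ν)) atTop (𝓝 0) := by
      simpa using (tendsto_inv_atTop_nhds_zero_nat (𝕜 := ℝ)).mul_const _
    refine squeeze_zero (fun n => integral_nonneg fun _ => sq_nonneg _) (fun n => ?_) h0
    have h1 := hf.integral_inv_mul_weightedU_sq_le hXm hXlaw hXindep (n := n)
      (c := fun k l => c n k l - 1 * 1) (B := (n : ℝ)⁻¹) (by positivity) (by
        simp only [c, sub_sub_cancel_left, neg_sq]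
        refine (sum_antipodal_sq_le n).trans_eq ?_
        rw [sq, mul_self_mul_inv])
    simp only [weightedU_sub_weight, mul_sub] at h1
    exact h1
  refine key.congr (fun n => ?_) (EventuallyEq.refl _ _)
  filter_upwards [ae_symm_sample hsymm hXm hXlaw hXindep] with ω hω
  rw [Uc_eq_weightedU f n _ hω]

end Limits

end UStat

theorem corollary7p1
    {S Ω : Type*} [MeasurableSpace S] [MeasurableSpace Ω]
    (ν : Measure S) [IsProbabilityMeasure ν]
    (P : Measure Ω) [IsProbabilityMeasure P]
    -- the i.i.d. sample with the common distribution `ν`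
    (X : ℕ → Ω → S) (hXlaw : ∀ i, HasLaw (X i) ν P) (hXindep : iIndepFun X P)
    -- the square integrable kernel
    (f : S → S → ℝ) (hfm : Measurable (Function.uncurry f))
    (hf : MemLp (Function.uncurry f) 2 (ν.prod ν))
    -- `f` is symmetric and `f = f₁₂` (almost everywhere)
    (hsymm : ∀ᵐ p ∂(ν.prod ν), f p.1 p.2 = f p.2 p.1)
    (hdeg : ∀ᵐ p ∂(ν.prod ν), f p.1 p.2 = UStat.hoeffding12 ν f p.1 p.2) :
    -- the objects in the result exist: the sequence of eigenvalues, and the law of `ξ`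
    (∃ (R : ℕ∞) (lam : UStat.Idx R → ℝ),
      UStat.IsNonzeroEigenvalues (UStat.integralOperator f hf) lam) ∧
    (∃ ρ : Measure ℝ, IsProbabilityMeasure ρ ∧ UStat.HasInvSqrtCoshCharFun ρ id) ∧
    -- the limit theorems
    ∀ (R : ℕ∞) (lam : UStat.Idx R → ℝ),
      UStat.IsNonzeroEigenvalues (UStat.integralOperator f hf) lam →
      (∀ {Ω' : Type*} [MeasurableSpace Ω'] (P' : Measure Ω') [IsProbabilityMeasure P']
        (ζ : UStat.Idx R → Ω' → ℝ),
        (∀ r, HasLaw (ζ r) (gaussianReal 0 1) P') → iIndepFun ζ P' →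
        ∃ W : Ω' → ℝ,
          UStat.IsL2Sum P' (fun r ω => 1 / 2 * lam r * (ζ r ω ^ 2 - 1)) W ∧
          TendstoInDistribution
            (fun (n : ℕ) ω => (n : ℝ)⁻¹ * UStat.U f n (fun i => X i ω)) atTop W
            (fun _ => P) P' ∧
          TendstoInDistribution
            (fun (n : ℕ) ω => (n : ℝ)⁻¹ * UStat.Uc f n (fun i => X i ω)) atTop W
            (fun _ => P) P' ∧
          TendstoInDistribution
            (fun (n : ℕ) ω => (n : ℝ)⁻¹ * UStat.Umm f n (fun i => X i ω)) atTop W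
            (fun _ => P) P') ∧
      (∀ {Ω' : Type*} [MeasurableSpace Ω'] (P' : Measure Ω') [IsProbabilityMeasure P']
        (ξ : UStat.Idx R → Ω' → ℝ),
        (∀ r, UStat.HasInvSqrtCoshCharFun P' (ξ r)) → iIndepFun ξ P' →
        ∃ W : Ω' → ℝ,
          UStat.IsL2Sum P' (fun r ω => lam r * ξ r ω) W ∧
          TendstoInDistribution
            (fun (n : ℕ) ω => (n : ℝ)⁻¹ * UStat.Upm f n (fun i => X i ω)) atTop W
            (fun _ => P) P' ∧
          TendstoInDistribution
            (fun (n : ℕ) ω => (n : ℝ)⁻¹ * UStat.Ump f n (fun i => X i ω)) atTop W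
            (fun _ => P) P') := by
  have hd := UStat.isDegenerate_of_ae_eq_hoeffding12 hfm hf hdeg
  -- `HasLaw` gives only almost everywhere measurability. Measurable versions are used instead, and
  -- almost surely the whole sample is unchanged.
  let Y : ℕ → Ω → S := fun i => (hXlaw i).aemeasurable.mk (X i)
  have hYX : ∀ i, X i =ᵐ[P] Y i := fun i => (hXlaw i).aemeasurable.ae_eq_mk
  have hYm : ∀ i, Measurable (Y i) := fun i => (hXlaw i).aemeasurable.measurable_mk
  have hYlaw : ∀ i, HasLaw (Y i) ν P := fun i => (hXlaw i).congr (hYX i).symm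
  have hYindep : iIndepFun Y P := hXindep.congr hYX
  have hsample : ∀ᵐ ω ∂P, (fun i => Y i ω) = fun i => X i ω := by
    filter_upwards [ae_all_iff.2 hYX] with ω hω
    exact funext fun i => (hω i).symm
  refine ⟨UStat.exists_isNonzeroEigenvalues hf hsymm, UStat.exists_hasInvSqrtCoshCharFun,
    fun R lam hlam => ⟨?_, ?_⟩⟩
  · intro Ω' _ P' _ ζ hζ hζi
    obtain ⟨W, hW, hlim⟩ := hd.exists_limit_gaussian hsymm hYm hYlaw hYindep hlam hζ hζi
    have h1 := hlim (fun _ => 1) fun _ => one_pow 2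
    refine ⟨W, hW, ?_, ?_, ?_⟩
    · refine h1.congr (fun n => ?_) (EventuallyEq.refl _ _)
      filter_upwards [hsample] with ω hω
      rw [UStat.U_eq_weightedU, hω]
    · refine (hd.tendstoInDistribution_Uc hsymm hYm hYlaw hYindep h1).congr (fun n => ?_)
        (EventuallyEq.refl _ _)
      filter_upwards [hsample] with ω hω
      rw [hω]
    · refine (hlim (fun k => (-1) ^ (k + 1)) fun k => ?_).congr (fun n => ?_)
        (EventuallyEq.refl _ _)
      · rw [pow_right_comm, neg_one_sq, one_pow]
      · filter_upwards [hsample] with ω hω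
        rw [UStat.Umm_eq_weightedU, hω]
  · intro Ω' _ P' _ ξ hξ hξi
    obtain ⟨W, hW, hlim⟩ := hd.exists_limit_invSqrtCosh hsymm hYm hYlaw hYindep hlam hξ hξi
    refine ⟨W, hW, ?_, ?_⟩
    · refine (hlim (fun _ => 1) (fun k => (-1) ^ (k + 1)) (fun _ => one_pow 2) (fun k => ?_)
        fun m => ?_).congr (fun n => ?_) (EventuallyEq.refl _ _)
      · rw [pow_right_comm, neg_one_sq, one_pow]
      · simpa only [one_mul] using UStat.abs_sum_neg_one_pow_add_le 1 m
      · filter_upwards [hsample] with ω hω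
        rw [UStat.Upm_eq_weightedU, hω]
    · refine (hlim (fun k => (-1) ^ (k + 1 + 1)) (fun _ => 1) (fun k => ?_) (fun _ => one_pow 2)
        fun m => ?_).congr (fun n => ?_) (EventuallyEq.refl _ _)
      · rw [pow_right_comm, neg_one_sq, one_pow]
      · simpa only [mul_one] using UStat.abs_sum_neg_one_pow_add_le 2 m
      · filter_upwards [hsample] with ω hω
        rw [UStat.Ump_eq_weightedU, hω]
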